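/- **Setting.** A *structure* $\mathcal S$ on $n$ nodes is a directed acyclic graph on $[n]$; its degree is its maximum in-degree and its skeleton is the underlying undirected graph. A distribution $P$ over $\{0,1\}^n$ is a *Bayes net with structure $\mathcal S$* (is *expressible* with $\mathcal S$) if, for $X\sim P$, every $X_i$ is independent of its other non-descendants conditioned on its parents in $\mathcal S$. Nodes $X_i,X_j$ are *$\gamma$-far from independent conditioned on $X_T$* under $P$ if $X_i,X_j$ are not independent conditioned on $X_T$ under any distribution $Q$ over $\{0,1\}^n$ with $d_{\mathrm{TV}}(P,Q)<\gamma$. $P$ is *$\gamma$-non-degenerate with respect to $\mathcal S$ and degree $d$* if $X_i,X_j$ are $\gamma$-far from independent conditioned on $X_T$ for all nodes $i\ne j$ and all $T\subseteq[n]\setminus\{i,j\}$ with $|T|\le d$ such that, in $\mathcal S$, one of the following holds: (a) $i$ is a parent of $j$; (b) some $k\in T$ is a child of both $i$ and $j$; (c) some $k\notin T$ is a child of $i$ and a parent of $j$; (d) some $k\notin T$ is a parent of both $i$ and $j$. **Theorem.** There are one algorithm (a program for a real RAM with unit-cost operations and sample access) and an absolute constant $C>0$ such that the following holds for all integers $n\ge1$,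 $d\ge0$, all $\gamma\in(0,1]$ and all structures $\mathcal S$ on $n$ nodes of degree at most $d$. Given $n$, $d$, $\gamma$ and the adjacency matrix of $\mathcal S$, and independent samples from an unknown distribution over $\{0,1\}^n$, the algorithm uses at most $C\,(2^d+d\log_2 n)/\gamma^2$ samples, always halts within time $C\,n^{d+3}/\gamma^2$, and needs only machine words of $C\log_2(2+d+n^{d+3}/\gamma^2)$ bits. Moreover, let $P$ be a Bayes net with some (unknown) structure $\mathcal S'$ of degree at most $d$ whose skeleton has no more edges than that of $\mathcal S$. 1. If $P$ is expressible with structure $\mathcal S$ and is $\gamma$-non-degenerate with respect to $\mathcal S$ and degree $d$, the algorithm accepts with probability at least $99/100$. 2. If $P$ is not expressible with structure $\mathcal S$, the algorithm rejects with probability at least $99/100$. (The real RAM has a word memory and a real memory, both addressed by words; in unit time it performs integer arithmetic on words, exact field operations and comparisons of reals, conversion of a word to a real, or reads one bit of the latest sample; there is no rounding of reals. Drawing a new sample takes time $n$.) -/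

import Mathlib

/-! ### Bayes nets over `{0,1}^n` -/

/-- The cube `{0,1}^n`. -/
abbrev Cube (n : ℕ) : Type := Fin n → Bool

/-- A structure: a directed acyclic graph on the nodes `0, …, n - 1`, given by its parent sets
(there is an edge `i → j` iff `i ∈ parents j`). -/
structure BayesStructure (n : ℕ) where
  parents : Fin n → Finset (Fin n)
  acyclic : ∀ i, ¬ Relation.TransGen (fun a b => a ∈ parents b) i i

namespace BayesStructure

variable {n : ℕ}

/-- There is an edge `i → j`: `i` is a parent of `j`, and `j` is a child of `i`. -/
def Edge (S : BayesStructure n) (i j : Fin n) : Prop := i ∈ S.parents j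

/-- `j` is a descendant of `i`: there is a directed path of positive length from `i` to `j`. -/
def Descendant (S : BayesStructure n) (i j : Fin n) : Prop := Relation.TransGen S.Edge i j

/-- The degree (maximum in-degree) of the structure is at most `d`. -/
def DegreeAtMost (S : BayesStructure n) (d : ℕ) : Prop := ∀ i, (S.parents i).card ≤ d

/-- The skeleton: the underlying undirected graph. -/
def skeleton (S : BayesStructure n) : SimpleGraph (Fin n) := SimpleGraph.fromRel S.Edge

/-- The number of edges of the skeleton. -/
noncomputable def numEdges (S : BayesStructure n) : ℕ := S.skeleton.edgeSet.ncard

open Classical in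
/-- The nodes that are neither `i`, nor descendants of `i`, nor parents of `i`. -/
noncomputable def otherNondescendants (S : BayesStructure n) (i : Fin n) : Finset (Fin n) :=
  Finset.univ.filter fun j => j ≠ i ∧ ¬ S.Descendant i j ∧ j ∉ S.parents i

end BayesStructure

/-- The marginal probability `Pr_{X ∼ P}[X_D = x_D]`. -/
noncomputable def marginalProb {n : ℕ} (P : PMF (Cube n)) (D : Finset (Fin n)) (x : Cube n) : ℝ :=
  ∑ y ∈ Finset.univ.filter (fun y : Cube n => ∀ k ∈ D, y k = x k), (P y).toReal

/-- Under `P`, the vectors `X_A` and `X_B` are independent conditioned on `X_T`, i.e.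
`Pr[X_A, X_B | X_T] = Pr[X_A | X_T] Pr[X_B | X_T]` for every configuration of `X_T` of positive
probability (written without denominators). -/
def CondIndep {n : ℕ} (P : PMF (Cube n)) (A B T : Finset (Fin n)) : Prop :=
  ∀ x : Cube n,
    marginalProb P (A ∪ B ∪ T) x * marginalProb P T x =
      marginalProb P (A ∪ T) x * marginalProb P (B ∪ T) x

/-- `P` can be expressed as a Bayes net with structure `S`: every node is independent of all the
other non-descendant nodes once its parents are fixed. -/
def IsBayesNet {n : ℕ} (P : PMF (Cube n)) (S : BayesStructure n) : Prop :=
  ∀ i, CondIndep P {i} (S.otherNondescendants i) (S.parents i)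

/-- Total variation distance. -/
noncomputable def tvDist {n : ℕ} (P Q : PMF (Cube n)) : ℝ :=
  (1 / 2) * ∑ x, |(P x).toReal - (Q x).toReal|

/-- `X_i` and `X_j` are `γ`-far from independent conditioned on `X_T`. -/
def FarFromCondIndep {n : ℕ} (P : PMF (Cube n)) (γ : ℝ) (i j : Fin n) (T : Finset (Fin n)) :
    Prop :=
  ∀ Q : PMF (Cube n), tvDist P Q < γ → ¬ CondIndep Q {i} {j} T

/-- `P` is `γ`-non-degenerate with respect to the structure `S` and degree `d`. -/
def NonDegenerate {n : ℕ} (P : PMF (Cube n)) (γ : ℝ) (S : BayesStructure n) (d : ℕ) : Prop :=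
  ∀ (i j : Fin n) (T : Finset (Fin n)), i ≠ j → T.card ≤ d → i ∉ T → j ∉ T →
    (S.Edge i j ∨
      (∃ k ∈ T, S.Edge i k ∧ S.Edge j k) ∨
      (∃ k, k ∉ T ∧ S.Edge i k ∧ S.Edge k j) ∨
      (∃ k, k ∉ T ∧ S.Edge k i ∧ S.Edge k j)) →
    FarFromCondIndep P γ i j T

/-! ### Real random access machines with sample access

A program works on a word memory (natural numbers below `2 ^ w`, `w` being the word length) and
on a real memory, both addressed by words; registers are memory cells with a fixed address.
Real numbers are only combined by field operations and compared; there is no rounding. Samples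
are obtained one at a time, and the bits of the latest sample can be read individually.
Every primitive operation takes one unit of time, except that drawing a sample takes time `n`. -/

/-- Word-valued expressions: constants, a memory cell, arithmetic (truncated subtraction, integer
division), and the bit of the latest sample at a given index. -/
inductive WordExpr where
  | lit (c : ℕ)
  | cell (addr : WordExpr)
  | add (a b : WordExpr)
  | sub (a b : WordExpr)
  | mul (a b : WordExpr)
  | div (a b : WordExpr)
  | mod (a b : WordExpr)
  | sampleBit (index : WordExpr)

/-- Real-valued expressions: words converted to reals, a memory cell, and arithmetic. -/
inductive RealExpr where
  | ofWord (a : WordExpr)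
  | cell (addr : WordExpr)
  | add (a b : RealExpr)
  | sub (a b : RealExpr)
  | mul (a b : RealExpr)
  | div (a b : RealExpr)

/-- Tests: strict comparisons of words or of reals, and negation. -/
inductive BoolExpr where
  | wordLt (a b : WordExpr)
  | realLt (a b : RealExpr)
  | not (t : BoolExpr)

/-- Programs. -/
inductive Prog where
  | skip
  | setWord (addr val : WordExpr)
  | setReal (addr : WordExpr) (val : RealExpr)
  | draw
  | seq (p q : Prog)
  | ite (t : BoolExpr) (p q : Prog)
  | while (t : BoolExpr) (p : Prog)

/-- A state of the machine: the two memories, the latest sample, and the samples that have not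
been drawn yet. -/
structure MachineState (n : ℕ) where
  word : ℕ → ℕ
  real : ℕ → ℝ
  sample : Cube n
  rest : List (Cube n)

namespace WordExpr

/-- The value of a word expression. -/
def eval {n : ℕ} (s : MachineState n) : WordExpr → ℕ
  | lit c => c
  | cell a => s.word (a.eval s)
  | add a b => a.eval s + b.eval s
  | sub a b => a.eval s - b.eval s
  | mul a b => a.eval s * b.eval s
  | div a b => a.eval s / b.eval s
  | mod a b => a.eval s % b.eval s
  | sampleBit a => if h : a.eval s < n then (s.sample ⟨a.eval s, h⟩).toNat else 0

/-- The number of operations needed to evaluate a word expression. -/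
def cost : WordExpr → ℕ
  | lit _ => 1
  | cell a => a.cost + 1
  | add a b => a.cost + b.cost + 1
  | sub a b => a.cost + b.cost + 1
  | mul a b => a.cost + b.cost + 1
  | div a b => a.cost + b.cost + 1
  | mod a b => a.cost + b.cost + 1
  | sampleBit a => a.cost + 1

end WordExpr

namespace RealExpr

/-- The value of a real expression. -/
noncomputable def eval {n : ℕ} (s : MachineState n) : RealExpr → ℝ
  | ofWord a => (a.eval s : ℝ)
  | cell a => s.real (a.eval s)
  | add a b => a.eval s + b.eval s
  | sub a b => a.eval s - b.eval s
  | mul a b => a.eval s * b.eval s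
  | div a b => a.eval s / b.eval s

/-- The number of operations needed to evaluate a real expression. -/
def cost : RealExpr → ℕ
  | ofWord a => a.cost + 1
  | cell a => a.cost + 1
  | add a b => a.cost + b.cost + 1
  | sub a b => a.cost + b.cost + 1
  | mul a b => a.cost + b.cost + 1
  | div a b => a.cost + b.cost + 1

end RealExpr

namespace BoolExpr

/-- The outcome of a test. -/
def Holds {n : ℕ} (s : MachineState n) : BoolExpr → Prop
  | wordLt a b => a.eval s < b.eval s
  | realLt a b => a.eval s < b.eval s
  | not t => ¬ t.Holds s

/-- The number of operations needed to evaluate a test. -/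
def cost : BoolExpr → ℕ
  | wordLt a b => a.cost + b.cost + 1
  | realLt a b => a.cost + b.cost + 1
  | not t => t.cost + 1

end BoolExpr

/-- `Exec w p s s' t`: on a machine of word length `w`, the program `p` started in state `s` halts
in state `s'` after time `t`. An execution gets stuck (and does not halt) when it writes a word
that is not smaller than `2 ^ w`, writes at an address that is not smaller than `2 ^ w`, or draws
more samples than are available. -/
inductive Exec {n : ℕ} (w : ℕ) : Prog → MachineState n → MachineState n → ℕ → Prop
  | skip (s : MachineState n) : Exec w .skip s s 1
  | setWord (a v : WordExpr) (s : MachineState n) :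
      a.eval s < 2 ^ w → v.eval s < 2 ^ w →
      Exec w (.setWord a v) s { s with word := Function.update s.word (a.eval s) (v.eval s) }
        (a.cost + v.cost + 1)
  | setReal (a : WordExpr) (v : RealExpr) (s : MachineState n) :
      a.eval s < 2 ^ w →
      Exec w (.setReal a v) s { s with real := Function.update s.real (a.eval s) (v.eval s) }
        (a.cost + v.cost + 1)
  | draw (s : MachineState n) (x : Cube n) (l : List (Cube n)) :
      s.rest = x :: l →
      Exec w .draw s { s with sample := x, rest := l } n
  | seq (p q : Prog) (s s₁ s₂ : MachineState n) (t₁ t₂ : ℕ) :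
      Exec w p s s₁ t₁ → Exec w q s₁ s₂ t₂ → Exec w (.seq p q) s s₂ (t₁ + t₂)
  | iteTrue (b : BoolExpr) (p q : Prog) (s s' : MachineState n) (t : ℕ) :
      b.Holds s → Exec w p s s' t → Exec w (.ite b p q) s s' (b.cost + t + 1)
  | iteFalse (b : BoolExpr) (p q : Prog) (s s' : MachineState n) (t : ℕ) :
      ¬ b.Holds s → Exec w q s s' t → Exec w (.ite b p q) s s' (b.cost + t + 1)
  | whileTrue (b : BoolExpr) (p : Prog) (s s₁ s₂ : MachineState n) (t₁ t₂ : ℕ) :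
      b.Holds s → Exec w p s s₁ t₁ → Exec w (.while b p) s₁ s₂ t₂ →
      Exec w (.while b p) s s₂ (b.cost + t₁ + t₂ + 1)
  | whileFalse (b : BoolExpr) (p : Prog) (s : MachineState n) :
      ¬ b.Holds s → Exec w (.while b p) s s (b.cost + 1)

/-- The initial state on input `(S, d, γ)` with the samples `ω`: the word memory holds `n`, then
`d`, then the `n × n` adjacency matrix of `S` row by row; the real memory holds `γ` at address `0`.
All other cells are zero. -/
noncomputable def startState {n m : ℕ} (S : BayesStructure n) (d : ℕ) (γ : ℝ)
    (ω : Fin m → Cube n) : MachineState n where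
  word a :=
    if a = 0 then n
    else if a = 1 then d
    else if ∃ i j : Fin n, a = 2 + i * n + j ∧ i ∈ S.parents j then 1
    else 0
  real a := if a = 0 then γ else 0
  sample := fun _ => false
  rest := List.ofFn ω

/-- On a machine of word length `w`, the program `p` halts on input `(S, d, γ)` and samples `ω`, and
accepts, i.e. it leaves a nonzero word at address `0`. -/
def Accepts {n m : ℕ} (p : Prog) (w : ℕ) (S : BayesStructure n) (d : ℕ) (γ : ℝ)
    (ω : Fin m → Cube n) : Prop :=
  ∃ s t, Exec w p (startState S d γ ω) s t ∧ s.word 0 ≠ 0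

/-- On a machine of word length `w`, the program `p` halts on input `(S, d, γ)` and samples `ω`, and
rejects, i.e. it leaves a zero at address `0`. -/
def Rejects {n m : ℕ} (p : Prog) (w : ℕ) (S : BayesStructure n) (d : ℕ) (γ : ℝ)
    (ω : Fin m → Cube n) : Prop :=
  ∃ s t, Exec w p (startState S d γ ω) s t ∧ s.word 0 = 0

/-- The law of `m` independent samples from `P`. -/
noncomputable def sampleLaw {n : ℕ} (P : PMF (Cube n)) (m : ℕ) :
    MeasureTheory.Measure (Fin m → Cube n) :=
  MeasureTheory.Measure.pi fun _ => P.toMeasure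

/-! ### Marginals -/

section Marginals

variable {n : ℕ} (P : PMF (Cube n))

/-! The tester rests on an exact structural fact. Under a Bayes net with structure `S'` of degree at
most `d`, two nodes that are not adjacent in `S'` are independent given the parents of one of them,
a set of at most `d` nodes. Suppose that no triple `(i, j, T)` that is relevant for `S` and has `|T|
≤ d` is conditionally independent. Then no edge of `S` is missing from the skeleton of `S'`, and
since `S'` has no more edges, the skeletons agree. If the colliders `i → k ← j` between non-adjacent
nodes differed, the separating parent set would contain or avoid `k` in just the way that makes the
triple relevant, a contradiction. So `S` and `S'` are Markov equivalent and `P` is expressible with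
`S`. Hence a `P` to be rejected has a relevant triple that is exactly independent
(`IsBayesNet.exists_relevant_condIndep`), while for a `P` to be accepted every relevant triple is
`γ`-far from independent.

Markov equivalence (`IsBayesNet.of_equiv`) is a counting argument. After Möbius inversion of the
logarithms of the marginals, the logarithm of the factorization is a sum of coefficients over those
sets `B` in which one member has all the others as parents; this property of `B` depends only on the
skeleton and the immoralities (`hasSink_iff`, `sum_parents_eq`).

The gap is detected by `depStat`, a sum of `2 |det| / total` over the `2 × 2` tables of `(X_i,
X_j)`, one for each value of `X_T`. It vanishes under independence. It is at least `γ` in the far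
case, because flipping `X_i` at suitable rates moves exactly this much mass and creates independence
(`FarFromCondIndep.le_depStat`). It is 8-Lipschitz in the `ℓ¹` norm of the cells
(`abs_depStat_sub_le`). With `D = min d n`, it therefore suffices to estimate the `4 * 2 ^ D` cells
up to `γ / 16` in `ℓ¹` and to compare with `γ / 2`. Hoeffding's inequality for all sets of cells,
with a union bound over `(n + 1) ^ D * n ^ 2` triples, asks for a number of samples of order `(2 ^ D
+ D log n) / γ ^ 2`.

For the running time, the sets `T` are enumerated as numbers with `D` digits in base `n + 1`, and
only sorted digit sequences are tested. There are at most `(n + D).choose D ≤ (2 n) ^ D / D!` of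
them, and the factorial outweighs every factor exponential in `D` in the cost of a test
(`choose_mul_le`). The program itself is verified with Hoare-style rules that carry a time bound
(`Run`). -/

theorem marginalProb_nonneg (D : Finset (Fin n)) (x : Cube n) : 0 ≤ marginalProb P D x :=
  Finset.sum_nonneg fun _ _ => ENNReal.toReal_nonneg

theorem marginalProb_congr {D : Finset (Fin n)} {x y : Cube n} (h : ∀ k ∈ D, x k = y k) :
    marginalProb P D x = marginalProb P D y := by
  unfold marginalProb
  refine Finset.sum_congr (Finset.filter_congr fun z _ => ?_) fun _ _ => rfl
  exact forall₂_congr fun k hk => by rw [h k hk]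

theorem sum_toReal_pmf : ∑ x, (P x).toReal = 1 := by
  have h : ∑ x, P x = 1 := by rw [← tsum_fintype (L := .unconditional _)]; exact P.tsum_coe
  rw [← ENNReal.toReal_sum fun x _ => P.apply_ne_top x, h, ENNReal.toReal_one]

theorem marginalProb_univ (x : Cube n) : marginalProb P Finset.univ x = (P x).toReal := by
  unfold marginalProb
  have : Finset.univ.filter (fun y : Cube n => ∀ k ∈ Finset.univ, y k = x k) = {x} := by
    ext y
    simp [funext_iff]
  rw [this, Finset.sum_singleton]

/-- Summing a function over the points that agree with `x` on `D`, one further coordinate `k` can be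
split off. -/
theorem sum_agree_insert (F : Cube n → ℝ) {D : Finset (Fin n)} {k : Fin n} (hk : k ∉ D)
    (x : Cube n) :
    ∑ y ∈ Finset.univ.filter (fun y : Cube n => ∀ l ∈ D, y l = x l), F y =
      ∑ b : Bool, ∑ y ∈ Finset.univ.filter
        (fun y : Cube n => ∀ l ∈ insert k D, y l = Function.update x k b l), F y := by
  classical
  rw [← Finset.sum_fiberwise (s := Finset.univ.filter (fun y : Cube n => ∀ l ∈ D, y l = x l))
    (g := fun y => y k)]
  refine Finset.sum_congr rfl fun b _ => Finset.sum_congr ?_ fun _ _ => rfl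
  ext y
  simp only [Finset.mem_filter, Finset.mem_univ, true_and, Finset.mem_insert]
  constructor
  · rintro ⟨h, rfl⟩ l (rfl | hl)
    · simp
    · rw [Function.update_of_ne (fun e => hk (by rwa [e] at hl)), h l hl]
  · intro h
    refine ⟨fun l hl => ?_, ?_⟩
    · have := h l (Or.inr hl)
      rwa [Function.update_of_ne (fun e => hk (by rwa [e] at hl))] at this
    · simpa using h k (Or.inl rfl)

theorem marginalProb_eq_sum_update {D : Finset (Fin n)} {k : Fin n} (hk : k ∉ D) (x : Cube n) :
    marginalProb P D x = ∑ b : Bool, marginalProb P (insert k D) (Function.update x k b) :=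
  sum_agree_insert _ hk x

theorem marginalProb_anti {D E : Finset (Fin n)} (h : D ⊆ E) (x : Cube n) :
    marginalProb P E x ≤ marginalProb P D x := by
  refine Finset.sum_le_sum_of_subset_of_nonneg (fun y hy => ?_) fun _ _ _ => ENNReal.toReal_nonneg
  simp only [Finset.mem_filter, Finset.mem_univ, true_and] at hy ⊢
  exact fun k hk => hy k (h hk)

theorem marginalProb_eq_zero_of_subset {D E : Finset (Fin n)} (h : D ⊆ E) {x : Cube n}
    (h0 : marginalProb P D x = 0) : marginalProb P E x = 0 :=
  le_antisymm (h0 ▸ marginalProb_anti P h x) (marginalProb_nonneg P E x)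

variable {P}

theorem CondIndep.symm {A B T : Finset (Fin n)} (h : CondIndep P A B T) : CondIndep P B A T := by
  intro x
  rw [Finset.union_comm B A, h x, mul_comm]

/-- The product identity is summed over the value of `k`. If `k ∉ B ∪ T`, the factors at `T` and, by
`hkA`, at `A ∪ T` do not depend on it, so `k` is summed out of the other two. -/
theorem CondIndep.of_insert {A B T : Finset (Fin n)} {k : Fin n} (hkA : k ∉ A)
    (h : CondIndep P A (insert k B) T) : CondIndep P A B T := by
  by_cases hk : k ∈ B ∪ T
  · have e1 : insert k B ∪ T = B ∪ T := by rw [Finset.insert_union, Finset.insert_eq_self.2 hk]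
    intro x
    have := h x
    rwa [Finset.union_assoc, e1, ← Finset.union_assoc] at this
  · have hk1 : k ∉ T := fun e => hk (Finset.mem_union_right _ e)
    intro x
    have hk2 : k ∉ A ∪ B ∪ T := by
      rw [Finset.union_assoc]
      simp only [Finset.mem_union, not_or] at hk ⊢
      exact ⟨hkA, hk⟩
    have hAT : k ∉ A ∪ T := by simp [hkA, hk1]
    rw [marginalProb_eq_sum_update P hk2 x, marginalProb_eq_sum_update P hk x,
      Finset.sum_mul, Finset.mul_sum]
    refine Finset.sum_congr rfl fun b _ => ?_
    have := h (Function.update x k b)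
    have e1 : A ∪ insert k B ∪ T = insert k (A ∪ B ∪ T) := by
      simp [Finset.union_insert, Finset.insert_union]
    rw [e1, Finset.insert_union,
      marginalProb_congr P (D := T) (y := x) (fun l hl => Function.update_of_ne
        (fun e => hk1 (by rwa [e] at hl)) _ _),
      marginalProb_congr P (D := A ∪ T) (y := x) (fun l hl => Function.update_of_ne
        (fun e => hAT (by rwa [e] at hl)) _ _)] at this
    exact this

theorem CondIndep.mono {A B B' T : Finset (Fin n)} (hB : B' ⊆ B) (hAB : Disjoint A B)
    (h : CondIndep P A B T) : CondIndep P A B' T := by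
  classical
  obtain ⟨E, rfl⟩ : ∃ E, B = E ∪ B' := ⟨B, (Finset.union_eq_left.2 hB).symm⟩
  clear hB
  induction E using Finset.induction_on with
  | empty => simpa using h
  | insert k E _ ih =>
    rw [Finset.insert_union] at h hAB
    exact ih (hAB.mono_right (Finset.subset_insert _ _))
      (h.of_insert fun e => Finset.disjoint_left.1 hAB e (Finset.mem_insert_self _ _))

end Marginals

/-! ### Factorization of Bayes nets -/

namespace BayesStructure

variable {n : ℕ} (S : BayesStructure n)

theorem edge_irrefl (i : Fin n) : ¬ S.Edge i i := fun h => S.acyclic i (Relation.TransGen.single h)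

theorem edge_asymm {i j : Fin n} (h : S.Edge i j) : ¬ S.Edge j i := fun h' =>
  S.acyclic i ((Relation.TransGen.single h).trans (Relation.TransGen.single h'))

open Classical in
/-- The number of ancestors of a node; it increases along edges. -/
noncomputable def height (i : Fin n) : ℕ := (Finset.univ.filter fun a => S.Descendant a i).card

theorem height_lt {i j : Fin n} (h : S.Edge i j) : S.height i < S.height j := by
  classical
  refine Finset.card_lt_card (Finset.ssubset_iff_subset_ne.2 ⟨fun a ha => ?_, fun e => ?_⟩)
  · simp only [Finset.mem_filter, Finset.mem_univ, true_and] at ha ⊢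
    exact Relation.TransGen.tail ha h
  · have : i ∈ Finset.univ.filter fun a => S.Descendant a j := by
      simp only [Finset.mem_filter, Finset.mem_univ, true_and]
      exact Relation.TransGen.single h
    rw [← e, Finset.mem_filter] at this
    exact S.acyclic i this.2

/-- A set of nodes that contains the parents of its members. -/
def Ancestral (A : Finset (Fin n)) : Prop := ∀ k ∈ A, S.parents k ⊆ A

theorem Ancestral.of_descendant {S : BayesStructure n} {A : Finset (Fin n)} (hA : S.Ancestral A)
    {i j : Fin n} (h : S.Descendant i j) (hj : j ∈ A) : i ∈ A := by
  induction h with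
  | single h => exact hA _ hj h
  | tail _ h ih => exact ih (hA _ hj h)

/-- A node of least height outside `A` has all its parents in `A`, since these are lower. -/
theorem exists_ancestral_insert {A : Finset (Fin n)} (hA : A ≠ Finset.univ) :
    ∃ k ∉ A, S.parents k ⊆ A := by
  classical
  have : (Finset.univ \ A).Nonempty := by
    rw [Finset.sdiff_nonempty]
    exact fun h => hA (Finset.univ_subset_iff.1 h)
  obtain ⟨k, hk, hmin⟩ := Finset.exists_min_image _ S.height this
  refine ⟨k, by simpa using hk, fun l hl => ?_⟩
  by_contra hlA
  exact absurd (hmin l (by simpa using hlA)) (not_le.2 (S.height_lt hl))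

/-- A node of greatest height in `A` has no child in `A`, so nothing is lost by removing it. -/
theorem Ancestral.exists_sink {S : BayesStructure n} {A : Finset (Fin n)} (hA : S.Ancestral A)
    (hne : A.Nonempty) :
    ∃ k ∈ A, S.Ancestral (A.erase k) := by
  obtain ⟨k, hk, hmax⟩ := Finset.exists_max_image _ S.height hne
  refine ⟨k, hk, fun l hl m hm => ?_⟩
  have hl' := Finset.mem_of_mem_erase hl
  refine Finset.mem_erase.2 ⟨?_, hA l hl' hm⟩
  rintro rfl
  exact absurd (hmax l hl') (not_le.2 (S.height_lt hm))

/-- The conditional probability of `X_k` given its parents, taken to be `1 / 2` where the parents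
have probability zero. -/
noncomputable def condProb (P : PMF (Cube n)) (k : Fin n) (x : Cube n) : ℝ :=
  if marginalProb P (S.parents k) x = 0 then 1 / 2
  else marginalProb P (insert k (S.parents k)) x / marginalProb P (S.parents k) x

variable (P : PMF (Cube n))

theorem condProb_nonneg (k : Fin n) (x : Cube n) : 0 ≤ S.condProb P k x := by
  unfold condProb
  split_ifs
  · norm_num
  · exact div_nonneg (marginalProb_nonneg _ _ _) (marginalProb_nonneg _ _ _)

theorem condProb_congr {k : Fin n} {x y : Cube n}
    (h : ∀ l ∈ insert k (S.parents k), x l = y l) : S.condProb P k x = S.condProb P k y := by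
  unfold condProb
  rw [marginalProb_congr P h,
    marginalProb_congr P fun l hl => h l (Finset.mem_insert_of_mem hl)]

theorem notMem_parents (k : Fin n) : k ∉ S.parents k := S.edge_irrefl k

/-- The default `1 / 2` is chosen so that this holds even where the parents have probability zero;
the product of the `condProb` is then always a probability distribution. -/
theorem sum_condProb (k : Fin n) (x : Cube n) :
    ∑ b : Bool, S.condProb P k (Function.update x k b) = 1 := by
  have hpa : ∀ b, marginalProb P (S.parents k) (Function.update x k b) =
      marginalProb P (S.parents k) x := fun b => marginalProb_congr P fun l hl =>
    Function.update_of_ne (fun e => S.notMem_parents k (by rwa [e] at hl)) _ _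
  unfold condProb
  simp only [hpa]
  split_ifs with h
  · norm_num
  · rw [← Finset.sum_div, ← marginalProb_eq_sum_update P (S.notMem_parents k) x, div_self h]

/-- The nodes outside `A` are summed out in reverse topological order. The induction is on their
number: a node whose parents lie in `A` is added to `A`, and its factor sums to `1`. -/
theorem sum_prod_condProb (A : Finset (Fin n)) (hA : S.Ancestral A) (x : Cube n) :
    ∑ y ∈ Finset.univ.filter (fun y : Cube n => ∀ l ∈ A, y l = x l), ∏ k, S.condProb P k y =
      ∏ k ∈ A, S.condProb P k x := by
  classical
  induction h : n - A.card generalizing A x with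
  | zero =>
    have hA' : A = Finset.univ := by
      rw [← Finset.card_eq_iff_eq_univ, Fintype.card_fin]
      have := Finset.card_le_univ A
      rw [Fintype.card_fin] at this
      omega
    subst hA'
    have : Finset.univ.filter (fun y : Cube n => ∀ k ∈ Finset.univ, y k = x k) = {x} := by
      ext y
      simp [funext_iff]
    rw [this, Finset.sum_singleton]
  | succ m ih =>
    have hA' : A ≠ Finset.univ := by
      rintro rfl
      rw [Finset.card_univ, Fintype.card_fin] at h
      omega
    obtain ⟨k, hk, hpa⟩ := S.exists_ancestral_insert hA'
    have hins : S.Ancestral (insert k A) := by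
      intro l hl
      rcases Finset.mem_insert.1 hl with rfl | hl
      · exact hpa.trans (Finset.subset_insert _ _)
      · exact (hA l hl).trans (Finset.subset_insert _ _)
    rw [sum_agree_insert _ hk]
    have : ∀ b, ∑ y ∈ Finset.univ.filter
        (fun y : Cube n => ∀ l ∈ insert k A, y l = Function.update x k b l),
          ∏ k, S.condProb P k y =
        S.condProb P k (Function.update x k b) * ∏ k ∈ A, S.condProb P k x := by
      intro b
      rw [ih _ hins _ (by rw [Finset.card_insert_of_notMem hk]; omega), Finset.prod_insert hk]
      congr 1
      refine Finset.prod_congr rfl fun l hl => S.condProb_congr P fun j hj => ?_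
      refine Function.update_of_ne ?_ _ _
      rintro rfl
      rcases Finset.mem_insert.1 hj with rfl | hj
      · exact hk hl
      · exact hk (hA l hl hj)
    simp only [this]
    rw [← Finset.sum_mul, S.sum_condProb, one_mul]

variable {P}

/-- A sink `k` of `A` is split off: the other members of `A` are nondescendants of `k`, so given its
parents `k` is independent of those that are not parents. -/
theorem _root_.IsBayesNet.marginalProb_eq {S : BayesStructure n} (h : IsBayesNet P S)
    (A : Finset (Fin n)) (hA : S.Ancestral A) (x : Cube n) :
    marginalProb P A x = ∏ k ∈ A, S.condProb P k x := by
  classical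
  induction hm : A.card generalizing A with
  | zero =>
    rw [Finset.card_eq_zero] at hm
    subst hm
    simp [marginalProb, sum_toReal_pmf]
  | succ m ih =>
    obtain ⟨k, hk, hA0⟩ := hA.exists_sink (Finset.card_pos.1 (by omega))
    have hpa : S.parents k ⊆ A.erase k := fun l hl =>
      Finset.mem_erase.2 ⟨fun e => S.notMem_parents k (e ▸ hl), hA k hk hl⟩
    have key := ih _ hA0 (by rw [Finset.card_erase_of_mem hk]; omega)
    rw [← Finset.mul_prod_erase _ _ hk, ← key]
    have hCI : CondIndep P {k} (A.erase k \ S.parents k) (S.parents k) := by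
      refine (h k).mono ?_ ?_
      · intro l hl
        simp only [Finset.mem_sdiff, Finset.mem_erase] at hl
        simp only [otherNondescendants, Finset.mem_filter, Finset.mem_univ, true_and]
        refine ⟨hl.1.1, fun hd => ?_, hl.2⟩
        -- The set `A.erase k` is ancestral, so with a descendant of `k` it would contain `k`.
        exact Finset.notMem_erase k A (hA0.of_descendant hd (Finset.mem_erase.2 hl.1))
      · simp [otherNondescendants]
    have e := hCI x
    rw [Finset.union_assoc, Finset.sdiff_union_of_subset hpa, ← Finset.insert_eq,
      ← Finset.insert_eq, Finset.insert_erase hk] at e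
    unfold condProb
    split_ifs with h0
    · rw [marginalProb_eq_zero_of_subset P hpa h0,
        marginalProb_eq_zero_of_subset P (hpa.trans (Finset.erase_subset _ _)) h0, mul_zero]
    · rw [div_mul_eq_mul_div, eq_div_iff h0, e]

theorem _root_.IsBayesNet.apply_eq {S : BayesStructure n} (h : IsBayesNet P S) (x : Cube n) :
    (P x).toReal = ∏ k, S.condProb P k x := by
  rw [← marginalProb_univ, h.marginalProb_eq _ fun _ _ => Finset.subset_univ _]

/-- A distribution that factorizes on its support is a Bayes net. -/
theorem isBayesNet_of_apply_eq (h : ∀ x, P x ≠ 0 → (P x).toReal = ∏ k, S.condProb P k x) :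
    IsBayesNet P S := by
  classical
  -- Off the support the product is still at least `0 = P x`. Both sides have total mass `1`, so an
  -- inequality at every point is an equality at every point.
  have hall : ∀ x, (P x).toReal = ∏ k, S.condProb P k x := by
    have hle : ∀ x ∈ Finset.univ, (P x).toReal ≤ ∏ k, S.condProb P k x := by
      intro x _
      by_cases hx : P x = 0
      · rw [hx]
        exact Finset.prod_nonneg fun k _ => S.condProb_nonneg P k x
      · exact (h x hx).le
    have hsum := S.sum_prod_condProb P ∅ (by simp [Ancestral]) (fun _ => false)
    simp only [Finset.notMem_empty, false_imp_iff, implies_true, Finset.filter_true,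
      Finset.prod_empty] at hsum
    have := (Finset.sum_eq_sum_iff_of_le hle).1 (by rw [sum_toReal_pmf, hsum])
    exact fun x => this x (Finset.mem_univ x)
  have hmarg : ∀ A, S.Ancestral A → ∀ x, marginalProb P A x = ∏ k ∈ A, S.condProb P k x := by
    intro A hA x
    rw [← S.sum_prod_condProb P A hA x]
    exact Finset.sum_congr rfl fun y _ => hall y
  intro i x
  -- With the parents included, both `N` and `insert i N` are ancestral. Their marginals factorize
  -- and differ by the single factor `S.condProb P i x`.
  set N := S.otherNondescendants i ∪ S.parents i with hN
  have hmem : ∀ j, j ∈ N ↔ j ≠ i ∧ ¬ S.Descendant i j := by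
    intro j
    simp only [hN, Finset.mem_union, otherNondescendants, Finset.mem_filter, Finset.mem_univ,
      true_and]
    constructor
    · rintro (h | h)
      · exact ⟨h.1, h.2.1⟩
      · exact ⟨fun e => S.notMem_parents i (e ▸ h), fun hd => S.acyclic i (hd.tail h)⟩
    · rintro ⟨h1, h2⟩
      by_cases h3 : j ∈ S.parents i
      · exact Or.inr h3
      · exact Or.inl ⟨h1, h2, h3⟩
  have hNA : S.Ancestral N := by
    intro j hj k hk
    rw [hmem] at hj ⊢
    refine ⟨?_, fun hd => hj.2 (hd.tail hk)⟩
    rintro rfl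
    exact hj.2 (Relation.TransGen.single hk)
  have hpa : S.parents i ⊆ N := Finset.subset_union_right
  have hiN : i ∉ N := fun hi => ((hmem i).1 hi).1 rfl
  have hiA : S.Ancestral (insert i N) := by
    intro j hj
    rcases Finset.mem_insert.1 hj with rfl | hj
    · exact hpa.trans (Finset.subset_insert _ _)
    · exact (hNA j hj).trans (Finset.subset_insert _ _)
  rw [Finset.union_assoc, ← hN, ← Finset.insert_eq, ← Finset.insert_eq, hmarg _ hiA, hmarg _ hNA,
    Finset.prod_insert hiN]
  unfold condProb
  split_ifs with h0
  · have h1 := marginalProb_eq_zero_of_subset P hpa h0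
    rw [hmarg _ hNA] at h1
    unfold condProb at h1
    rw [h0, h1]
    ring
  · field_simp

end BayesStructure

/-! ### Markov equivalent structures -/

/-- Möbius inversion on the subsets of a finite set: every set function is a sum over subsets. -/
theorem exists_sum_powerset {α : Type*} [DecidableEq α] (F : Finset α → ℝ) :
    ∃ G : Finset α → ℝ, ∀ A, F A = ∑ B ∈ A.powerset, G B := by
  refine ⟨fun A => A.strongInduction fun A ih =>
    F A - ∑ B ∈ A.ssubsets.attach, ih B.1 (Finset.mem_ssubsets.1 B.2), fun A => ?_⟩
  have h : A.powerset = insert A A.ssubsets := by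
    ext B
    rw [Finset.mem_insert, Finset.mem_powerset, Finset.mem_ssubsets]
    exact le_iff_eq_or_lt
  have hA : A ∉ A.ssubsets := fun hA => (Finset.mem_ssubsets.1 hA).ne rfl
  rw [h, Finset.sum_insert hA, Finset.strongInduction_eq,
    Finset.sum_attach A.ssubsets (fun B => B.strongInduction fun A ih =>
      F A - ∑ B ∈ A.ssubsets.attach, ih B.1 (Finset.mem_ssubsets.1 B.2))]
  ring

namespace BayesStructure

variable {n : ℕ} (S S' : BayesStructure n)

/-- Adjacency in the skeleton. -/
def Adj (i j : Fin n) : Prop := S.Edge i j ∨ S.Edge j i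

theorem skeleton_adj {i j : Fin n} : S.skeleton.Adj i j ↔ S.Adj i j := by
  rw [skeleton, SimpleGraph.fromRel_adj]
  refine ⟨fun h => h.2, fun h => ⟨?_, h⟩⟩
  rintro rfl
  exact h.elim (S.edge_irrefl i) (S.edge_irrefl i)

/-- `B` has a member of which all the other members are parents. -/
def HasSink (B : Finset (Fin n)) : Prop := ∃ k ∈ B, B ⊆ insert k (S.parents k)

/-- The right-hand side refers only to adjacency and to immoralities, so Markov equivalent
structures have the same sets with a sink. For the converse, the node `k` of greatest height in `B`
is the sink: if some `j` were not adjacent to `k`, the condition at `t` would force `k → t`, while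
maximality gives `t → k`. -/
theorem hasSink_iff (B : Finset (Fin n)) :
    S.HasSink B ↔ ∃ t ∈ B, (∀ j ∈ B, j ≠ t → S.Adj j t) ∧
      ∀ j ∈ B, ∀ k ∈ B, j ≠ t → k ≠ t → j ≠ k → ¬ S.Adj j k → S.Edge j t ∧ S.Edge k t := by
  constructor
  · rintro ⟨t, ht, h⟩
    have h' : ∀ j ∈ B, j ≠ t → S.Edge j t := fun j hj hjt =>
      (Finset.mem_insert.1 (h hj)).resolve_left hjt
    exact ⟨t, ht, fun j hj hjt => Or.inl (h' j hj hjt),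
      fun j hj k hk hjt hkt _ _ => ⟨h' j hj hjt, h' k hk hkt⟩⟩
  · rintro ⟨t, ht, h1, h2⟩
    obtain ⟨k, hk, hmax⟩ := Finset.exists_max_image B S.height ⟨t, ht⟩
    have hlast : ∀ j ∈ B, S.Adj j k → S.Edge j k := fun j hj h => h.resolve_right fun e =>
      absurd (hmax j hj) (not_le.2 (S.height_lt e))
    refine ⟨k, hk, fun j hj => Finset.mem_insert.2 ?_⟩
    by_cases hjk : j = k
    · exact Or.inl hjk
    refine Or.inr (hlast j hj ?_)
    by_cases hkt : k = t
    · exact hkt ▸ h1 j hj (hkt ▸ hjk)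
    have htk : S.Edge t k := hlast t ht (h1 k hk hkt).symm
    by_cases hjt : j = t
    · exact hjt ▸ Or.inl htk
    by_contra hn
    exact S.edge_asymm htk (h2 j hj k hk hjt hkt hjk hn).2

theorem hasSink_congr (hadj : ∀ i j, S.Adj i j ↔ S'.Adj i j)
    (himm : ∀ i j k, i ≠ j → ¬ S.Adj i j →
      (S.Edge i k ∧ S.Edge j k ↔ S'.Edge i k ∧ S'.Edge j k)) (B : Finset (Fin n)) :
    S.HasSink B ↔ S'.HasSink B := by
  rw [hasSink_iff, hasSink_iff]
  refine exists_congr fun t => and_congr_right fun _ => and_congr ?_ ?_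
  · simp only [hadj]
  · refine forall₂_congr fun j _ => forall₂_congr fun k _ => forall₃_congr fun _ _ hjk => ?_
    rw [← hadj]
    exact forall_congr' fun hn => himm j k t hjk hn

open Classical in
-- Two sinks of `B` would be parents of each other.
theorem card_sinks (B : Finset (Fin n)) :
    ((Finset.univ.filter fun k => k ∈ B ∧ B ⊆ insert k (S.parents k)).card : ℝ) =
      if S.HasSink B then 1 else 0 := by
  split_ifs with h
  · obtain ⟨k, hk, hB⟩ := h
    rw [Nat.cast_eq_one, Finset.card_eq_one]
    refine ⟨k, ?_⟩
    ext l
    simp only [Finset.mem_filter, Finset.mem_univ, true_and, Finset.mem_singleton]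
    constructor
    · rintro ⟨hl, hB'⟩
      by_contra hne
      exact S.edge_asymm ((Finset.mem_insert.1 (hB hl)).resolve_left hne)
        ((Finset.mem_insert.1 (hB' hk)).resolve_left (Ne.symm hne))
    · rintro rfl
      exact ⟨hk, hB⟩
  · rw [Nat.cast_eq_zero, Finset.card_eq_zero, Finset.filter_eq_empty_iff]
    exact fun k _ hk => h ⟨k, hk⟩

open Classical in
-- In the Möbius expansion, the difference at `k` collects the sets `B` with `k ∈ B ⊆ insert k
-- (S.parents k)`, that is, those of which `k` is the sink. So `G B` is counted once if `B` has a
-- sink and not at all otherwise, and the sum depends on `S` only through `HasSink`.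
theorem sum_parents_eq (F G : Finset (Fin n) → ℝ) (hG : ∀ A, F A = ∑ B ∈ A.powerset, G B) :
    ∑ k, (F (insert k (S.parents k)) - F (S.parents k)) =
      ∑ B, G B * if S.HasSink B then 1 else 0 := by
  have h1 : ∀ k, F (insert k (S.parents k)) - F (S.parents k) =
      ∑ B, if k ∈ B ∧ B ⊆ insert k (S.parents k) then G B else 0 := by
    intro k
    rw [hG, hG, ← Finset.sum_filter, sub_eq_iff_eq_add]
    rw [← Finset.sum_filter_add_sum_filter_not _ (fun B => k ∈ B)]
    congr 1
    · refine Finset.sum_congr ?_ fun _ _ => rfl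
      ext B
      simp [and_comm]
    · refine Finset.sum_congr ?_ fun _ _ => rfl
      ext B
      simp only [Finset.mem_filter, Finset.mem_powerset]
      constructor
      · rintro ⟨h, hk⟩
        exact (Finset.subset_insert_iff_of_notMem hk).1 h
      · exact fun h => ⟨h.trans (Finset.subset_insert _ _), fun hk => S.notMem_parents k (h hk)⟩
  simp only [h1]
  rw [Finset.sum_comm]
  refine Finset.sum_congr rfl fun B _ => ?_
  rw [← card_sinks, ← Finset.sum_filter, Finset.sum_const, nsmul_eq_mul, mul_comm]

variable {S S'}

/-- Structures with the same skeleton and the same immoralities are Markov equivalent. -/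
theorem _root_.IsBayesNet.of_equiv {P : PMF (Cube n)} (h : IsBayesNet P S')
    (hadj : ∀ i j, S.Adj i j ↔ S'.Adj i j)
    (himm : ∀ i j k, i ≠ j → ¬ S.Adj i j →
      (S.Edge i k ∧ S.Edge j k ↔ S'.Edge i k ∧ S'.Edge j k)) :
    IsBayesNet P S := by
  classical
  refine S.isBayesNet_of_apply_eq fun x hx => ?_
  -- Only points of the support have to be treated; there every marginal is positive and logarithms
  -- can be taken.
  have hx0 : 0 < (P x).toReal := ENNReal.toReal_pos hx (P.apply_ne_top x)
  have hpos : ∀ A, 0 < marginalProb P A x := fun A =>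
    hx0.trans_le (marginalProb_univ P x ▸ marginalProb_anti P (Finset.subset_univ A) x)
  have hprod : ∀ R : BayesStructure n, 0 < ∏ k, R.condProb P k x ∧
      Real.log (∏ k, R.condProb P k x) =
      ∑ k, (Real.log (marginalProb P (insert k (R.parents k)) x) -
        Real.log (marginalProb P (R.parents k) x)) := by
    intro R
    have e : ∀ k, R.condProb P k x =
        marginalProb P (insert k (R.parents k)) x / marginalProb P (R.parents k) x :=
      fun k => if_neg (hpos _).ne'
    simp only [e]
    refine ⟨Finset.prod_pos fun k _ => div_pos (hpos _) (hpos _), ?_⟩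
    rw [Real.log_prod fun k _ => (div_pos (hpos _) (hpos _)).ne']
    exact Finset.sum_congr rfl fun k _ => Real.log_div (hpos _).ne' (hpos _).ne'
  rw [h.apply_eq]
  refine Real.log_injOn_pos (hprod S').1 (hprod S).1 ?_
  obtain ⟨G, hG⟩ := exists_sum_powerset fun A => Real.log (marginalProb P A x)
  rw [(hprod S).2, (hprod S').2,
    S.sum_parents_eq (fun A => Real.log (marginalProb P A x)) G hG,
    S'.sum_parents_eq (fun A => Real.log (marginalProb P A x)) G hG]
  refine Finset.sum_congr rfl fun B _ => ?_
  rw [if_congr (hasSink_congr S S' hadj himm B) rfl rfl]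

variable (S)

/-- The configurations under which non-degeneracy is required of the pair `i, j` and the set `T`. -/
def Relevant (i j : Fin n) (T : Finset (Fin n)) : Prop :=
  S.Edge i j ∨
    (∃ k ∈ T, S.Edge i k ∧ S.Edge j k) ∨
    (∃ k, k ∉ T ∧ S.Edge i k ∧ S.Edge k j) ∨
    (∃ k, k ∉ T ∧ S.Edge k i ∧ S.Edge k j)

variable {S}

/-- Two nodes that are not adjacent are independent given the parents of one of them. -/
theorem _root_.IsBayesNet.exists_separator {P : PMF (Cube n)} (h : IsBayesNet P S') {i j : Fin n}
    (hij : i ≠ j) (hn : ¬ S'.Adj i j) :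
    (¬ S'.Descendant j i ∧ CondIndep P {i} {j} (S'.parents j)) ∨
      (¬ S'.Descendant i j ∧ CondIndep P {i} {j} (S'.parents i)) := by
  have key : ∀ i j : Fin n, i ≠ j → ¬ S'.Adj i j → ¬ S'.Descendant j i →
      CondIndep P {i} {j} (S'.parents j) := by
    intro i j hij hn hd
    refine ((h j).mono (B' := {i}) ?_ ?_).symm
    · simp only [Finset.singleton_subset_iff, otherNondescendants, Finset.mem_filter,
        Finset.mem_univ, true_and]
      exact ⟨hij, hd, fun e => hn (Or.inl e)⟩
    · simp [otherNondescendants]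
  -- By acyclicity one of the nodes is not a descendant of the other, and then the parents of the
  -- latter separate them. The non-descendance is kept in the conclusion because the comparison of
  -- immoralities needs it.
  by_cases hd : S'.Descendant j i
  · have hd' : ¬ S'.Descendant i j := fun e => S'.acyclic i (e.trans hd)
    exact Or.inr ⟨hd', (key j i hij.symm (fun e => hn e.symm) hd').symm⟩
  · exact Or.inl ⟨hd, key i j hij hn hd⟩

/-- A Bayes net that cannot be expressed with `S`, but with a structure that has no more edges,
violates one of the conditions of non-degeneracy. -/
theorem _root_.IsBayesNet.exists_relevant_condIndep {P : PMF (Cube n)} {d : ℕ}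
    (h : IsBayesNet P S')
    (hd : S'.DegreeAtMost d) (hE : S'.numEdges ≤ S.numEdges) (hS : ¬ IsBayesNet P S) :
    ∃ (i j : Fin n) (T : Finset (Fin n)), i ≠ j ∧ T.card ≤ d ∧ i ∉ T ∧ j ∉ T ∧
      S.Relevant i j T ∧ CondIndep P {i} {j} T := by
  by_contra hcon
  push Not at hcon
  have hskel : ∀ i j, S.Adj i j → S'.Adj i j := by
    have : ∀ i j, S.Edge i j → S'.Adj i j := by
      intro i j hij
      have hne : i ≠ j := fun e => S.edge_irrefl i (e ▸ hij)
      by_contra hn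
      rcases h.exists_separator hne hn with ⟨_, hCI⟩ | ⟨_, hCI⟩
      · exact hcon i j _ hne (hd j) (fun e => hn (Or.inl e)) (S'.notMem_parents j) (Or.inl hij) hCI
      · exact hcon i j _ hne (hd i) (S'.notMem_parents i) (fun e => hn (Or.inr e)) (Or.inl hij) hCI
    rintro i j (hij | hij)
    · exact this i j hij
    · exact (this j i hij).symm
  have hle : S.skeleton ≤ S'.skeleton := fun i j hij =>
    S'.skeleton_adj.2 (hskel i j (S.skeleton_adj.1 hij))
  -- This is where the bound on the number of edges enters: an inclusion of skeletons becomes an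
  -- equality.
  have heq : S.skeleton.edgeSet = S'.skeleton.edgeSet :=
    Set.eq_of_subset_of_ncard_le (SimpleGraph.edgeSet_mono hle) hE (Set.toFinite _)
  have hadj : ∀ i j, S.Adj i j ↔ S'.Adj i j := by
    intro i j
    rw [← skeleton_adj, ← skeleton_adj, SimpleGraph.edgeSet_inj.1 heq]
  refine hS (h.of_equiv hadj fun i j k hij hn => ?_)
  have hn' : ¬ S'.Adj i j := fun e => hn ((hadj i j).2 e)
  have hiT : i ∉ S'.parents j := fun e => hn' (Or.inl e)
  have hjT : j ∉ S'.parents i := fun e => hn' (Or.inr e)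
  constructor
  · rintro ⟨hik, hjk⟩
    have hik' : S'.Adj i k := (hadj i k).1 (Or.inl hik)
    have hjk' : S'.Adj j k := (hadj j k).1 (Or.inl hjk)
    by_contra hnot
    -- The separator contains `k`, so clause (b) applies. Otherwise, if it consists of the parents
    -- of `j`, one has `j → k` in `S'`, and then either `i → k`, which is the missing collider, or
    -- `j → k → i`, which makes `i` a descendant of `j`. The other case is symmetric.
    rcases h.exists_separator hij hn' with ⟨hdesc, hCI⟩ | ⟨hdesc, hCI⟩
    · refine hcon i j _ hij (hd j) hiT (S'.notMem_parents j) (Or.inr (Or.inl ⟨k, ?_, hik, hjk⟩)) hCI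
      refine hjk'.resolve_left fun hjk1 => ?_
      refine hik'.elim (fun e => hnot ⟨e, hjk1⟩) fun e => ?_
      exact hdesc ((Relation.TransGen.single hjk1).tail e)
    · refine hcon i j _ hij (hd i) (S'.notMem_parents i) hjT (Or.inr (Or.inl ⟨k, ?_, hik, hjk⟩)) hCI
      refine hik'.resolve_left fun hik1 => ?_
      refine hjk'.elim (fun e => hnot ⟨hik1, e⟩) fun e => ?_
      exact hdesc ((Relation.TransGen.single hik1).tail e)
  · rintro ⟨hik', hjk'⟩
    have hik : S.Adj i k := (hadj i k).2 (Or.inl hik')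
    have hjk : S.Adj j k := (hadj j k).2 (Or.inl hjk')
    by_contra hnot
    -- In `S'` the separator avoids the common child `k`. In `S` the node `k` is adjacent to both
    -- nodes without being a collider, so clause (d), or clause (c) for one order of the pair,
    -- applies.
    have hT : ∀ T : Finset (Fin n), T.card ≤ d → i ∉ T → j ∉ T → k ∉ T →
        ¬ CondIndep P {i} {j} T := by
      intro T hcard hi hj hk hCI
      rcases hik with hik | hik
      · rcases hjk with hjk | hjk
        · exact hnot ⟨hik, hjk⟩
        · exact hcon i j T hij hcard hi hj (Or.inr (Or.inr (Or.inl ⟨k, hk, hik, hjk⟩))) hCI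
      · rcases hjk with hjk | hjk
        · exact hcon j i T hij.symm hcard hj hi
            (Or.inr (Or.inr (Or.inl ⟨k, hk, hjk, hik⟩))) hCI.symm
        · exact hcon i j T hij hcard hi hj (Or.inr (Or.inr (Or.inr ⟨k, hk, hik, hjk⟩))) hCI
    rcases h.exists_separator hij hn' with ⟨_, hCI⟩ | ⟨_, hCI⟩
    · exact hT _ (hd j) hiT (S'.notMem_parents j) (fun e => S'.edge_asymm e hjk') hCI
    · exact hT _ (hd i) (S'.notMem_parents i) hjT (fun e => S'.edge_asymm e hik') hCI

end BayesStructure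

/-! ### Dependence of two coordinates within the cells of a code -/

/-- The distance from independence of a (non-normalized) `2 × 2` table for each `t < N`; the table
at `t` has the entries `u (4 * t), …, u (4 * t + 3)`. -/
noncomputable def depStat (N : ℕ) (u : ℕ → ℝ) : ℝ :=
  ∑ t ∈ Finset.range N, 2 * |u (4 * t + 3) * u (4 * t) - u (4 * t + 1) * u (4 * t + 2)| /
    (u (4 * t) + u (4 * t + 1) + u (4 * t + 2) + u (4 * t + 3))

/-- This covers the comparison with a table that vanishes, in which the ratios used in
`abs_det_sub_le` are not available. -/
theorem abs_det_le {a b c e : ℝ} (ha : 0 ≤ a) (hb : 0 ≤ b) (hc : 0 ≤ c) (he : 0 ≤ e) :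
    |(e * a - b * c) / (a + b + c + e)| ≤ a + b + c + e := by
  rcases eq_or_lt_of_le (show 0 ≤ a + b + c + e by positivity) with h | h
  · rw [← h]
    simp
  · rw [abs_div, abs_of_pos h, div_le_iff₀ h, abs_le]
    constructor <;> nlinarith [mul_nonneg ha hb, mul_nonneg ha hc, mul_nonneg ha he,
      mul_nonneg hb hc, mul_nonneg hb he, mul_nonneg hc he]

/-- With the total `s`, the identity `(e a - b c) / s = e - (e + b) (e + c) / s` reduces the claim
to the product of the two margins divided by the total, which is Lipschitz since the ratios of
margins to totals lie in `[0, 1]`. -/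
theorem abs_det_sub_le {a b c e a' b' c' e' : ℝ} (ha : 0 ≤ a) (hb : 0 ≤ b) (hc : 0 ≤ c)
    (he : 0 ≤ e) (ha' : 0 ≤ a') (hb' : 0 ≤ b') (hc' : 0 ≤ c') (he' : 0 ≤ e') :
    |(e * a - b * c) / (a + b + c + e) - (e' * a' - b' * c') / (a' + b' + c' + e')| ≤
      4 * (|a - a'| + |b - b'| + |c - c'| + |e - e'|) := by
  rcases eq_or_lt_of_le (show 0 ≤ a + b + c + e by positivity) with h | h
  · have h1 : a = 0 := by linarith
    have h2 : b = 0 := by linarith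
    have h3 : c = 0 := by linarith
    have h4 : e = 0 := by linarith
    subst h1 h2 h3 h4
    have := abs_det_le ha' hb' hc' he'
    simp only [zero_sub, abs_neg, mul_zero, sub_self, zero_div, abs_of_nonneg ha',
      abs_of_nonneg hb', abs_of_nonneg hc', abs_of_nonneg he']
    linarith
  rcases eq_or_lt_of_le (show 0 ≤ a' + b' + c' + e' by positivity) with h' | h'
  · have h1 : a' = 0 := by linarith
    have h2 : b' = 0 := by linarith
    have h3 : c' = 0 := by linarith
    have h4 : e' = 0 := by linarith
    subst h1 h2 h3 h4
    have := abs_det_le ha hb hc he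
    simp only [sub_zero, mul_zero, zero_div, abs_of_nonneg ha,
      abs_of_nonneg hb, abs_of_nonneg hc, abs_of_nonneg he]
    linarith
  set s := a + b + c + e with hs
  set s' := a' + b' + c' + e' with hs'
  set x := (e + c) / s with hx
  set y := (e' + b') / s' with hy
  have hx0 : 0 ≤ x := by positivity
  have hy0 : 0 ≤ y := by positivity
  have hx1 : x ≤ 1 := by rw [hx, div_le_one h]; linarith
  have hy1 : y ≤ 1 := by rw [hy, div_le_one h']; linarith
  -- Telescoping of `(e + b) (e + c) / s` with `e + c = x s` and `e' + b' = y s'`. Each of the four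
  -- terms contributes at most `|e - e'|`, which gives the constant `4`; the other differences occur
  -- less often.
  have key : (e * a - b * c) / s - (e' * a' - b' * c') / s' =
      (e - e') - ((e + b) - (e' + b')) * x - y * ((e + c) - (e' + c')) -
        (y * x) * (s' - s) := by
    rw [hx, hy]
    field_simp
    rw [hs, hs']
    ring
  have e1 : |((e + b) - (e' + b')) * x| ≤ |e - e'| + |b - b'| := by
    rw [abs_mul, abs_of_nonneg hx0]
    refine (mul_le_of_le_one_right (abs_nonneg _) hx1).trans ?_
    rw [show e + b - (e' + b') = (e - e') + (b - b') by ring]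
    exact abs_add_le _ _
  have e2 : |y * ((e + c) - (e' + c'))| ≤ |e - e'| + |c - c'| := by
    rw [abs_mul, abs_of_nonneg hy0]
    refine (mul_le_of_le_one_left (abs_nonneg _) hy1).trans ?_
    rw [show e + c - (e' + c') = (e - e') + (c - c') by ring]
    exact abs_add_le _ _
  have e3 : |(y * x) * (s' - s)| ≤ |a - a'| + |b - b'| + |c - c'| + |e - e'| := by
    rw [abs_mul, abs_of_nonneg (mul_nonneg hy0 hx0)]
    refine (mul_le_of_le_one_left (abs_nonneg _) (mul_le_one₀ hy1 hx0 hx1)).trans ?_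
    rw [abs_sub_comm, show s - s' = ((a - a') + (b - b')) + (c - c') + (e - e') by
      rw [hs, hs']; ring]
    exact (abs_add_le _ _).trans (add_le_add_left ((abs_add_le _ _).trans
      (add_le_add_left (abs_add_le _ _) _)) _)
  rw [key]
  refine (abs_sub _ _).trans ?_
  have e4 := abs_sub ((e - e') - ((e + b) - (e' + b')) * x) (y * ((e + c) - (e' + c')))
  have e5 := abs_sub (e - e') (((e + b) - (e' + b')) * x)
  have := abs_nonneg (a - a')
  have := abs_nonneg (b - b')
  have := abs_nonneg (c - c')
  linarith

theorem sum_range_four_mul (N : ℕ) (F : ℕ → ℝ) :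
    ∑ k ∈ Finset.range (4 * N), F k =
      ∑ t ∈ Finset.range N, (F (4 * t) + F (4 * t + 1) + F (4 * t + 2) + F (4 * t + 3)) := by
  induction N with
  | zero => simp
  | succ N ih =>
    rw [Finset.sum_range_succ, ← ih, show 4 * (N + 1) = 4 * N + 1 + 1 + 1 + 1 by ring]
    simp only [Finset.sum_range_succ]
    ring

theorem abs_depStat_sub_le (N : ℕ) {u v : ℕ → ℝ} (hu : ∀ k, 0 ≤ u k) (hv : ∀ k, 0 ≤ v k) :
    |depStat N u - depStat N v| ≤ 8 * ∑ k ∈ Finset.range (4 * N), |u k - v k| := by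
  rw [sum_range_four_mul, depStat, depStat, ← Finset.sum_sub_distrib, Finset.mul_sum]
  refine (Finset.abs_sum_le_sum_abs _ _).trans (Finset.sum_le_sum fun t _ => ?_)
  have key := abs_det_sub_le (hu (4 * t)) (hu (4 * t + 1)) (hu (4 * t + 2)) (hu (4 * t + 3))
    (hv (4 * t)) (hv (4 * t + 1)) (hv (4 * t + 2)) (hv (4 * t + 3))
  have hs : ∀ w : ℕ → ℝ, (∀ k, 0 ≤ w k) →
      2 * |w (4 * t + 3) * w (4 * t) - w (4 * t + 1) * w (4 * t + 2)| /
        (w (4 * t) + w (4 * t + 1) + w (4 * t + 2) + w (4 * t + 3)) =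
      2 * |(w (4 * t + 3) * w (4 * t) - w (4 * t + 1) * w (4 * t + 2)) /
        (w (4 * t) + w (4 * t + 1) + w (4 * t + 2) + w (4 * t + 3))| := by
    intro w hw
    rw [abs_div, abs_of_nonneg (a := w (4 * t) + w (4 * t + 1) + w (4 * t + 2) + w (4 * t + 3)),
      mul_div_assoc]
    exact add_nonneg (add_nonneg (add_nonneg (hw _) (hw _)) (hw _)) (hw _)
  rw [hs u hu, hs v hv, ← mul_sub, abs_mul, abs_of_pos (by norm_num : (0 : ℝ) < 2)]
  have := abs_abs_sub_abs_le ((u (4 * t + 3) * u (4 * t) - u (4 * t + 1) * u (4 * t + 2)) /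
        (u (4 * t) + u (4 * t + 1) + u (4 * t + 2) + u (4 * t + 3)))
        ((v (4 * t + 3) * v (4 * t) - v (4 * t + 1) * v (4 * t + 2)) /
        (v (4 * t) + v (4 * t + 1) + v (4 * t + 2) + v (4 * t + 3)))
  linarith

/-- By homogeneity of degree one, the program can work with counts instead of frequencies and
compare with `γ * m / 2`. -/
theorem depStat_div (N : ℕ) (u : ℕ → ℝ) {m : ℝ} (hm : 0 < m) :
    depStat N (fun k => u k / m) = depStat N u / m := by
  unfold depStat
  rw [Finset.sum_div]
  refine Finset.sum_congr rfl fun t _ => ?_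
  rw [div_mul_div_comm, div_mul_div_comm, ← sub_div, ← add_div, ← add_div, ← add_div, abs_div,
    abs_of_pos (mul_pos hm hm)]
  rcases eq_or_ne (u (4 * t) + u (4 * t + 1) + u (4 * t + 2) + u (4 * t + 3)) 0 with h | h
  · rw [h]
    simp
  · field_simp

/-- The probability that the code `g` takes the value `k`. -/
noncomputable def codeProb {n : ℕ} (P : PMF (Cube n)) (g : Cube n → ℕ) (k : ℕ) : ℝ :=
  ∑ x ∈ Finset.univ.filter (fun x => g x = k), (P x).toReal

/-- `τ` takes values below `N` and encodes the coordinates in `T`. -/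
structure IsCode {n : ℕ} (T : Finset (Fin n)) (N : ℕ) (τ : Cube n → ℕ) : Prop where
  lt : ∀ x, τ x < N
  eq_iff : ∀ x y, τ x = τ y ↔ ∀ k ∈ T, x k = y k

/-- The code `τ` extended by the coordinates `i` and `j`. -/
def pairCode {n : ℕ} (τ : Cube n → ℕ) (i j : Fin n) (x : Cube n) : ℕ :=
  4 * τ x + 2 * (x i).toNat + (x j).toNat

section Codes

variable {n : ℕ} (P : PMF (Cube n))

theorem codeProb_nonneg (g : Cube n → ℕ) (k : ℕ) : 0 ≤ codeProb P g k :=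
  Finset.sum_nonneg fun _ _ => ENNReal.toReal_nonneg

variable {T : Finset (Fin n)} {N : ℕ} {τ : Cube n → ℕ} {i j : Fin n}

theorem pairCode_eq_iff {t : ℕ} {a b : Bool} (x : Cube n) :
    pairCode τ i j x = 4 * t + 2 * a.toNat + b.toNat ↔ τ x = t ∧ x i = a ∧ x j = b := by
  unfold pairCode
  cases a <;> cases b <;> cases x i <;> cases x j <;> simp <;> omega

theorem pairCode_lt (hτ : IsCode T N τ) (x : Cube n) : pairCode τ i j x < 4 * N := by
  have := hτ.lt x
  unfold pairCode
  cases x i <;> cases x j <;> simp <;> omega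

theorem IsCode.pairCode_eq_iff (hτ : IsCode T N τ) (x y : Cube n) :
    pairCode τ i j y = pairCode τ i j x ↔ ∀ k ∈ insert i (insert j T), y k = x k := by
  rw [show pairCode τ i j x = 4 * τ x + 2 * (x i).toNat + (x j).toNat from rfl,
    _root_.pairCode_eq_iff, hτ.eq_iff]
  simp only [Finset.mem_insert, forall_eq_or_imp]
  tauto

theorem IsCode.marginalProb_eq (hτ : IsCode T N τ) (x : Cube n) :
    marginalProb P (insert i (insert j T)) x = codeProb P (pairCode τ i j) (pairCode τ i j x) := by
  unfold marginalProb codeProb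
  refine Finset.sum_congr (Finset.filter_congr fun y _ => ?_) fun _ _ => rfl
  rw [hτ.pairCode_eq_iff]

/-- The point `x` with the coordinates `i` and `j` replaced. -/
def setPair (i j : Fin n) (x : Cube n) (a b : Bool) : Cube n :=
  Function.update (Function.update x i a) j b

/-- Conditional independence of two coordinates, read off the joint marginal. -/
theorem condIndep_iff (hij : i ≠ j) (hi : i ∉ T) (hj : j ∉ T) :
    CondIndep P {i} {j} T ↔ ∀ x a b,
      marginalProb P (insert i (insert j T)) (setPair i j x a b) *
        ∑ a', ∑ b', marginalProb P (insert i (insert j T)) (setPair i j x a' b') =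
      (∑ b', marginalProb P (insert i (insert j T)) (setPair i j x a b')) *
        ∑ a', marginalProb P (insert i (insert j T)) (setPair i j x a' b) := by
  have e1 : ∀ x, marginalProb P T x =
      ∑ a', ∑ b', marginalProb P (insert i (insert j T)) (setPair i j x a' b') := by
    intro x
    rw [marginalProb_eq_sum_update P hi]
    refine Finset.sum_congr rfl fun a _ => ?_
    rw [marginalProb_eq_sum_update P (k := j) (by simp [hj, hij.symm])]
    simp only [Finset.insert_comm i j]
    rfl
  have e2 : ∀ x, marginalProb P ({i} ∪ T) x =
      ∑ b', marginalProb P (insert i (insert j T)) (setPair i j x (x i) b') := by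
    intro x
    rw [← Finset.insert_eq, marginalProb_eq_sum_update P (k := j) (by simp [hj, hij.symm])]
    simp only [Finset.insert_comm i j, setPair, Function.update_eq_self]
  have e3 : ∀ x, marginalProb P ({j} ∪ T) x =
      ∑ a', marginalProb P (insert i (insert j T)) (setPair i j x a' (x j)) := by
    intro x
    rw [← Finset.insert_eq, marginalProb_eq_sum_update P (k := i) (by simp [hi, hij])]
    refine Finset.sum_congr rfl fun a _ => ?_
    rw [setPair, ← Function.update_of_ne hij.symm a x, Function.update_eq_self]
  have e4 : ∀ x, marginalProb P ({i} ∪ {j} ∪ T) x =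
      marginalProb P (insert i (insert j T)) (setPair i j x (x i) (x j)) := by
    intro x
    rw [Finset.union_assoc, ← Finset.insert_eq, ← Finset.insert_eq]
    simp [setPair]
  have e5 : ∀ x a b a' b', setPair i j (setPair i j x a b) a' b' = setPair i j x a' b' := by
    intro x a b a' b'
    ext k
    simp only [setPair, Function.update_apply]
    split_ifs <;> rfl
  have e6 : ∀ x a b, setPair i j x a b i = a := by
    intro x a b
    simp [setPair, hij]
  have e7 : ∀ x a b, setPair i j x a b j = b := by
    intro x a b
    simp [setPair]
  constructor
  · intro h x a b
    have := h (setPair i j x a b)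
    rw [e1, e2, e3, e4] at this
    simpa only [e5, e6, e7] using this
  · intro h x
    rw [e1, e2, e3, e4]
    exact h x (x i) (x j)

theorem IsCode.setPair (hτ : IsCode T N τ) (hi : i ∉ T) (hj : j ∉ T) (x : Cube n) (a b : Bool) :
    τ (setPair i j x a b) = τ x := by
  rw [hτ.eq_iff]
  intro k hk
  have h1 : k ≠ i := fun e => hi (e ▸ hk)
  have h2 : k ≠ j := fun e => hj (e ▸ hk)
  simp [_root_.setPair, h1, h2]

theorem IsCode.pairCode_setPair (hτ : IsCode T N τ) (hij : i ≠ j) (hi : i ∉ T) (hj : j ∉ T)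
    (x : Cube n) (a b : Bool) :
    pairCode τ i j (_root_.setPair i j x a b) = 4 * τ x + 2 * a.toNat + b.toNat := by
  rw [_root_.pairCode_eq_iff]
  exact ⟨hτ.setPair hi hj x a b, by simp [_root_.setPair, hij], by simp [_root_.setPair]⟩

theorem CondIndep.depStat_eq_zero {P : PMF (Cube n)} (hτ : IsCode T N τ) (hij : i ≠ j)
    (hi : i ∉ T) (hj : j ∉ T) (h : CondIndep P {i} {j} T) :
    depStat N (codeProb P (pairCode τ i j)) = 0 := by
  refine Finset.sum_eq_zero fun t _ => ?_
  by_cases ht : ∃ x, τ x = t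
  · obtain ⟨x, rfl⟩ := ht
    -- One cell is enough: in a `2 × 2` table, "cell times total equals row times column" says that
    -- the determinant vanishes.
    have := (condIndep_iff P hij hi hj).1 h x true true
    simp only [hτ.marginalProb_eq P, hτ.pairCode_setPair hij hi hj, Fintype.sum_bool,
      Bool.toNat_true, Bool.toNat_false, mul_one, mul_zero, add_zero] at this
    rw [show codeProb P (pairCode τ i j) (4 * τ x + 3) * codeProb P (pairCode τ i j) (4 * τ x) -
      codeProb P (pairCode τ i j) (4 * τ x + 1) * codeProb P (pairCode τ i j) (4 * τ x + 2) = 0 by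
        linarith]
    simp
  · have h0 : ∀ k, k / 4 = t → codeProb P (pairCode τ i j) k = 0 := by
      rintro k hk
      refine Finset.sum_eq_zero fun x hx => absurd ⟨x, ?_⟩ ht
      rw [← hk, ← (Finset.mem_filter.1 hx).2, pairCode]
      cases x i <;> cases x j <;> simp <;> omega
    rw [h0 (4 * t + 3) (by omega), h0 (4 * t + 1) (by omega)]
    simp

end Codes

/-- A probability mass function with real values. -/
noncomputable def PMF.ofReal {α : Type*} [Fintype α] (q : α → ℝ) (h0 : ∀ x, 0 ≤ q x)
    (h1 : ∑ x, q x = 1) : PMF α :=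
  PMF.ofFintype (fun x => ENNReal.ofReal (q x)) (by
    rw [← ENNReal.ofReal_sum_of_nonneg fun x _ => h0 x, h1, ENNReal.ofReal_one])

theorem PMF.toReal_ofReal {α : Type*} [Fintype α] (q : α → ℝ) (h0 : ∀ x, 0 ≤ q x)
    (h1 : ∑ x, q x = 1) (x : α) : (PMF.ofReal q h0 h1 x).toReal = q x := by
  rw [PMF.ofReal, PMF.ofFintype_apply, ENNReal.toReal_ofReal (h0 x)]

/-! ### Making two coordinates independent by flipping one of them -/

section Flip

variable {n : ℕ}

/-- Flip the coordinate `i`. -/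
def flipEquiv (i : Fin n) : Cube n ≃ Cube n :=
  Function.Involutive.toPerm (fun x => Function.update x i (!x i)) fun x => by simp

theorem flipEquiv_apply (i : Fin n) (x : Cube n) :
    flipEquiv i x = Function.update x i (!x i) := rfl

theorem flipEquiv_flipEquiv (i : Fin n) (x : Cube n) : flipEquiv i (flipEquiv i x) = x := by
  simp [flipEquiv_apply]

/-- The probability of the cell `(a, b)` of the table at `t`. -/
noncomputable def cellProb (P : PMF (Cube n)) (τ : Cube n → ℕ) (i j : Fin n) (t : ℕ)
    (a b : Bool) : ℝ :=
  codeProb P (pairCode τ i j) (4 * t + 2 * a.toNat + b.toNat)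

/-- The probability of all the cells of the table at `t`. -/
noncomputable def tableProb (P : PMF (Cube n)) (τ : Cube n → ℕ) (i j : Fin n) (t : ℕ) : ℝ :=
  ∑ a, ∑ b, cellProb P τ i j t a b

/-- The determinant of the table at `t`, with the sign for which `(a, b)` is on the diagonal. -/
noncomputable def cellDet (P : PMF (Cube n)) (τ : Cube n → ℕ) (i j : Fin n) (t : ℕ)
    (a b : Bool) : ℝ :=
  cellProb P τ i j t a b * cellProb P τ i j t (!a) (!b) -
    cellProb P τ i j t (!a) b * cellProb P τ i j t a (!b)

/-- The rate at which the coordinate `i` is flipped in the cell `(a, b)` of the table at `t` in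
order to make the coordinates `i` and `j` independent. -/
noncomputable def flipRate (P : PMF (Cube n)) (τ : Cube n → ℕ) (i j : Fin n) (t : ℕ)
    (a b : Bool) : ℝ :=
  max (cellDet P τ i j t a b) 0 / (tableProb P τ i j t * cellProb P τ i j t a b)

variable (P : PMF (Cube n)) (τ : Cube n → ℕ) (i j : Fin n)

theorem cellProb_nonneg (t : ℕ) (a b : Bool) : 0 ≤ cellProb P τ i j t a b :=
  codeProb_nonneg _ _ _

theorem tableProb_nonneg (t : ℕ) : 0 ≤ tableProb P τ i j t :=
  Finset.sum_nonneg fun _ _ => Finset.sum_nonneg fun _ _ => cellProb_nonneg P τ i j t _ _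

theorem tableProb_eq (t : ℕ) (a b : Bool) : tableProb P τ i j t =
    cellProb P τ i j t a b + cellProb P τ i j t (!a) (!b) +
      cellProb P τ i j t (!a) b + cellProb P τ i j t a (!b) := by
  unfold tableProb
  cases a <;> cases b <;> simp <;> ring

theorem flipRate_nonneg (t : ℕ) (a b : Bool) : 0 ≤ flipRate P τ i j t a b :=
  div_nonneg (le_max_right _ _)
    (mul_nonneg (tableProb_nonneg P τ i j t) (cellProb_nonneg P τ i j t a b))

theorem flipRate_le_one (t : ℕ) (a b : Bool) : flipRate P τ i j t a b ≤ 1 := by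
  have h1 := cellProb_nonneg P τ i j t a b
  have h2 := cellProb_nonneg P τ i j t (!a) (!b)
  have h3 := cellProb_nonneg P τ i j t (!a) b
  have h4 := cellProb_nonneg P τ i j t a (!b)
  refine div_le_one_of_le₀ (max_le ?_ ?_) (mul_nonneg (tableProb_nonneg P τ i j t) h1)
  · rw [cellDet, tableProb_eq P τ i j t a b]
    nlinarith [mul_nonneg h1 h1, mul_nonneg h1 h3, mul_nonneg h1 h4, mul_nonneg h3 h4]
  · exact mul_nonneg (tableProb_nonneg P τ i j t) h1

/-- In an empty cell the rate is `0` by the convention for division by zero, and this is the right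
value because the determinant with the sign of that cell is at most `0`. -/
theorem cellProb_mul_flipRate (t : ℕ) (a b : Bool) :
    cellProb P τ i j t a b * flipRate P τ i j t a b =
      max (cellDet P τ i j t a b) 0 / tableProb P τ i j t := by
  unfold flipRate
  rcases eq_or_ne (cellProb P τ i j t a b) 0 with h | h
  · have : cellDet P τ i j t a b ≤ 0 := by
      rw [cellDet, h, zero_mul, zero_sub, neg_nonpos]
      exact mul_nonneg (cellProb_nonneg P τ i j t _ _) (cellProb_nonneg P τ i j t _ _)
    rw [max_eq_right this]
    simp
  · rw [mul_div_assoc', mul_comm (tableProb P τ i j t), mul_div_mul_left _ _ h]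

theorem cellDet_not (t : ℕ) (a b : Bool) :
    cellDet P τ i j t (!a) b = -cellDet P τ i j t a b := by
  unfold cellDet
  rw [Bool.not_not]
  ring

theorem cellDet_not_right (t : ℕ) (a b : Bool) :
    cellDet P τ i j t a (!b) = -cellDet P τ i j t a b := by
  unfold cellDet
  rw [Bool.not_not]
  ring

/-- The statistic is the mass that is flipped: the positive part of the signed determinant survives
in two cells at most, each losing `|det| / total`. This explains the factor `2` in `depStat`. -/
theorem depStat_eq_sum (N : ℕ) : depStat N (codeProb P (pairCode τ i j)) =
    ∑ t ∈ Finset.range N, ∑ a, ∑ b, cellProb P τ i j t a b * flipRate P τ i j t a b := by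
  refine Finset.sum_congr rfl fun t _ => ?_
  simp only [cellProb_mul_flipRate, ← Finset.sum_div]
  have hs : tableProb P τ i j t = codeProb P (pairCode τ i j) (4 * t) +
      codeProb P (pairCode τ i j) (4 * t + 1) + codeProb P (pairCode τ i j) (4 * t + 2) +
      codeProb P (pairCode τ i j) (4 * t + 3) := by
    simp only [tableProb, cellProb, Fintype.sum_bool, Bool.toNat_true, Bool.toNat_false]
    ring_nf
  have hd : cellDet P τ i j t true true =
      codeProb P (pairCode τ i j) (4 * t + 3) * codeProb P (pairCode τ i j) (4 * t) -
      codeProb P (pairCode τ i j) (4 * t + 1) * codeProb P (pairCode τ i j) (4 * t + 2) := by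
    simp [cellDet, cellProb, add_assoc]
  have h1 : cellDet P τ i j t false true = -cellDet P τ i j t true true :=
    cellDet_not P τ i j t true true
  have h2 : cellDet P τ i j t true false = -cellDet P τ i j t true true :=
    cellDet_not_right P τ i j t true true
  have h3 : cellDet P τ i j t false false = cellDet P τ i j t true true := by
    rw [← neg_neg (cellDet P τ i j t true true), ← h2]
    exact cellDet_not P τ i j t true false
  rw [← hs, ← hd]
  congr 1
  simp only [Fintype.sum_bool, h1, h2, h3]
  rcases le_total 0 (cellDet P τ i j t true true) with h | h
  · rw [abs_of_nonneg h, max_eq_left h, max_eq_right (by linarith)]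
    ring
  · rw [abs_of_nonpos h, max_eq_right h, max_eq_left (by linarith)]
    ring

variable {P τ i j}

theorem sum_mul_flipRate {T : Finset (Fin n)} {N : ℕ} (hτ : IsCode T N τ) :
    ∑ x, (P x).toReal * flipRate P τ i j (τ x) (x i) (x j) =
      depStat N (codeProb P (pairCode τ i j)) := by
  rw [depStat_eq_sum, ← Finset.sum_fiberwise_of_maps_to (t := Finset.range N) (g := τ)
    fun x _ => Finset.mem_range.2 (hτ.lt x)]
  refine Finset.sum_congr rfl fun t _ => ?_
  rw [← Finset.sum_fiberwise (g := fun x : Cube n => x i)]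
  refine Finset.sum_congr rfl fun a _ => ?_
  rw [← Finset.sum_fiberwise (g := fun x : Cube n => x j)]
  refine Finset.sum_congr rfl fun b _ => ?_
  rw [cellProb, codeProb, Finset.sum_mul]
  refine Finset.sum_congr ?_ fun x hx => ?_
  · ext x
    simp only [Finset.mem_filter, Finset.mem_univ, true_and, pairCode_eq_iff, and_assoc]
  · simp only [Finset.mem_filter, Finset.mem_univ, true_and, pairCode_eq_iff] at hx
    rw [hx.1, hx.2.1, hx.2.2]

/-- The distance of a distribution from conditional independence is at most the statistic. -/
theorem FarFromCondIndep.le_depStat {T : Finset (Fin n)} {N : ℕ} {γ : ℝ} (hτ : IsCode T N τ)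
    (hij : i ≠ j) (hi : i ∉ T) (hj : j ∉ T) (h : FarFromCondIndep P γ i j T) :
    γ ≤ depStat N (codeProb P (pairCode τ i j)) := by
  by_contra! hlt
  set r : Cube n → ℝ := fun x => flipRate P τ i j (τ x) (x i) (x j) with hr
  have hr0 : ∀ x, 0 ≤ r x := fun x => flipRate_nonneg _ _ _ _ _ _ _
  have hr1 : ∀ x, r x ≤ 1 := fun x => flipRate_le_one _ _ _ _ _ _ _
  have hP0 : ∀ x, 0 ≤ (P x).toReal := fun x => ENNReal.toReal_nonneg
  -- `q` is the law of `X` after `X_i` has been flipped with probability `r X`. All the other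
  -- coordinates keep their joint law.
  set q : Cube n → ℝ := fun x => (P x).toReal * (1 - r x) +
    (P (flipEquiv i x)).toReal * r (flipEquiv i x) with hq
  have hq0 : ∀ x, 0 ≤ q x := fun x => add_nonneg (mul_nonneg (hP0 x) (sub_nonneg.2 (hr1 x)))
    (mul_nonneg (hP0 _) (hr0 _))
  have hflip : ∑ x, (P (flipEquiv i x)).toReal * r (flipEquiv i x) = ∑ x, (P x).toReal * r x :=
    Equiv.sum_comp (flipEquiv i) fun x => (P x).toReal * r x
  have hq1 : ∑ x, q x = 1 := by
    rw [hq, Finset.sum_add_distrib, hflip, ← Finset.sum_add_distrib]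
    refine Eq.trans ?_ (sum_toReal_pmf P)
    exact Finset.sum_congr rfl fun x _ => by ring
  refine h (PMF.ofReal q hq0 hq1) (lt_of_le_of_lt ?_ hlt) ?_
  · rw [← sum_mul_flipRate hτ, tvDist]
    simp only [PMF.toReal_ofReal]
    -- The change at `x` is at most outgoing plus incoming mass. Each of these sums to the
    -- statistic, and the factor `1 / 2` of the total variation distance leaves it once.
    have hx : ∀ x ∈ Finset.univ, |(P x).toReal - q x| ≤ (P x).toReal * r x +
        (P (flipEquiv i x)).toReal * r (flipEquiv i x) := by
      intro x _
      have h1 := mul_nonneg (hP0 x) (hr0 x)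
      have h2 := mul_nonneg (hP0 (flipEquiv i x)) (hr0 (flipEquiv i x))
      rw [hq, abs_le]
      constructor <;> dsimp only <;> linarith
    have := Finset.sum_le_sum hx
    rw [Finset.sum_add_distrib, hflip] at this
    linarith
  -- The cell `(a, b)` exchanges mass only with `(!a, b)`, whose determinant has the opposite sign,
  -- so the net loss is `det / total`. What remains is the product of the two margins divided by the
  -- total, hence independence.
  · have hmarg : ∀ x a b, marginalProb (PMF.ofReal q hq0 hq1) (insert i (insert j T))
        (setPair i j x a b) = cellProb P τ i j (τ x) a b -
          cellDet P τ i j (τ x) a b / tableProb P τ i j (τ x) := by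
      intro x a b
      set D := insert i (insert j T) with hD
      set z := setPair i j x a b with hz
      have hz1 : τ z = τ x := hτ.setPair hi hj x a b
      have hzi : z i = a := by simp [hz, setPair, hij]
      have hzj : z j = b := by simp [hz, setPair]
      have hagree : ∀ y w : Cube n, (∀ l ∈ D, y l = w l) → r y = r w := by
        intro y w hyw
        have h1 : τ y = τ w := (hτ.eq_iff y w).2 fun k hk => hyw k (by simp [hD, hk])
        have h2 := hyw i (by simp [hD])
        have h3 := hyw j (by simp [hD])
        simp only [hr, h1, h2, h3]
      have hfl : ∀ y w : Cube n, (∀ l ∈ D, y l = w l) →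
          ∀ l ∈ D, flipEquiv i y l = flipEquiv i w l := by
        intro y w hyw l hl
        rw [flipEquiv_apply, flipEquiv_apply]
        by_cases hli : l = i
        · subst hli
          simp [hyw l hl]
        · simp [hli, hyw l hl]
      have hmz : marginalProb P D z = cellProb P τ i j (τ x) a b := by
        rw [hτ.marginalProb_eq, hτ.pairCode_setPair hij hi hj, cellProb]
      have hmf : marginalProb P D (flipEquiv i z) = cellProb P τ i j (τ x) (!a) b := by
        have : flipEquiv i z = setPair i j x (!a) b := by
          rw [flipEquiv_apply, hzi, hz, setPair, setPair, Function.update_comm hij,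
            Function.update_idem, Function.update_comm hij]
        rw [this, hτ.marginalProb_eq, hτ.pairCode_setPair hij hi hj, cellProb]
      have e1 : ∑ y ∈ Finset.univ.filter (fun y : Cube n => ∀ l ∈ D, y l = z l),
          (P y).toReal * (1 - r y) = marginalProb P D z * (1 - r z) := by
        rw [marginalProb, Finset.sum_mul]
        refine Finset.sum_congr rfl fun y hy => ?_
        rw [hagree y z (Finset.mem_filter.1 hy).2]
      have e2 : ∑ y ∈ Finset.univ.filter (fun y : Cube n => ∀ l ∈ D, y l = z l),
          (P (flipEquiv i y)).toReal * r (flipEquiv i y) =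
            marginalProb P D (flipEquiv i z) * r (flipEquiv i z) := by
        rw [marginalProb, Finset.sum_mul]
        refine Finset.sum_equiv (flipEquiv i) (fun y => ?_) fun y hy => ?_
        · simp only [Finset.mem_filter, Finset.mem_univ, true_and]
          refine ⟨hfl y z, fun hy => ?_⟩
          have := hfl _ _ hy
          rwa [flipEquiv_flipEquiv, flipEquiv_flipEquiv] at this
        · rw [hagree _ _ (hfl y z (Finset.mem_filter.1 hy).2)]
      have hrz : r z = flipRate P τ i j (τ x) a b := by simp only [hr, hz1, hzi, hzj]
      have hrf : r (flipEquiv i z) = flipRate P τ i j (τ x) (!a) b := by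
        have h1 : τ (flipEquiv i z) = τ x := by
          rw [← hz1, hτ.eq_iff]
          intro k hk
          have : k ≠ i := fun e => hi (e ▸ hk)
          simp [flipEquiv_apply, this]
        have h2 : flipEquiv i z i = !a := by simp [flipEquiv_apply, hzi]
        have h3 : flipEquiv i z j = b := by simp [flipEquiv_apply, hij.symm, hzj]
        simp only [hr, h1, h2, h3]
      rw [show marginalProb (PMF.ofReal q hq0 hq1) D z = ∑ y ∈ Finset.univ.filter
        (fun y : Cube n => ∀ l ∈ D, y l = z l), q y from
          Finset.sum_congr rfl fun y _ => PMF.toReal_ofReal q hq0 hq1 y]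
      rw [hq, Finset.sum_add_distrib, e1, e2, hmz, hmf, hrz, hrf, mul_sub, mul_one,
        cellProb_mul_flipRate, cellProb_mul_flipRate, cellDet_not]
      rw [sub_add, ← sub_div]
      congr 2
      rcases le_total 0 (cellDet P τ i j (τ x) a b) with h | h
      · rw [max_eq_left h, max_eq_right (by linarith), sub_zero]
      · rw [max_eq_right h, max_eq_left (by linarith)]
        ring
    rw [condIndep_iff _ hij hi hj]
    intro x a b
    simp only [hmarg]
    have hb : ∀ f : Bool → ℝ, ∀ c, ∑ c', f c' = f c + f (!c) := by
      intro f c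
      cases c <;> simp [add_comm]
    rw [hb _ a, hb _ b, hb _ b, hb _ a]
    simp only [cellDet_not, cellDet_not_right]
    rcases eq_or_ne (tableProb P τ i j (τ x)) 0 with h0 | h0
    · have := tableProb_eq P τ i j (τ x) a b
      have h1 := cellProb_nonneg P τ i j (τ x) a b
      have h2 := cellProb_nonneg P τ i j (τ x) (!a) (!b)
      have h3 := cellProb_nonneg P τ i j (τ x) (!a) b
      have h4 := cellProb_nonneg P τ i j (τ x) a (!b)
      have h5 : cellProb P τ i j (τ x) a b = 0 := by linarith
      have h6 : cellProb P τ i j (τ x) (!a) b = 0 := by linarith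
      rw [h0, h5, h6]
      simp
    · have hs := tableProb_eq P τ i j (τ x) a b
      have hd : cellDet P τ i j (τ x) a b = cellProb P τ i j (τ x) a b *
        cellProb P τ i j (τ x) (!a) (!b) -
          cellProb P τ i j (τ x) (!a) b * cellProb P τ i j (τ x) a (!b) := rfl
      have h4 : cellProb P τ i j (τ x) a (!b) = tableProb P τ i j (τ x) -
        cellProb P τ i j (τ x) a b - cellProb P τ i j (τ x) (!a) (!b) -
          cellProb P τ i j (τ x) (!a) b := by linarith
      rw [hd, h4]
      field_simp
      ring

end Flip

/-! ### Concentration of the empirical distribution -/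

open MeasureTheory ProbabilityTheory in
/-- Hoeffding's inequality for the frequency of an event. -/
theorem sampleLaw_real_le {n : ℕ} (P : PMF (Cube n)) (m : ℕ) (f : Cube n → ℝ)
    (hf : ∀ x, f x ∈ Set.Icc (0 : ℝ) 1) {ε : ℝ} (hε : 0 ≤ ε) :
    (sampleLaw P m).real {ω | ε * m ≤ ∑ s, (f (ω s) - ∑ x, (P x).toReal * f x)} ≤
      Real.exp (-(2 * m * ε ^ 2)) := by
  have hint : ∫ x, f x ∂P.toMeasure = ∑ x, (P x).toReal * f x := by
    rw [PMF.integral_eq_sum]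
    rfl
  have hsub : HasSubgaussianMGF (fun x => f x - ∑ x, (P x).toReal * f x) ((‖(1 : ℝ) - 0‖₊ / 2) ^ 2)
      P.toMeasure := by
    rw [← hint]
    exact hasSubgaussianMGF_of_mem_Icc (measurable_of_finite f).aemeasurable
      (Filter.Eventually.of_forall hf)
  have hind : iIndepFun (fun (s : Fin m) (ω : Fin m → Cube n) =>
      f (ω s) - ∑ x, (P x).toReal * f x) (sampleLaw P m) :=
    iIndepFun_pi (μ := fun _ => P.toMeasure) (X := fun _ x => f x - ∑ x, (P x).toReal * f x)
      fun _ => (measurable_of_finite _).aemeasurable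
  have hsub' : ∀ s ∈ (Finset.univ : Finset (Fin m)), HasSubgaussianMGF
      (fun ω : Fin m → Cube n => f (ω s) - ∑ x, (P x).toReal * f x)
        ((‖(1 : ℝ) - 0‖₊ / 2) ^ 2) (sampleLaw P m) := by
    intro s _
    refine HasSubgaussianMGF.of_map (Y := fun ω : Fin m → Cube n => ω s)
      (X := fun x => f x - ∑ x, (P x).toReal * f x) (measurable_pi_apply s).aemeasurable ?_
    rw [sampleLaw, (measurePreserving_eval (fun _ : Fin m => P.toMeasure) s).map_eq]
    exact hsub
  -- Each summand has variance proxy `(1 / 2) ^ 2`, so the exponent is `(ε m) ^ 2 / (2 * m / 4) = 2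
  -- m ε ^ 2`.
  refine (HasSubgaussianMGF.measure_sum_ge_le_of_iIndepFun hind hsub'
    (mul_nonneg hε (Nat.cast_nonneg m))).trans (le_of_eq ?_)
  congr 1
  simp only [Finset.sum_const, Finset.card_univ, Fintype.card_fin, sub_zero, nnnorm_one,
    nsmul_eq_mul]
  push_cast
  rcases Nat.eq_zero_or_pos m with rfl | hm
  · simp
  · have : (m : ℝ) ≠ 0 := by positivity
    field_simp

/-- The number of samples with code `k`. -/
def codeCount {n m : ℕ} (g : Cube n → ℕ) (ω : Fin m → Cube n) (k : ℕ) : ℕ :=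
  (Finset.univ.filter fun s => g (ω s) = k).card

theorem sum_codeCount {n m : ℕ} (g : Cube n → ℕ) (ω : Fin m → Cube n) (A : Finset ℕ) :
    ∑ k ∈ A, (codeCount g ω k : ℝ) = ∑ s, if g (ω s) ∈ A then 1 else 0 := by
  unfold codeCount
  simp only [Finset.card_filter, Nat.cast_sum, Nat.cast_ite, Nat.cast_one, Nat.cast_zero]
  rw [Finset.sum_comm]
  exact Finset.sum_congr rfl fun s _ => by simp

theorem sum_codeProb_mem {n : ℕ} (P : PMF (Cube n)) (g : Cube n → ℕ) (A : Finset ℕ) :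
    ∑ k ∈ A, codeProb P g k = ∑ x, (P x).toReal * if g x ∈ A then 1 else 0 := by
  unfold codeProb
  simp only [Finset.sum_filter]
  rw [Finset.sum_comm]
  exact Finset.sum_congr rfl fun s _ => by simp

/-- The empirical distribution of a code is close to the true one. -/
theorem sampleLaw_real_codeCount_le {n : ℕ} (P : PMF (Cube n)) (m : ℕ) (g : Cube n → ℕ) {N : ℕ}
    (hg : ∀ x, g x < N) {ε : ℝ} (hε : 0 ≤ ε) :
    (sampleLaw P m).real {ω | 2 * (ε * m) ≤
      ∑ k ∈ Finset.range N, |(codeCount g ω k : ℝ) - m * codeProb P g k|} ≤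
      2 ^ N * Real.exp (-(2 * m * ε ^ 2)) := by
  have hfin : MeasureTheory.IsFiniteMeasure (sampleLaw P m) := by
    unfold sampleLaw
    infer_instance
  have hsum : ∀ (ω : Fin m → Cube n) (A : Finset ℕ),
      ∑ k ∈ A, ((codeCount g ω k : ℝ) - m * codeProb P g k) =
      ∑ s, ((if g (ω s) ∈ A then 1 else 0) - ∑ x, (P x).toReal * if g x ∈ A then 1 else 0) := by
    intro ω A
    rw [Finset.sum_sub_distrib, sum_codeCount, ← Finset.mul_sum, sum_codeProb_mem,
      Finset.sum_sub_distrib]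
    simp
  have hsub : {ω : Fin m → Cube n | 2 * (ε * m) ≤
      ∑ k ∈ Finset.range N, |(codeCount g ω k : ℝ) - m * codeProb P g k|} ⊆
      ⋃ A ∈ (Finset.range N).powerset, {ω | ε * m ≤
        ∑ s, ((if g (ω s) ∈ A then 1 else 0) -
          ∑ x, (P x).toReal * if g x ∈ A then 1 else 0)} := by
    intro ω hω
    rw [Set.mem_ofPred_eq] at hω
    set v : ℕ → ℝ := fun k => (codeCount g ω k : ℝ) - m * codeProb P g k with hv
    have h0 : ∑ k ∈ Finset.range N, v k = 0 := by
      rw [hsum]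
      simp [hg, sum_toReal_pmf]
    -- The deviations sum to zero, so their `ℓ¹` norm is twice the deviation of the set of cells
    -- where they are nonnegative. A union bound over all `2 ^ N` sets of cells therefore suffices.
    have h1 : ∑ k ∈ Finset.range N, |v k| =
        2 * ∑ k ∈ (Finset.range N).filter (fun k => 0 ≤ v k), v k := by
      have e : ∀ k, |v k| = 2 * (if 0 ≤ v k then v k else 0) - v k := by
        intro k
        split_ifs with h
        · rw [abs_of_nonneg h]; ring
        · rw [abs_of_neg (not_le.1 h)]; ring
      rw [Finset.sum_filter, Finset.sum_congr rfl fun k _ => e k, Finset.sum_sub_distrib, h0,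
        sub_zero, Finset.mul_sum]
    simp only [Set.mem_iUnion, Finset.mem_powerset]
    refine ⟨(Finset.range N).filter (fun k => 0 ≤ v k), Finset.filter_subset _ _, ?_⟩
    rw [Set.mem_ofPred_eq, ← hsum]
    change 2 * (ε * m) ≤ ∑ k ∈ Finset.range N, |v k| at hω
    change _ ≤ ∑ k ∈ (Finset.range N).filter (fun k => 0 ≤ v k), v k
    linarith
  refine (MeasureTheory.measureReal_mono hsub (MeasureTheory.measure_ne_top _ _)).trans ?_
  refine (MeasureTheory.measureReal_biUnion_finset_le _ _).trans ?_
  refine (Finset.sum_le_sum fun A _ => sampleLaw_real_le P m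
    (fun x => if g x ∈ A then 1 else 0) (fun x => ?_) hε).trans (le_of_eq ?_)
  · split_ifs <;> simp
  · rw [Finset.sum_const, Finset.card_powerset, Finset.card_range, nsmul_eq_mul]
    push_cast
    rfl

/-! ### The test -/

/-- The bit of `x` at `v`, and `0` if there is no such bit. -/
def bitAt {n : ℕ} (x : Cube n) (v : ℕ) : ℕ := if h : v < n then (x ⟨v, h⟩).toNat else 0

theorem bitAt_le_one {n : ℕ} (x : Cube n) (v : ℕ) : bitAt x v ≤ 1 := by
  unfold bitAt
  split_ifs
  · exact Bool.toNat_le _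
  · exact Nat.zero_le _

/-- The number with the binary digits of `x` at the positions `f 0, …, f (D - 1)`. -/
def bitCode {n : ℕ} (f : ℕ → ℕ) (x : Cube n) : ℕ → ℕ
  | 0 => 0
  | D + 1 => 2 * bitCode f x D + bitAt x (f D)

/-- The digits of `c` in base `n + 1`. -/
def digit (n c k : ℕ) : ℕ := c / (n + 1) ^ k % (n + 1)

/-- The set of nodes among the first `D` digits of `c`. -/
def digitSet (n D c : ℕ) : Finset (Fin n) :=
  Finset.univ.filter fun v => ∃ k < D, digit n c k = v

/-- The first `D` digits of `c` are weakly increasing. -/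
def DigitsSorted (n D c : ℕ) : Prop := ∀ k, k + 1 < D → digit n c k ≤ digit n c (k + 1)

theorem digit_le (n c k : ℕ) : digit n c k ≤ n :=
  Nat.lt_succ_iff.1 (Nat.mod_lt _ (Nat.succ_pos n))

theorem exists_digit_eq (n D : ℕ) (f : ℕ → ℕ) (hf : ∀ k, f k ≤ n) :
    ∃ c < (n + 1) ^ D, ∀ k < D, digit n c k = f k := by
  induction D generalizing f with
  | zero => exact ⟨0, by simp, by simp⟩
  | succ D ih =>
    obtain ⟨c, hc, h⟩ := ih (fun k => f (k + 1)) fun k => hf _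
    have hf0 := hf 0
    refine ⟨f 0 + (n + 1) * c, ?_, ?_⟩
    · calc f 0 + (n + 1) * c < (n + 1) * (c + 1) := by rw [mul_add]; omega
        _ ≤ (n + 1) * (n + 1) ^ D := Nat.mul_le_mul_left _ hc
        _ = _ := by ring
    · intro k hk
      rcases k with _ | k
      · simp only [digit, pow_zero, Nat.div_one, Nat.add_mul_mod_self_left]
        exact Nat.mod_eq_of_lt (by omega)
      · rw [← h k (by omega), digit, digit, pow_succ', ← Nat.div_div_eq_div_mul,
          Nat.add_mul_div_left _ _ (Nat.succ_pos n), Nat.div_eq_of_lt (Nat.lt_succ_of_le hf0),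
          Nat.zero_add]

theorem exists_digitSet_eq {n D : ℕ} (T : Finset (Fin n)) (hT : T.card ≤ D) :
    ∃ c < (n + 1) ^ D, DigitsSorted n D c ∧ digitSet n D c = T := by
  -- The elements of `T` in increasing order, padded with the digit `n`. This digit names no node
  -- and, being the largest, keeps the sequence sorted.
  set f : ℕ → ℕ := fun k => if h : k < T.card then T.orderEmbOfFin rfl ⟨k, h⟩ else n with hf
  obtain ⟨c, hc, h⟩ := exists_digit_eq n D f fun k => by
    rw [hf]
    dsimp only
    split_ifs
    · exact (Fin.is_lt _).le
    · exact le_rfl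
  refine ⟨c, hc, fun k hk => ?_, ?_⟩
  · rw [h k (by omega), h (k + 1) hk, hf]
    dsimp only
    split_ifs with h1 h2 h2
    · exact (T.orderEmbOfFin rfl).monotone (by simp)
    · exact (Fin.is_lt _).le
    · omega
    · exact le_rfl
  · ext v
    simp only [digitSet, Finset.mem_filter, Finset.mem_univ, true_and]
    constructor
    · rintro ⟨k, hk, hkv⟩
      rw [h k hk, hf] at hkv
      dsimp only at hkv
      split_ifs at hkv with h1
      · rw [← Fin.ext hkv]
        exact Finset.orderEmbOfFin_mem _ _ _
      · exact absurd hkv v.2.ne'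
    · intro hv
      have : v ∈ Set.range (T.orderEmbOfFin rfl) := by
        rw [Finset.range_orderEmbOfFin]
        exact hv
      obtain ⟨⟨k, hk⟩, rfl⟩ := this
      refine ⟨k, by omega, ?_⟩
      rw [h k (by omega), hf]
      simp [hk]

theorem card_digitSet_le (n D c : ℕ) : (digitSet n D c).card ≤ D := by
  calc (digitSet n D c).card = ((digitSet n D c).map Fin.valEmbedding).card := by simp
    _ ≤ ((Finset.range D).image (digit n c)).card := by
        refine Finset.card_le_card fun v hv => ?_
        simp only [digitSet, Finset.mem_map, Finset.mem_filter, Finset.mem_univ, true_and] at hv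
        obtain ⟨w, ⟨k, hk, h⟩, rfl⟩ := hv
        exact Finset.mem_image.2 ⟨k, Finset.mem_range.2 hk, h⟩
    _ ≤ D := Finset.card_image_le.trans (by simp)

theorem bitCode_lt {n : ℕ} (f : ℕ → ℕ) (x : Cube n) (D : ℕ) : bitCode f x D < 2 ^ D := by
  induction D with
  | zero => simp [bitCode]
  | succ D ih =>
    have := bitAt_le_one x (f D)
    rw [bitCode, pow_succ]
    omega

theorem bitCode_eq_iff {n : ℕ} (f : ℕ → ℕ) (x y : Cube n) (D : ℕ) :
    bitCode f x D = bitCode f y D ↔ ∀ k < D, bitAt x (f k) = bitAt y (f k) := by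
  induction D with
  | zero => simp [bitCode]
  | succ D ih =>
    have h1 := bitAt_le_one x (f D)
    have h2 := bitAt_le_one y (f D)
    simp only [bitCode, Nat.lt_succ_iff_lt_or_eq, or_imp, forall_and, forall_eq, ← ih]
    omega

/-- Digits equal to `n` contribute the constant bit `0`, and repeated digits contribute redundant
bits. Neither affects which points share a code. -/
theorem isCode_bitCode (n D c : ℕ) :
    IsCode (digitSet n D c) (2 ^ D) fun x => bitCode (digit n c) x D where
  lt x := bitCode_lt _ _ _
  eq_iff x y := by
    rw [bitCode_eq_iff]
    simp only [digitSet, Finset.mem_filter, Finset.mem_univ, true_and, forall_exists_index, and_imp]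
    constructor
    · intro h v k hk hv
      have := h k hk
      rw [hv, bitAt, bitAt, dif_pos v.2, dif_pos v.2] at this
      revert this
      cases x v <;> cases y v <;> simp
    · intro h k hk
      unfold bitAt
      split_ifs with hv
      · rw [h ⟨_, hv⟩ k hk rfl]
      · rfl

/-! ### Accuracy and failure probability of the tests -/

section Test

variable {n : ℕ} (S : BayesStructure n) (D : ℕ)

/-- The triples that are tested: two nodes and the number of a set of nodes. -/
def Tested (c : ℕ) (i j : Fin n) : Prop :=
  DigitsSorted n D c ∧ i ≠ j ∧ i ∉ digitSet n D c ∧ j ∉ digitSet n D c ∧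
    S.Relevant i j (digitSet n D c)

/-- The code of the samples from which the dependence of `i` and `j` is estimated. -/
def testCode (c : ℕ) (i j : Fin n) : Cube n → ℕ :=
  pairCode (fun x => bitCode (digit n c) x D) i j

/-- The estimated dependence of `i` and `j`, multiplied by the number of samples. -/
noncomputable def testStat {m : ℕ} (ω : Fin m → Cube n) (c : ℕ) (i j : Fin n) : ℝ :=
  depStat (2 ^ D) fun k => codeCount (testCode D c i j) ω k

/-- All the tested pairs of nodes look dependent. -/
def TestPasses {m : ℕ} (γ : ℝ) (ω : Fin m → Cube n) : Prop :=
  ∀ c < (n + 1) ^ D, ∀ i j, Tested S D c i j → γ * m / 2 ≤ testStat D ω c i j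

/-- The empirical distributions of all the codes are accurate. -/
def GoodSamples {m : ℕ} (P : PMF (Cube n)) (γ : ℝ) (ω : Fin m → Cube n) : Prop :=
  ∀ c < (n + 1) ^ D, ∀ i j, Tested S D c i j →
    ∑ k ∈ Finset.range (4 * 2 ^ D),
      |(codeCount (testCode D c i j) ω k : ℝ) - m * codeProb P (testCode D c i j) k| <
        2 * (γ / 32 * m)

variable {S D}

/-- Accuracy `γ / 16` in `ℓ¹` times the Lipschitz constant `8` gives `γ / 2`, half the gap between
the values `0` and `γ` that have to be told apart. -/
theorem GoodSamples.abs_testStat_sub_lt {m : ℕ} (hm : 0 < m) {P : PMF (Cube n)} {γ : ℝ}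
    {ω : Fin m → Cube n} (h : GoodSamples S D P γ ω) {c : ℕ} (hc : c < (n + 1) ^ D) {i j : Fin n}
    (ht : Tested S D c i j) :
    |testStat D ω c i j - m * depStat (2 ^ D) (codeProb P (testCode D c i j))| < γ * m / 2 := by
  have hm' : (0 : ℝ) < m := by exact_mod_cast hm
  have h1 := h c hc i j ht
  have h2 := abs_depStat_sub_le (2 ^ D)
    (u := fun k => (codeCount (testCode D c i j) ω k : ℝ) / m)
    (v := codeProb P (testCode D c i j)) (fun k => by positivity) (codeProb_nonneg P _)
  have h3 : ∑ k ∈ Finset.range (4 * 2 ^ D), |(codeCount (testCode D c i j) ω k : ℝ) / m -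
      codeProb P (testCode D c i j) k| = (∑ k ∈ Finset.range (4 * 2 ^ D),
      |(codeCount (testCode D c i j) ω k : ℝ) - m * codeProb P (testCode D c i j) k|) / m := by
    rw [Finset.sum_div]
    refine Finset.sum_congr rfl fun k _ => ?_
    rw [← abs_of_pos hm', ← abs_div, abs_of_pos hm', sub_div, mul_div_cancel_left₀ _ hm'.ne']
  rw [h3, depStat_div _ _ hm', mul_div_assoc', le_div_iff₀ hm', ← abs_of_pos hm', ← abs_mul,
    abs_of_pos hm', sub_mul, div_mul_cancel₀ _ hm'.ne'] at h2
  rw [testStat, mul_comm (m : ℝ)]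
  linarith

/-- Relevance needs an edge of `S`. This excludes the small cases in which `D * log n` does not
absorb the number of pairs of nodes; nothing is tested there. -/
theorem one_le_of_tested {c d : ℕ} {i j : Fin n} (hd : S.DegreeAtMost d)
    (h : Tested S (min d n) c i j) : 1 ≤ min d n ∧ 2 ≤ n := by
  have hedge : ∃ a b, S.Edge a b := by
    rcases h.2.2.2.2 with h | ⟨k, _, h, _⟩ | ⟨k, _, h, _⟩ | ⟨k, _, h, _⟩ <;> exact ⟨_, _, h⟩
  obtain ⟨a, b, hab⟩ := hedge
  have h1 : 1 ≤ d := (Finset.card_pos.2 ⟨a, hab⟩).trans_le (hd b)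
  have h2 : (i : ℕ) ≠ j := fun e => h.2.1 (Fin.ext e)
  have := i.2
  have := j.2
  exact ⟨le_min h1 (by omega), by omega⟩

/-- Since `5632 = 11 * 512`, the exponent `2 m (γ / 32) ^ 2 = m γ ^ 2 / 512` is at least `11 (2 ^ D
+ D l)` with `l = Nat.clog 2 n`. Of the `11`, the sets of cells use `4 * 2 ^ D`, the factor `100 ≤ 2
^ 7` uses `7 * 2 ^ D`, and the number of triples is at most `2 ^ (4 D l)`. -/
theorem failure_bound_le {D n : ℕ} (hD : 1 ≤ D) (hn : 2 ≤ n) {m : ℕ} {γ : ℝ}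
    (hm : 5632 * ((2 : ℝ) ^ D + D * Nat.clog 2 n) ≤ m * γ ^ 2) :
    ((n + 1) ^ D * (n * n) : ℝ) * (2 ^ (4 * 2 ^ D) * Real.exp (-(2 * m * (γ / 32) ^ 2))) ≤
      1 / 100 := by
  set l := Nat.clog 2 n with hl
  have hnl : n ≤ 2 ^ l := Nat.le_pow_clog (by norm_num) n
  have hl1 : 1 ≤ l := Nat.clog_pos (by norm_num) hn
  have hn1 : n + 1 ≤ 2 ^ (l + 1) := by rw [pow_succ]; omega
  have hexp : Real.exp (-(2 * m * (γ / 32) ^ 2)) ≤ ((2 : ℝ) ^ (11 * (2 ^ D + D * l)))⁻¹ := by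
    rw [Real.exp_neg]
    refine inv_anti₀ (by positivity) ?_
    calc (2 : ℝ) ^ (11 * (2 ^ D + D * l)) ≤ (Real.exp 1) ^ (11 * (2 ^ D + D * l)) := by
          refine pow_le_pow_left₀ (by norm_num) ?_ _
          have := Real.add_one_le_exp 1
          linarith
      _ = Real.exp (11 * (2 ^ D + D * l)) := by
          rw [← Real.exp_nat_mul]
          push_cast
          ring_nf
      _ ≤ _ := by
          refine Real.exp_le_exp.2 ?_
          nlinarith
  have hnat : (n + 1) ^ D * (n * n) * 2 ^ (4 * 2 ^ D) * 100 ≤ 2 ^ (11 * (2 ^ D + D * l)) := by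
    calc (n + 1) ^ D * (n * n) * 2 ^ (4 * 2 ^ D) * 100
        ≤ (2 ^ (l + 1)) ^ D * (2 ^ l * 2 ^ l) * 2 ^ (4 * 2 ^ D) * 2 ^ 7 := by
          gcongr
          norm_num
      _ = 2 ^ ((l + 1) * D + (l + l) + 4 * 2 ^ D + 7) := by
          rw [← pow_mul, ← pow_add, ← pow_add, ← pow_add, ← pow_add]
      _ ≤ _ := by
          refine Nat.pow_le_pow_right (by norm_num) ?_
          have h1 : 1 ≤ 2 ^ D := Nat.one_le_two_pow
          have h2 : D ≤ D * l := Nat.le_mul_of_pos_right _ hl1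
          have h3 : l ≤ D * l := Nat.le_mul_of_pos_left _ hD
          nlinarith
  have hreal : ((n + 1) ^ D * (n * n) : ℝ) * 2 ^ (4 * 2 ^ D) * 100 ≤
      2 ^ (11 * (2 ^ D + D * l)) := by exact_mod_cast hnat
  have hpos : (0 : ℝ) < 2 ^ (11 * (2 ^ D + D * l)) := by positivity
  calc _ ≤ ((n + 1) ^ D * (n * n) : ℝ) *
        (2 ^ (4 * 2 ^ D) * ((2 : ℝ) ^ (11 * (2 ^ D + D * l)))⁻¹) := by gcongr
    _ = ((n + 1) ^ D * (n * n) : ℝ) * 2 ^ (4 * 2 ^ D) / 2 ^ (11 * (2 ^ D + D * l)) := by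
        rw [← mul_assoc, div_eq_mul_inv]
    _ ≤ 1 / 100 := by
        rw [div_le_iff₀ hpos]
        linarith

theorem sampleLaw_isProbabilityMeasure (P : PMF (Cube n)) (m : ℕ) :
    MeasureTheory.IsProbabilityMeasure (sampleLaw P m) := by
  unfold sampleLaw
  infer_instance

theorem sampleLaw_real_goodSamples {d : ℕ} (hd : S.DegreeAtMost d) {m : ℕ} {γ : ℝ} (hγ : 0 < γ)
    (hm : 5632 * ((2 : ℝ) ^ min d n + (min d n : ℕ) * Nat.clog 2 n) ≤ m * γ ^ 2)
    (P : PMF (Cube n)) :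
    (99 / 100 : ℝ) ≤ (sampleLaw P m).real {ω | GoodSamples S (min d n) P γ ω} := by
  have hP := sampleLaw_isProbabilityMeasure P m
  set D := min d n with hD
  set B : Set (Fin m → Cube n) := {ω | ¬ GoodSamples S D P γ ω} with hB
  suffices h : (sampleLaw P m).real B ≤ 1 / 100 by
    have hmeas : MeasurableSet B := (Set.toFinite B).measurableSet
    have := MeasureTheory.measureReal_compl (μ := sampleLaw P m) hmeas
    rw [MeasureTheory.probReal_univ] at this
    have e : {ω | GoodSamples S D P γ ω} = Bᶜ := by
      ext ω
      simp [hB]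
    rw [e]
    linarith
  by_cases hex : ∃ c i j, Tested S D c i j
  swap
  · have : B = ∅ := by
      rw [Set.eq_empty_iff_forall_notMem]
      exact fun ω hω => hω fun c _ i j ht => absurd ⟨c, i, j, ht⟩ hex
    rw [this]
    simp
  obtain ⟨c, i, j, ht⟩ := hex
  obtain ⟨hD1, hn2⟩ := one_le_of_tested hd ht
  refine le_trans ?_ (failure_bound_le hD1 hn2 hm)
  have hsub : B ⊆ ⋃ z ∈ Finset.range ((n + 1) ^ D) ×ˢ (Finset.univ : Finset (Fin n × Fin n)),
      {ω | 2 * (γ / 32 * m) ≤ ∑ k ∈ Finset.range (4 * 2 ^ D),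
        |(codeCount (testCode D z.1 z.2.1 z.2.2) ω k : ℝ) -
          m * codeProb P (testCode D z.1 z.2.1 z.2.2) k|} := by
    intro ω hω
    change ¬ GoodSamples S D P γ ω at hω
    unfold GoodSamples at hω
    push Not at hω
    obtain ⟨c, hc, i, j, _, h⟩ := hω
    simp only [Set.mem_iUnion]
    exact ⟨(c, i, j), by simpa using hc, h⟩
  refine (MeasureTheory.measureReal_mono hsub (MeasureTheory.measure_ne_top _ _)).trans ?_
  refine (MeasureTheory.measureReal_biUnion_finset_le _ _).trans ?_
  refine (Finset.sum_le_sum fun z _ => sampleLaw_real_codeCount_le P m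
    (testCode D z.1 z.2.1 z.2.2) (pairCode_lt (isCode_bitCode n D z.1))
      (ε := γ / 32) (by positivity)).trans (le_of_eq ?_)
  rw [Finset.sum_const, nsmul_eq_mul]
  simp [hD]

theorem testPasses_of_nonDegenerate {d : ℕ} {m : ℕ} (hm : 0 < m) {γ : ℝ} {P : PMF (Cube n)}
    (hP : NonDegenerate P γ S d) {ω : Fin m → Cube n}
    (h : GoodSamples S (min d n) P γ ω) : TestPasses S (min d n) γ ω := by
  intro c hc i j ht
  have h1 := (abs_lt.1 (h.abs_testStat_sub_lt hm hc ht)).1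
  obtain ⟨_, hij, hi, hj, hrel⟩ := ht
  have h2 := (hP i j _ hij ((card_digitSet_le n _ c).trans (min_le_left _ _)) hi hj hrel).le_depStat
    (isCode_bitCode n (min d n) c) hij hi hj
  have h3 := mul_le_mul_of_nonneg_left h2 (Nat.cast_nonneg (α := ℝ) m)
  rw [testCode] at h1
  linarith

theorem not_testPasses_of_not_isBayesNet {d : ℕ} {m : ℕ} (hm : 0 < m) {γ : ℝ} {P : PMF (Cube n)}
    {S' : BayesStructure n} (hd : S'.DegreeAtMost d) (hP : IsBayesNet P S')
    (hE : S'.numEdges ≤ S.numEdges) (hS : ¬ IsBayesNet P S) {ω : Fin m → Cube n}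
    (h : GoodSamples S (min d n) P γ ω) : ¬ TestPasses S (min d n) γ ω := by
  obtain ⟨i, j, T, hij, hT, hi, hj, hrel, hCI⟩ := hP.exists_relevant_condIndep hd hE hS
  have hT' : T.card ≤ min d n := le_min hT (by simpa using Finset.card_le_univ T)
  obtain ⟨c, hc, hsort, rfl⟩ := exists_digitSet_eq T hT'
  intro hpass
  have ht : Tested S (min d n) c i j := ⟨hsort, hij, hi, hj, hrel⟩
  have h1 := (abs_lt.1 (h.abs_testStat_sub_lt hm hc ht)).2
  have h2 := hpass c hc i j ht
  rw [testCode, hCI.depStat_eq_zero (isCode_bitCode n (min d n) c) hij hi hj, mul_zero,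
    sub_zero] at h1
  linarith

end Test

/-! ### Programs with named arrays -/

/-- The names of the arrays (and of the registers, which are the arrays of which only the first
cell is used) of the program. -/
inductive Reg where
  | deg | logn | pw | tables | tuples | samples | s | k | c | i | j | ok | quot | prev | sorted
  | cur | cond | code | digits | marks | counts | bits
  deriving DecidableEq

namespace Reg

/-- The number of an array. -/
def idx : Reg → ℕ
  | deg => 0 | logn => 1 | pw => 2 | tables => 3 | tuples => 4 | samples => 5 | s => 6 | k => 7
  | c => 8 | i => 9 | j => 10 | ok => 11 | quot => 12 | prev => 13 | sorted => 14 | cur => 15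
  | cond => 16 | code => 17 | digits => 18 | marks => 19 | counts => 20 | bits => 21

/-- The stride of the interleaving is `32`: every array is unbounded, without any layout depending
on its length. -/
theorem idx_lt (r : Reg) : r.idx < 32 := by cases r <;> decide

theorem idx_injective : Function.Injective idx := by
  intro a b h
  cases a <;> cases b <;> first | rfl | exact absurd h (by decide)

end Reg

/-- The memory as it is used by the program: the arrays, which are interleaved behind the input, the
real memory, the latest sample, and the samples that have not been drawn yet. -/
structure Mem (n : ℕ) where
  a : Reg → ℕ → ℕ
  x : ℕ → ℝ
  smp : Cube n
  rest : List (Cube n)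

namespace Mem

variable {n : ℕ}

/-- Write into an array. -/
def set (v : Mem n) (r : Reg) (i x : ℕ) : Mem n :=
  { v with a := Function.update v.a r (Function.update (v.a r) i x) }

/-- Write into the real memory. -/
def setX (v : Mem n) (i : ℕ) (x : ℝ) : Mem n := { v with x := Function.update v.x i x }

variable (v : Mem n) (r : Reg) (i x : ℕ)

@[simp] theorem set_a_self : (v.set r i x).a r = Function.update (v.a r) i x := by simp [set]

theorem set_a_of_ne {r' : Reg} (h : r' ≠ r) : (v.set r i x).a r' = v.a r' := by simp [set, h]

@[simp] theorem set_x : (v.set r i x).x = v.x := rfl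

@[simp] theorem set_rest : (v.set r i x).rest = v.rest := rfl

@[simp] theorem setX_x (y : ℝ) : (v.setX i y).x = Function.update v.x i y := rfl

/-- `v'` differs from `v` only in the arrays listed in `F`, in the real memory apart from
address `0`, and in the latest sample. -/
structure Frame (F : List Reg) (v v' : Mem n) : Prop where
  a : ∀ r, r ∉ F → v'.a r = v.a r
  x : v'.x 0 = v.x 0
  rest : v'.rest = v.rest

variable {v} {F G : List Reg} {v' v'' : Mem n}

theorem Frame.refl : Frame F v v := ⟨fun _ _ => rfl, rfl, rfl⟩

theorem Frame.trans (h : Frame F v v') (h' : Frame F v' v'') : Frame F v v'' :=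
  ⟨fun r hr => (h'.a r hr).trans (h.a r hr), h'.x.trans h.x, h'.rest.trans h.rest⟩

theorem Frame.mono (h : Frame F v v') (hFG : F ⊆ G) : Frame G v v' :=
  ⟨fun r hr => h.a r fun e => hr (hFG e), h.x, h.rest⟩

theorem Frame.set (h : Frame F v v') {r : Reg} (hr : r ∈ F) (i x : ℕ) :
    Frame F v (v'.set r i x) :=
  ⟨fun r' hr' => (set_a_of_ne _ _ _ _ fun e => hr' (by rwa [e])).trans (h.a r' hr'), h.x, h.rest⟩

end Mem

/-- The word at each address of the input. -/
noncomputable def inputWord {n : ℕ} (S : BayesStructure n) (d a : ℕ) : ℕ :=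
  if a = 0 then n
  else if a = 1 then d
  else if ∃ i j : Fin n, a = 2 + i * n + j ∧ i ∈ S.parents j then 1
  else 0

/-- The state `s` of the machine represents `v`: the input is intact, followed by the arrays. -/
structure Represents {n : ℕ} (S : BayesStructure n) (d : ℕ) (s : MachineState n) (v : Mem n) : Prop where
  input : ∀ a < 2 + n * n, s.word a = inputWord S d a
  arr : ∀ r i, s.word (2 + n * n + (32 * i + r.idx)) = v.a r i
  real : s.real = v.x
  sample : s.sample = v.smp
  rest : s.rest = v.rest

namespace WordExpr

/-- The number of nodes. -/
def nodes : WordExpr := cell (lit 0)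

/-- The degree bound. -/
def degree : WordExpr := cell (lit 1)

/-- The entry of the adjacency matrix for the edge `i → j`. -/
def edge (i j : WordExpr) : WordExpr := cell (add (add (lit 2) (mul i nodes)) j)

/-- The address of a cell of an array. -/
def arrAddr (r : Reg) (i : WordExpr) : WordExpr :=
  add (add (lit 2) (mul nodes nodes)) (add (mul (lit 32) i) (lit r.idx))

/-- A cell of an array. -/
def arr (r : Reg) (i : WordExpr) : WordExpr := cell (arrAddr r i)

/-- A register. -/
def reg (r : Reg) : WordExpr := arr r (lit 0)

end WordExpr

namespace Prog

open WordExpr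

/-- Write into an array. -/
def set (r : Reg) (i e : WordExpr) : Prog := setWord (arrAddr r i) e

/-- Write into a register. -/
def setReg (r : Reg) (e : WordExpr) : Prog := set r (lit 0) e

/-- Run `p` for each value of `r` below `e`. -/
def forLoop (r : Reg) (e : WordExpr) (p : Prog) : Prog :=
  seq (setReg r (lit 0))
    (.while (.wordLt (reg r) e) (seq p (setReg r (add (reg r) (lit 1)))))

end Prog

/-! ### Rules for verifying programs together with their running time -/

section Run

variable {n : ℕ} {S : BayesStructure n} {d : ℕ} {s : MachineState n} {v : Mem n}

namespace Represents

theorem nodes (h : Represents S d s v) : WordExpr.nodes.eval s = n := by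
  simp [WordExpr.nodes, WordExpr.eval, h.input, inputWord]

theorem degree (h : Represents S d s v) (hn : 1 ≤ n) : WordExpr.degree.eval s = d := by
  have : 0 < n * n := Nat.mul_pos hn hn
  simp [WordExpr.degree, WordExpr.eval, h.input 1 (by omega), inputWord]

theorem evalArr (h : Represents S d s v) (r : Reg) (i : WordExpr) :
    (WordExpr.arr r i).eval s = v.a r (i.eval s) := by
  rw [← h.arr, WordExpr.arr, WordExpr.eval, WordExpr.arrAddr]
  simp only [WordExpr.eval, h.nodes]

theorem evalReg (h : Represents S d s v) (r : Reg) : (WordExpr.reg r).eval s = v.a r 0 :=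
  h.evalArr r _

open Classical in
theorem edge (h : Represents S d s v) {e f : WordExpr} {i j : Fin n} (he : e.eval s = i)
    (hf : f.eval s = j) : (WordExpr.edge e f).eval s = if S.Edge i j then 1 else 0 := by
  have hi := i.2
  have hj := j.2
  have hlt : (i : ℕ) * n + j < n * n := by nlinarith
  simp only [WordExpr.edge, WordExpr.eval, he, hf, h.nodes]
  rw [h.input _ (by omega), inputWord, if_neg (by omega), if_neg (by omega)]
  refine if_congr ⟨?_, fun h => ⟨i, j, rfl, h⟩⟩ rfl rfl
  -- The offset `i * n + j` determines `i` and `j` because `j < n`.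
  rintro ⟨i', j', heq, hmem⟩
  have hj' := j'.2
  have h1 : (i : ℕ) * n + j = i' * n + j' := by omega
  have hn : 0 < n := by omega
  have h2 : (i : ℕ) = i' := by
    have := congrArg (· / n) h1
    simpa [Nat.mul_add_div, mul_comm _ n, Nat.mul_add_div hn, Nat.div_eq_of_lt] using this
  have h3 : (j : ℕ) = j' := by
    rw [h2] at h1
    omega
  rw [Fin.ext h2, Fin.ext h3]
  exact hmem

theorem setWord (h : Represents S d s v) (r : Reg) (i x : ℕ) :
    Represents S d { s with word := Function.update s.word (2 + n * n + (32 * i + r.idx)) x }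
      (v.set r i x) where
  input a ha := by
    rw [← h.input a ha]
    exact Function.update_of_ne (by omega) _ _
  arr r' i' := by
    have h1 := r.idx_lt
    have h2 := r'.idx_lt
    by_cases hr : r' = r
    · subst hr
      by_cases hi : i' = i
      · subst hi
        simp
      · rw [Mem.set_a_self, Function.update_of_ne hi, ← h.arr]
        exact Function.update_of_ne (by omega) _ _
    · rw [Mem.set_a_of_ne _ _ _ _ hr, ← h.arr]
      have : r'.idx ≠ r.idx := fun e => hr (Reg.idx_injective e)
      exact Function.update_of_ne (by omega) _ _
  real := h.real
  sample := h.sample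
  rest := h.rest

theorem setReal (h : Represents S d s v) (i : ℕ) (x : ℝ) :
    Represents S d { s with real := Function.update s.real i x } (v.setX i x) where
  input := h.input
  arr := h.arr
  real := by rw [h.real]; rfl
  sample := h.sample
  rest := h.rest

end Represents

variable (S d)

/-- On a machine of word length `w`, started with the memory `v`, the program `p` halts within time
`T` with a memory that satisfies `Q`. -/
def Run (w : ℕ) (p : Prog) (v : Mem n) (T : ℕ) (Q : Mem n → Prop) : Prop :=
  ∀ s, Represents S d s v → ∃ s' v' t, Exec w p s s' t ∧ Represents S d s' v' ∧ t ≤ T ∧ Q v'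

variable {S d} {w : ℕ} {p q : Prog} {T T' : ℕ} {Q Q' : Mem n → Prop}

namespace Run

theorem mono (h : Run S d w p v T Q) (hT : T ≤ T') (hQ : ∀ v', Q v' → Q' v') :
    Run S d w p v T' Q' := by
  intro s hs
  obtain ⟨s', v', t, h1, h2, h3, h4⟩ := h s hs
  exact ⟨s', v', t, h1, h2, h3.trans hT, hQ v' h4⟩

theorem skip (hT : 1 ≤ T) (hQ : Q v) : Run S d w .skip v T Q :=
  fun s hs => ⟨s, v, 1, Exec.skip s, hs, hT, hQ⟩

theorem seq (h : Run S d w p v T Q') (h' : ∀ v', Q' v' → Run S d w q v' T' Q) :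
    Run S d w (.seq p q) v (T + T') Q := by
  intro s hs
  obtain ⟨s₁, v₁, t₁, h1, h2, h3, h4⟩ := h s hs
  obtain ⟨s₂, v₂, t₂, h5, h6, h7, h8⟩ := h' v₁ h4 s₁ h2
  exact ⟨s₂, v₂, t₁ + t₂, Exec.seq _ _ _ _ _ _ _ h1 h5, h6, add_le_add h3 h7, h8⟩

/-- Expressions and tests are charged a flat `1000`; that their actual cost is smaller is left as
the side condition `hc`, settled by computation wherever the rule is used. -/
theorem ite {b : BoolExpr} {R : Prop} (hb : ∀ s, Represents S d s v → (b.Holds s ↔ R))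
    (hp : R → Run S d w p v T Q) (hq : ¬ R → Run S d w q v T Q) (hc : b.cost + 1 ≤ 1000) :
    Run S d w (.ite b p q) v (T + 1000) Q := by
  intro s hs
  by_cases hR : R
  · obtain ⟨s', v', t, h1, h2, h3, h4⟩ := hp hR s hs
    exact ⟨s', v', _, Exec.iteTrue _ _ _ _ _ _ ((hb s hs).2 hR) h1, h2, by omega, h4⟩
  · obtain ⟨s', v', t, h1, h2, h3, h4⟩ := hq hR s hs
    exact ⟨s', v', _, Exec.iteFalse _ _ _ _ _ _ (fun h => hR ((hb s hs).1 h)) h1, h2, by omega, h4⟩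

/-- A single number `B` bounds all indices and all stored values, so the hypothesis `hw` rules out
overflow of words and of addresses alike. -/
theorem set {B : ℕ} (hw : 2 + n * n + 32 * (B + 1) ≤ 2 ^ w) {r : Reg} {e f : WordExpr}
    {i x : ℕ} (he : ∀ s, Represents S d s v → e.eval s = i) (hf : ∀ s, Represents S d s v → f.eval s = x)
    (hi : i ≤ B) (hx : x ≤ B) (hQ : Q (v.set r i x))
    (hc : (WordExpr.arrAddr r e).cost + f.cost + 1 ≤ 1000) :
    Run S d w (.set r e f) v 1000 Q := by
  intro s hs
  have hr := r.idx_lt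
  have haddr : (WordExpr.arrAddr r e).eval s = 2 + n * n + (32 * i + r.idx) := by
    simp only [WordExpr.arrAddr, WordExpr.eval, hs.nodes, he s hs]
  refine ⟨_, v.set r i x, _, Exec.setWord _ _ _ ?_ ?_, ?_, hc, hQ⟩
  · rw [haddr]
    omega
  · rw [hf s hs]
    omega
  · rw [haddr, hf s hs]
    exact hs.setWord r i x

theorem setReg {B : ℕ} (hw : 2 + n * n + 32 * (B + 1) ≤ 2 ^ w) {r : Reg} {f : WordExpr}
    {x : ℕ} (hf : ∀ s, Represents S d s v → f.eval s = x) (hx : x ≤ B) (hQ : Q (v.set r 0 x))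
    (hc : (WordExpr.arrAddr r (.lit 0)).cost + f.cost + 1 ≤ 1000) :
    Run S d w (.setReg r f) v 1000 Q :=
  set hw (fun _ _ => rfl) hf (Nat.zero_le _) hx hQ hc

theorem setReal {f : RealExpr} {i : ℕ} {x : ℝ} (hi : i < 2 ^ w)
    (hf : ∀ s, Represents S d s v → f.eval s = x) (hQ : Q (v.setX i x)) (hc : f.cost + 2 ≤ 1000) :
    Run S d w (.setReal (.lit i) f) v 1000 Q := by
  intro s hs
  refine ⟨_, v.setX i x, _, Exec.setReal _ _ _ hi, ?_, ?_, hQ⟩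
  · rw [hf s hs]
    exact hs.setReal i x
  · rw [WordExpr.cost]
    omega

theorem draw {y : Cube n} {l : List (Cube n)} (hr : v.rest = y :: l)
    (hQ : Q { v with smp := y, rest := l }) : Run S d w .draw v n Q := by
  intro s hs
  refine ⟨_, { v with smp := y, rest := l }, _, Exec.draw s y l (hs.rest.trans hr), ?_, le_rfl, hQ⟩
  exact ⟨hs.input, hs.arr, hs.real, rfl, rfl⟩

/-- The rule for a loop that runs `N` times. -/
theorem whileLoop {b : BoolExpr} (N : ℕ) (I : ℕ → Mem n → Prop) (T : ℕ → ℕ)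
    (htrue : ∀ k < N, ∀ v, I k v → ∀ s, Represents S d s v → b.Holds s)
    (hfalse : ∀ v, I N v → ∀ s, Represents S d s v → ¬ b.Holds s)
    (hbody : ∀ k < N, ∀ v, I k v → Run S d w p v (T k) (I (k + 1))) (hc : b.cost + 1 ≤ 1000)
    (h0 : I 0 v) :
    Run S d w (.while b p) v (∑ k ∈ Finset.range N, (T k + 1000) + 1000) (I N) := by
  -- Induction on the number `k` of iterations that remain.
  suffices h : ∀ k ≤ N, ∀ v, I (N - k) v →
      Run S d w (.while b p) v (∑ l ∈ Finset.Ico (N - k) N, (T l + 1000) + 1000) (I N) by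
    have := h N le_rfl v (by rwa [Nat.sub_self])
    rwa [Nat.sub_self, ← Finset.range_eq_Ico] at this
  intro k
  induction k with
  | zero =>
    intro _ v hv s hs
    exact ⟨s, v, _, Exec.whileFalse _ _ _ (hfalse v hv s hs), hs, by omega, hv⟩
  | succ k ih =>
    intro hk v hv s hs
    obtain ⟨s₁, v₁, t₁, h1, h2, h3, h4⟩ := hbody _ (by omega) v hv s hs
    rw [show N - (k + 1) + 1 = N - k by omega] at h4
    obtain ⟨s₂, v₂, t₂, h5, h6, h7, h8⟩ := ih (by omega) v₁ h4 s₁ h2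
    refine ⟨s₂, v₂, _, Exec.whileTrue _ _ _ _ _ _ _
      (htrue _ (by omega) v hv s hs) h1 h5, h6, ?_, h8⟩
    rw [Finset.sum_eq_sum_Ico_succ_bot (by omega), show N - (k + 1) + 1 = N - k by omega]
    omega

/-- The rule for loops over the values of a register. -/
theorem forLoop {B : ℕ} (hw : 2 + n * n + 32 * (B + 1) ≤ 2 ^ w) {r : Reg} {e : WordExpr} {N : ℕ}
    (hN : N ≤ B) (I : ℕ → Mem n → Prop) (T : ℕ → ℕ)
    (he : ∀ k ≤ N, ∀ v, I k v → ∀ s, Represents S d s v → e.eval s = N)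
    (hbody : ∀ k < N, ∀ v, I k v → v.a r 0 = k →
      Run S d w p v (T k) fun v' => v'.a r 0 = k ∧ I (k + 1) (v'.set r 0 (k + 1)))
    (hc : (BoolExpr.wordLt (.reg r) e).cost + 1 ≤ 1000) (h0 : I 0 (v.set r 0 0)) :
    Run S d w (.forLoop r e p) v (∑ k ∈ Finset.range N, (T k + 2000) + 2000) (I N) := by
  have hloop : ∀ v, I 0 v ∧ v.a r 0 = 0 →
      Run S d w (.while (.wordLt (.reg r) e) (.seq p (.setReg r (.add (.reg r) (.lit 1))))) v
        (∑ k ∈ Finset.range N, ((T k + 1000) + 1000) + 1000) (fun v => I N v ∧ v.a r 0 = N) := by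
    intro v hv
    refine Run.whileLoop N (fun k v => I k v ∧ v.a r 0 = k) (fun k => T k + 1000) ?_ ?_ ?_ hc hv
    · intro k hk v hv s hs
      simpa only [BoolExpr.Holds, hs.evalReg, hv.2, he k hk.le v hv.1 s hs] using hk
    · intro v hv s hs
      simp only [BoolExpr.Holds, hs.evalReg, hv.2, he N le_rfl v hv.1 s hs, lt_irrefl,
        not_false_iff]
    · intro k hk v hv
      refine (hbody k hk v hv.1 hv.2).seq fun v' hv' => ?_
      refine setReg hw (x := k + 1) (fun s hs => ?_) (by omega) ?_ (by
          simp [WordExpr.cost, WordExpr.reg, WordExpr.arr, WordExpr.arrAddr, WordExpr.nodes])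
      · simp only [WordExpr.eval, hs.evalReg, hv'.1]
      · exact ⟨hv'.2, by simp⟩
  refine ((setReg hw (x := 0) (Q := fun v => I 0 v ∧ v.a r 0 = 0) (fun _ _ => rfl)
    (Nat.zero_le _) ⟨h0, by simp⟩ (by simp [WordExpr.cost, WordExpr.arrAddr, WordExpr.nodes])).seq hloop).mono ?_ fun v hv => hv.1
  simp only [add_assoc, Nat.reduceAdd]
  omega

/-- The rule for loops over the values of a register, with a uniform time bound. -/
theorem forLoop_const {B : ℕ} (hw : 2 + n * n + 32 * (B + 1) ≤ 2 ^ w) {r : Reg} {e : WordExpr}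
    {N : ℕ} (hN : N ≤ B) (I : ℕ → Mem n → Prop) (T : ℕ)
    (he : ∀ k ≤ N, ∀ v, I k v → ∀ s, Represents S d s v → e.eval s = N)
    (hbody : ∀ k < N, ∀ v, I k v → v.a r 0 = k →
      Run S d w p v T fun v' => v'.a r 0 = k ∧ I (k + 1) (v'.set r 0 (k + 1)))
    (hc : (BoolExpr.wordLt (.reg r) e).cost + 1 ≤ 1000) (h0 : I 0 (v.set r 0 0)) :
    Run S d w (.forLoop r e p) v (N * (T + 2000) + 2000) (I N) :=
  (forLoop hw hN I (fun _ => T) he hbody hc h0).mono (by simp) fun _ h => h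

end Run

end Run

/-! ### The program -/

namespace Prog

open WordExpr

/-- The stored bit of the current sample at a given index. -/
def storedBit (e : WordExpr) : WordExpr :=
  -- Rows have length `n + 1`. Position `n` is never written and stays `0`, which is the bit
  -- belonging to the padding digit `n`.
  arr .bits (add (mul (reg .s) (add nodes (lit 1))) e)

/-- Clear the counts. -/
def clearCounts : Prog :=
  forLoop .k (mul (lit 4) (reg .tables)) (set .counts (reg .k) (lit 0))

/-- Compute the code of the current sample and count it. -/
def countSample : Prog :=
  seq (setReg .code (lit 0)) <|
  seq (forLoop .k (reg .deg)
    (setReg .code (add (mul (lit 2) (reg .code)) (storedBit (arr .digits (reg .k)))))) <|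
  seq (setReg .code (add (add (mul (lit 4) (reg .code)) (mul (lit 2) (storedBit (reg .i))))
    (storedBit (reg .j)))) <|
  set .counts (reg .code) (add (arr .counts (reg .code)) (lit 1))

/-- Count the codes of all the samples. -/
def countSamples : Prog := forLoop .s (reg .samples) countSample

/-- An entry of the current table. -/
def count (b : ℕ) : WordExpr := arr .counts (add (mul (lit 4) (reg .k)) (lit b))

/-- The distance of two words. -/
def dist (e f : WordExpr) : WordExpr := add (sub e f) (sub f e)

/-- The sum of the current table. -/
def total : WordExpr := add (add (add (count 0) (count 1)) (count 2)) (count 3)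

/-- Compute the statistic from the counts. -/
def statistic : Prog :=
  seq (setReal (lit 1) (.ofWord (lit 0))) <|
  forLoop .k (reg .tables) <|
    setReal (lit 1) (.add (.cell (lit 1))
      (.div
        (.ofWord (mul (lit 2) (dist (mul (count 3) (count 0)) (mul (count 1) (count 2)))))
        -- With truncated subtraction this is `max total 1`, so an empty table contributes `0 / 1`.
        (.ofWord (add total (sub (lit 1) total)))))

/-- Reject if the statistic is too small. -/
def judge : Prog :=
  ite (.realLt (.mul (.ofWord (lit 2)) (.cell (lit 1)))
      (.mul (.cell (lit 0)) (.ofWord (reg .samples))))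
    (setReg .ok (lit 0)) skip

/-- Reject if the nodes `i` and `j` look independent given the current set of nodes. -/
def testPair : Prog := seq clearCounts <| seq countSamples <| seq statistic judge

/-- Find out whether a pair of nodes and the current set have to be tested. -/
def relevance : Prog :=
  seq (setReg .cond (edge (reg .i) (reg .j))) <|
  forLoop .k nodes <|
    setReg .cond (add (reg .cond) (add
      -- The first summand is clause (b), the second is clauses (c) and (d) together; `.cond` ends
      -- up positive exactly for relevant triples.
      (mul (arr .marks (reg .k)) (mul (edge (reg .i) (reg .k)) (edge (reg .j) (reg .k))))
      (mul (sub (lit 1) (arr .marks (reg .k)))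
        (mul (add (edge (reg .i) (reg .k)) (edge (reg .k) (reg .i)))
          (edge (reg .k) (reg .j))))))

/-- Test a pair of nodes, if necessary. -/
def pair : Prog :=
  seq relevance <|
  ite (.wordLt (lit 0) (mul
      (mul (reg .cond) (mul (sub (lit 1) (arr .marks (reg .i))) (sub (lit 1) (arr .marks (reg .j)))))
      (dist (reg .i) (reg .j))))
    testPair skip

/-- Mark the nodes of the current set. -/
def mark : Prog :=
  seq (forLoop .k nodes (set .marks (reg .k) (lit 0))) <|
  forLoop .k (reg .deg) (set .marks (arr .digits (reg .k)) (lit 1))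

/-- Test all pairs of nodes with the current set. -/
def tuple : Prog := seq mark <| forLoop .i nodes <| forLoop .j nodes pair

/-- Compute the digits of the number of the current set, and whether they are increasing. -/
def decode : Prog :=
  seq (setReg .quot (reg .c)) <|
  seq (setReg .prev (lit 0)) <|
  seq (setReg .sorted (lit 1)) <|
  forLoop .k (reg .deg) <|
    seq (setReg .cur (mod (reg .quot) (add nodes (lit 1)))) <|
    seq (ite (.wordLt (reg .cur) (reg .prev)) (setReg .sorted (lit 0)) skip) <|
    seq (setReg .prev (reg .cur)) <|
    seq (set .digits (reg .k) (reg .cur)) <|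
    setReg .quot (div (reg .quot) (add nodes (lit 1)))

/-- Perform all the tests. -/
def tests : Prog :=
  seq (setReg .ok (lit 1)) <|
  forLoop .c (reg .tuples) <|
    seq decode <|
    ite (.wordLt (lit 0) (reg .sorted)) tuple skip

/-- Compute the degree bound, which need not exceed the number of nodes, and the logarithm of the
number of nodes. -/
def setupLog : Prog :=
  -- Truncated subtraction turns `d - (d - n)` into `min d n`.
  seq (setReg .deg (sub degree (sub degree nodes))) <|
  seq (setReg .pw (lit 1)) <|
  .while (.wordLt (reg .pw) nodes) <|
    seq (setReg .pw (mul (lit 2) (reg .pw))) <|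
    setReg .logn (add (reg .logn) (lit 1))

/-- Compute the number of tables and the number of tuples. -/
def setupPowers : Prog :=
  seq (setReg .tables (lit 1)) <|
  seq (setReg .tuples (lit 1)) <|
  forLoop .k (reg .deg) <|
    seq (setReg .tables (mul (lit 2) (reg .tables))) <|
    setReg .tuples (mul (reg .tuples) (add nodes (lit 1)))

/-- Compute the number of samples. -/
def setupSamples : Prog :=
  -- Reals cannot be rounded to words, so the ceiling that defines the sample size is found by
  -- counting upwards.
  .while (.realLt (.mul (.mul (.ofWord (reg .samples)) (.cell (lit 0))) (.cell (lit 0)))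
      (.ofWord (mul (lit 5632) (add (reg .tables) (mul (reg .deg) (reg .logn)))))) <|
    setReg .samples (add (reg .samples) (lit 1))

/-- Draw and store the samples. -/
def drawSamples : Prog :=
  forLoop .s (reg .samples) <|
    seq draw <|
    forLoop .k nodes (set .bits (add (mul (reg .s) (add nodes (lit 1))) (reg .k))
      (sampleBit (reg .k)))

/-- The tester. -/
def tester : Prog :=
  seq setupLog <| seq setupPowers <| seq setupSamples <| seq drawSamples <| seq tests <|
  ite (.wordLt (lit 0) (reg .ok)) (setWord (lit 0) (lit 1)) (setWord (lit 0) (lit 0))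

end Prog

/-! ### Correctness of the tests -/

section Tests

open WordExpr Mem

variable {n : ℕ} {S : BayesStructure n} {d w B : ℕ}

/-- The contents of the memory once the samples have been stored. -/
structure Ready (D m : ℕ) (γ : ℝ) (ω : Fin m → Cube n) (v : Mem n) : Prop where
  deg : v.a .deg 0 = D
  tables : v.a .tables 0 = 2 ^ D
  tuples : v.a .tuples 0 = (n + 1) ^ D
  samples : v.a .samples 0 = m
  bits : ∀ (s : Fin m) (k : ℕ), k ≤ n → v.a .bits (s * (n + 1) + k) = bitAt (ω s) k
  gamma : v.x 0 = γ

/-- The arrays that are changed by the tests. -/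
def loopRegs : List Reg :=
  [.k, .s, .code, .counts, .ok, .cond, .i, .j, .marks, .quot, .prev, .sorted, .cur, .digits, .c]

variable {D m : ℕ} {γ : ℝ} {ω : Fin m → Cube n} {v v' : Mem n} {F : List Reg}

theorem Ready.frame (h : Ready D m γ ω v) (hF : Frame F v v') (hFL : F ⊆ loopRegs) :
    Ready D m γ ω v' := by
  have hF' := hF.mono hFL
  refine ⟨?_, ?_, ?_, ?_, ?_, ?_⟩
  · rw [hF'.a .deg (by decide), h.deg]
  · rw [hF'.a .tables (by decide), h.tables]
  · rw [hF'.a .tuples (by decide), h.tuples]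
  · rw [hF'.a .samples (by decide), h.samples]
  · rw [hF'.a .bits (by decide)]
    exact h.bits
  · rw [hF'.x, h.gamma]

/-- A bound on all the words that occur. -/
def WordBound (n D m B : ℕ) : Prop := 4 * 2 ^ D + (n + 1) ^ D + 4 * ((m + 1) * (n + 1)) ≤ B

theorem WordBound.facts (h : WordBound n D m B) :
    4 * 2 ^ D ≤ B ∧ (n + 1) ^ D ≤ B ∧ 4 * m ≤ B ∧ 4 * (n + 1) ≤ B ∧ D ≤ B ∧
      ∀ s < m, ∀ k ≤ n, s * (n + 1) + k ≤ B := by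
  unfold WordBound at h
  have h1 : D < 2 ^ D := Nat.lt_two_pow_self
  have h2 : (m + 1) * (n + 1) = m * (n + 1) + (n + 1) := by ring
  have h3 : m ≤ m * (n + 1) := Nat.le_mul_of_pos_right _ (Nat.succ_pos n)
  refine ⟨by omega, by omega, by omega, by omega, by omega, fun s hs k hk => ?_⟩
  have : s * (n + 1) ≤ m * (n + 1) := Nat.mul_le_mul_right _ hs.le
  omega

variable (hw : 2 + n * n + 32 * (B + 1) ≤ 2 ^ w) (hB : WordBound n D m B)

include hw hB

theorem run_clearCounts (hv : Ready D m γ ω v) :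
    Run S d w Prog.clearCounts v (4 * 2 ^ D * 3000 + 2000) fun v' =>
      Frame [.k, .counts] v v' ∧ ∀ q < 4 * 2 ^ D, v'.a .counts q = 0 := by
  obtain ⟨hB1, hB2, hB3, hB4, hB5, hB6⟩ := hB.facts
  refine Run.forLoop_const hw hB1
    (fun k v' => Frame [.k, .counts] v v' ∧ ∀ q < k, v'.a .counts q = 0) 1000 ?_ ?_ (by decide) ?_
  · intro k _ v' hI s hs
    simp [WordExpr.eval, hs.evalReg, (hv.frame hI.1 (by decide)).tables]
  · intro k hk v' hI hvk
    refine Run.set hw (i := k) (x := 0) (fun s hs => ?_) (fun s hs => rfl) (by omega) (by omega)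
      ⟨?_, ?_, ?_⟩ (by decide)
    · rw [hs.evalReg, hvk]
    · simp [set_a_of_ne, hvk]
    · exact (hI.1.set (by decide) _ _).set (by decide) _ _
    · intro q hq
      rw [set_a_of_ne _ _ _ _ (by decide), set_a_self, Function.update_apply]
      split_ifs with h
      · rfl
      · exact hI.2 q (by omega)
  · exact ⟨Frame.refl.set (by decide) _ _, by simp⟩

/-- The registers that hold the current test. -/
structure Current (D c : ℕ) (i j : Fin n) (v : Mem n) : Prop where
  i : v.a .i 0 = i
  j : v.a .j 0 = j
  digits : ∀ k < D, v.a .digits k = digit n c k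

omit hw hB in
theorem Current.frame {c : ℕ} {i j : Fin n} (h : Current D c i j v) (hF : Frame F v v')
    (hFL : F ⊆ [.k, .s, .code, .counts, .ok, .cond]) : Current D c i j v' := by
  have hF' := hF.mono hFL
  refine ⟨?_, ?_, ?_⟩
  · rw [hF'.a .i (by decide), h.i]
  · rw [hF'.a .j (by decide), h.j]
  · rw [hF'.a .digits (by decide)]
    exact h.digits

theorem run_countSample (hv : Ready D m γ ω v) {c : ℕ} {i j : Fin n} (hc : Current D c i j v)
    (s : Fin m) (hs : v.a .s 0 = s) (hcnt : ∀ q < 4 * 2 ^ D, v.a .counts q + 1 ≤ B) :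
    Run S d w Prog.countSample v (D * 3000 + 5000) fun v' =>
      Frame [.k, .code, .counts] v v' ∧ ∀ q, v'.a .counts q =
        v.a .counts q + if testCode D c i j (ω s) = q then 1 else 0 := by
  obtain ⟨hB1, hB2, hB3, hB4, hB5, hB6⟩ := hB.facts
  have hbit : ∀ {v' : Mem n} {F : List Reg}, Frame F v v' → F ⊆ [.k, .code] →
      ∀ σ, Represents S d σ v' → ∀ (e : WordExpr) (q : ℕ), q ≤ n → e.eval σ = q →
      (Prog.storedBit e).eval σ = bitAt (ω s) q := by
    intro v' F hF hFL σ hσ e q hq he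
    rw [Prog.storedBit, hσ.evalArr, ← hv.bits s q hq, (hF.mono hFL).a .bits (by decide)]
    simp only [WordExpr.eval, hσ.evalReg, hσ.nodes, he, (hF.mono hFL).a .s (by decide), hs]
  have hcode : ∀ k ≤ D, bitCode (digit n c) (ω s) k ≤ 2 ^ D := fun k hk =>
    (bitCode_lt _ _ _).le.trans (Nat.pow_le_pow_right (by norm_num) hk)
  have hpair : testCode D c i j (ω s) < 4 * 2 ^ D := pairCode_lt (isCode_bitCode n D c) _
  refine Run.mono (T := 1000 + ((D * 3000 + 2000) + (1000 + 1000))) ?_ (by omega) fun _ h => h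
  refine (Run.setReg hw (x := 0) (Q := fun v' => Frame [.k, .code] v v' ∧ v'.a .code 0 = 0)
    (fun _ _ => rfl) (Nat.zero_le _) ⟨Frame.refl.set (by decide) _ _, by simp⟩ (by decide)).seq
    fun v₁ h₁ => ?_
  refine Run.seq (Q' := fun v' => Frame [.k, .code] v v' ∧
    v'.a .code 0 = bitCode (digit n c) (ω s) D) ?_ fun v₂ h₂ => ?_
  · refine Run.forLoop_const hw hB5 (fun k v' => Frame [.k, .code] v v' ∧
      v'.a .code 0 = bitCode (digit n c) (ω s) k) 1000 ?_ ?_ (by decide) ?_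
    · intro k _ v' hI σ hσ
      rw [hσ.evalReg, (hv.frame hI.1 (by decide)).deg]
    · intro k hk v' hI hvk
      refine Run.setReg hw (x := bitCode (digit n c) (ω s) (k + 1)) (fun σ hσ => ?_)
        ((hcode _ hk).trans (by omega)) ⟨?_, ?_, ?_⟩ (by decide)
      · have h := hbit hI.1 (by decide) σ hσ (arr .digits (reg .k)) (digit n c k) (digit_le n c k)
          (by rw [hσ.evalArr, hσ.evalReg, hvk, (hc.frame hI.1 (by decide)).digits k hk])
        simp only [WordExpr.eval, hσ.evalReg, h, hI.2, bitCode]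
      · simpa [set_a_of_ne] using hvk
      · exact (hI.1.set (by decide) _ _).set (by decide) _ _
      · simp [set_a_of_ne]
    · refine ⟨h₁.1.set (by decide) _ _, ?_⟩
      simpa [set_a_of_ne, bitCode] using h₁.2
  refine Run.seq (Q' := fun v' => Frame [.k, .code] v v' ∧
    v'.a .code 0 = testCode D c i j (ω s)) ?_ fun v₃ h₃ => ?_
  · refine Run.setReg hw (x := testCode D c i j (ω s)) (fun σ hσ => ?_) (by omega)
      ⟨h₂.1.set (by decide) _ _, by simp⟩ (by decide)
    have hcur := hc.frame h₂.1 (by decide)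
    have h1 := hbit h₂.1 (by decide) σ hσ (reg .i) i i.2.le (by rw [hσ.evalReg, hcur.i])
    have h2 := hbit h₂.1 (by decide) σ hσ (reg .j) j j.2.le (by rw [hσ.evalReg, hcur.j])
    simp only [WordExpr.eval, hσ.evalReg, h1, h2, h₂.2, testCode, pairCode, bitAt, i.2, j.2,
      dif_pos]
  · have h4 : v₃.a .counts = v.a .counts := h₃.1.a .counts (by decide)
    refine Run.set hw (i := testCode D c i j (ω s))
      (x := v.a .counts (testCode D c i j (ω s)) + 1) (fun σ hσ => ?_) (fun σ hσ => ?_)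
      (by omega) (hcnt _ hpair) ⟨?_, fun q => ?_⟩ (by decide)
    · rw [hσ.evalReg, h₃.2]
    · simp only [WordExpr.eval, hσ.evalReg, hσ.evalArr, h₃.2, h4]
    · exact (h₃.1.mono (by decide)).set (by decide) _ _
    · rw [set_a_self, Function.update_apply, h4]
      by_cases h : q = testCode D c i j (ω s)
      · simp [h]
      · simp [h, Ne.symm h]

omit hw hB in
/-- The number of the first `s` samples with code `q`. -/
def partialCount (g : Cube n → ℕ) (ω : Fin m → Cube n) (s q : ℕ) : ℕ :=
  (Finset.univ.filter fun s' : Fin m => (s' : ℕ) < s ∧ g (ω s') = q).card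

omit hw hB in
theorem partialCount_succ (g : Cube n → ℕ) (ω : Fin m → Cube n) (s : Fin m) (q : ℕ) :
    partialCount g ω (s + 1) q = partialCount g ω s q + if g (ω s) = q then 1 else 0 := by
  unfold partialCount
  split_ifs with h
  · rw [← Finset.card_insert_of_notMem (a := s) (by simp)]
    congr 1
    ext s'
    simp only [Finset.mem_filter, Finset.mem_univ, true_and, Finset.mem_insert,
      Nat.lt_succ_iff_lt_or_eq, ← Fin.ext_iff]
    constructor
    · rintro ⟨h1 | h1, h2⟩
      · exact Or.inr ⟨h1, h2⟩
      · exact Or.inl h1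
    · rintro (h1 | h1)
      · exact ⟨Or.inr h1, h1 ▸ h⟩
      · exact ⟨Or.inl h1.1, h1.2⟩
  · rw [add_zero]
    congr 1
    ext s'
    simp only [Finset.mem_filter, Finset.mem_univ, true_and,
      Nat.lt_succ_iff_lt_or_eq, ← Fin.ext_iff]
    constructor
    · rintro ⟨h1 | h1, h2⟩
      · exact ⟨h1, h2⟩
      · exact absurd (h1 ▸ h2) h
    · exact fun h1 => ⟨Or.inl h1.1, h1.2⟩

omit hw hB in
theorem partialCount_le (g : Cube n → ℕ) (ω : Fin m → Cube n) (s q : ℕ) :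
    partialCount g ω s q ≤ m :=
  (Finset.card_le_univ _).trans (by simp)

theorem run_countSamples (hv : Ready D m γ ω v) {c : ℕ} {i j : Fin n} (hc : Current D c i j v)
    (hcnt : ∀ q < 4 * 2 ^ D, v.a .counts q = 0) :
    Run S d w Prog.countSamples v (m * ((D * 3000 + 5000) + 2000) + 2000) fun v' =>
      Frame [.k, .s, .code, .counts] v v' ∧ ∀ q < 4 * 2 ^ D, v'.a .counts q =
        codeCount (testCode D c i j) ω q := by
  obtain ⟨hB1, hB2, hB3, hB4, hB5, hB6⟩ := hB.facts
  refine (Run.forLoop_const hw (N := m) (by omega) (fun s v' =>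
    Frame [.k, .s, .code, .counts] v v' ∧ ∀ q < 4 * 2 ^ D, v'.a .counts q =
      partialCount (testCode D c i j) ω s q) (D * 3000 + 5000) ?_ ?_ (by decide) ?_).mono
        le_rfl fun v' h => ⟨h.1, fun q hq => ?_⟩
  · intro s _ v' hI σ hσ
    rw [hσ.evalReg, (hv.frame hI.1 (by decide)).samples]
  · intro s hs v' hI hvs
    refine (run_countSample hw hB (hv.frame hI.1 (by decide)) (hc.frame hI.1 (by decide)) ⟨s, hs⟩
      hvs fun q hq => ?_).mono le_rfl fun v'' h'' => ⟨?_, ?_, fun q hq => ?_⟩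
    · rw [hI.2 q hq]
      have := partialCount_le (testCode D c i j) ω s q
      omega
    · rw [h''.1.a .s (by decide), hvs]
    · exact (hI.1.trans (h''.1.mono (by decide))).set (by decide) _ _
    · rw [set_a_of_ne _ _ _ _ (by decide), h''.2, hI.2 q hq]
      exact (partialCount_succ _ _ ⟨s, hs⟩ q).symm
  · refine ⟨Frame.refl.set (by decide) _ _, fun q hq => ?_⟩
    rw [set_a_of_ne _ _ _ _ (by decide), hcnt q hq]
    simp [partialCount]
  · rw [h.2 q hq]
    simp [partialCount, codeCount]

omit hw hB in
theorem cast_dist (p q : ℕ) : ((p - q + (q - p) : ℕ) : ℝ) = |(p : ℝ) - q| := by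
  rcases le_total p q with h | h
  · rw [Nat.sub_eq_zero_of_le h, zero_add, Nat.cast_sub h, abs_sub_comm, abs_of_nonneg]
    exact sub_nonneg.2 (Nat.cast_le.2 h)
  · rw [Nat.sub_eq_zero_of_le h, add_zero, Nat.cast_sub h, abs_of_nonneg]
    exact sub_nonneg.2 (Nat.cast_le.2 h)

theorem run_statistic (hv : Ready D m γ ω v) {c : ℕ} {i j : Fin n}
    (hcnt : ∀ q < 4 * 2 ^ D, v.a .counts q = codeCount (testCode D c i j) ω q) :
    Run S d w Prog.statistic v (1000 + (2 ^ D * 3000 + 2000)) fun v' =>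
      Frame [.k] v v' ∧ v'.x 1 = testStat D ω c i j := by
  obtain ⟨hB1, hB2, hB3, hB4, hB5, hB6⟩ := hB.facts
  have hframe : ∀ (v' : Mem n) (z : ℝ), Frame [.k] v v' → Frame [.k] v (v'.setX 1 z) :=
    fun v' z h => ⟨h.a, by simp [h.x], h.rest⟩
  set u : ℕ → ℝ := fun k => codeCount (testCode D c i j) ω k with hu
  set f : ℕ → ℝ := fun t => 2 * |u (4 * t + 3) * u (4 * t) - u (4 * t + 1) * u (4 * t + 2)| /
    (u (4 * t) + u (4 * t + 1) + u (4 * t + 2) + u (4 * t + 3)) with hf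
  refine Run.seq (Q' := fun v' => Frame [.k] v v' ∧ v'.x 1 = 0) ?_ fun v₁ h₁ => ?_
  · exact Run.setReal (by omega) (x := 0) (fun σ hσ => by simp [RealExpr.eval, WordExpr.eval])
      ⟨hframe _ _ Frame.refl, by simp⟩ (by decide)
  · refine (Run.forLoop_const hw (N := 2 ^ D) (by omega) (fun k v' =>
      Frame [.k] v v' ∧ v'.x 1 = ∑ t ∈ Finset.range k, f t) 1000 ?_ ?_ (by decide) ?_)
    · intro k _ v' hI σ hσ
      rw [hσ.evalReg, (hv.frame hI.1 (by decide)).tables]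
    · intro k hk v' hI hvk
      refine Run.setReal (by omega) (x := v'.x 1 + f k) (fun σ hσ => ?_) ⟨?_, ?_, ?_⟩ (by decide)
      · have hq : ∀ b < 4, (Prog.count b).eval σ = codeCount (testCode D c i j) ω (4 * k + b) := by
          intro b hb
          rw [Prog.count, hσ.evalArr, hI.1.a .counts (by decide)]
          simp only [WordExpr.eval, hσ.evalReg, hvk]
          exact hcnt _ (by omega)
        simp only [RealExpr.eval, WordExpr.eval, Prog.dist, Prog.total, hq, Nat.lt_add_one,
          Nat.reduceLT, hσ.real, hf, hu]
        congr 1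
        rw [Nat.cast_mul, cast_dist]
        simp only [Nat.cast_mul, add_zero, Nat.cast_ofNat]
        generalize codeCount (testCode D c i j) ω (4 * k) = p0
        generalize codeCount (testCode D c i j) ω (4 * k + 1) = p1
        generalize codeCount (testCode D c i j) ω (4 * k + 2) = p2
        generalize codeCount (testCode D c i j) ω (4 * k + 3) = p3
        rcases Nat.eq_zero_or_pos (p0 + p1 + p2 + p3) with h0 | h0
        · obtain ⟨rfl, rfl, rfl, rfl⟩ : p0 = 0 ∧ p1 = 0 ∧ p2 = 0 ∧ p3 = 0 := by omega
          simp
        · rw [Nat.sub_eq_zero_of_le h0, add_zero]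
          push_cast
          rfl
      · exact hvk
      · exact (hframe _ _ hI.1).set (by decide) _ _
      · rw [Finset.sum_range_succ, ← hI.2]
        simp
    · exact ⟨h₁.1.set (by decide) _ _, by simpa using h₁.2⟩

theorem run_testPair (hv : Ready D m γ ω v) {c : ℕ} {i j : Fin n} (hc : Current D c i j v) :
    Run S d w Prog.testPair v (20000 * (2 ^ D + m * (D + 1) + 1)) fun v' =>
      Frame [.k, .s, .code, .counts, .ok] v v' ∧
        (v'.a .ok 0 ≠ 0 ↔ v.a .ok 0 ≠ 0 ∧ γ * m / 2 ≤ testStat D ω c i j) := by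
  refine Run.mono (T := (4 * 2 ^ D * 3000 + 2000) + ((m * ((D * 3000 + 5000) + 2000) + 2000) +
    ((1000 + (2 ^ D * 3000 + 2000)) + (1000 + 1000)))) ?_ ?_ fun _ h => h
  · refine (run_clearCounts hw hB hv).seq fun v₁ h₁ => ?_
    have hv₁ := hv.frame h₁.1 (by decide)
    refine (run_countSamples hw hB hv₁ (hc.frame h₁.1 (by decide)) h₁.2).seq fun v₂ h₂ => ?_
    have hv₂ := hv₁.frame h₂.1 (by decide)
    refine (run_statistic hw hB hv₂ h₂.2).seq fun v₃ h₃ => ?_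
    have hv₃ := hv₂.frame h₃.1 (by decide)
    have hF : Frame [.k, .s, .code, .counts] v v₃ :=
      (h₁.1.mono (by decide)).trans (h₂.1.trans (h₃.1.mono (by decide)))
    have hF' : Frame [.k, .s, .code, .counts, .ok] v v₃ := hF.mono (by decide)
    refine Run.ite (R := 2 * testStat D ω c i j < γ * m) (fun σ hσ => ?_) (fun hR => ?_)
      (fun hR => ?_) (by decide)
    · simp only [BoolExpr.Holds, RealExpr.eval, WordExpr.eval, hσ.evalReg, hσ.real, h₃.2,
        hv₃.gamma, hv₃.samples, Nat.cast_ofNat]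
    · refine Run.setReg hw (x := 0) (fun _ _ => rfl) (Nat.zero_le _)
        ⟨hF'.set (by decide) _ _, ?_⟩ (by decide)
      simp only [set_a_self, Function.update_self, ne_eq, not_true, false_iff, not_and, not_le]
      intro _
      linarith
    · refine Run.skip (by norm_num) ⟨hF', ?_⟩
      rw [hF.a .ok (by decide)]
      exact (and_iff_left (by linarith)).symm
  · have e : m * ((D * 3000 + 5000) + 2000) = 3000 * (m * (D + 1)) + 4000 * m := by ring
    have : m ≤ m * (D + 1) := Nat.le_mul_of_pos_right _ (Nat.succ_pos D)
    omega

end Tests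

/-! ### Relevance, enumeration of pairs and sets, and the loop over all tests -/

section Pairs

open WordExpr Mem

variable {n : ℕ} {S : BayesStructure n} {d w B D m : ℕ} {γ : ℝ} {ω : Fin m → Cube n}
  {v v' : Mem n} {F : List Reg}
  (hw : 2 + n * n + 32 * (B + 1) ≤ 2 ^ w) (hB : WordBound n D m B)

open Classical in
/-- The nodes in `T` are marked. -/
def Marked (T : Finset (Fin n)) (v : Mem n) : Prop :=
  ∀ u : Fin n, v.a .marks u = if u ∈ T then 1 else 0

theorem Marked.frame {T : Finset (Fin n)} (h : Marked T v) (hF : Frame F v v')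
    (hFL : F ⊆ [.k, .s, .code, .counts, .ok, .cond, .i, .j]) : Marked T v' := by
  unfold Marked
  rw [(hF.mono hFL).a .marks (by decide)]
  exact h

include hw hB

/-- The configurations witnessed by `k` under which non-degeneracy is required. -/
def BayesStructure.RelevantVia (S : BayesStructure n) (i j : Fin n) (T : Finset (Fin n))
    (k : Fin n) : Prop :=
  k ∈ T ∧ S.Edge i k ∧ S.Edge j k ∨ k ∉ T ∧ (S.Edge i k ∨ S.Edge k i) ∧ S.Edge k j

omit hw hB in
-- The form in which the loop over `k` accumulates the clauses; the vacuous bound `(k : ℕ) < n` is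
-- the loop invariant after the last step.
theorem BayesStructure.relevant_iff (i j : Fin n) (T : Finset (Fin n)) :
    S.Relevant i j T ↔ S.Edge i j ∨ ∃ k : Fin n, (k : ℕ) < n ∧ S.RelevantVia i j T k := by
  unfold Relevant RelevantVia
  constructor
  · rintro (h | ⟨k, h⟩ | ⟨k, h⟩ | ⟨k, h⟩)
    · exact Or.inl h
    · exact Or.inr ⟨k, k.2, Or.inl h⟩
    · exact Or.inr ⟨k, k.2, Or.inr ⟨h.1, Or.inl h.2.1, h.2.2⟩⟩
    · exact Or.inr ⟨k, k.2, Or.inr ⟨h.1, Or.inr h.2.1, h.2.2⟩⟩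
  · rintro (h | ⟨k, _, h | ⟨h1, h2 | h2, h3⟩⟩)
    · exact Or.inl h
    · exact Or.inr (Or.inl ⟨k, h⟩)
    · exact Or.inr (Or.inr (Or.inl ⟨k, h1, h2, h3⟩))
    · exact Or.inr (Or.inr (Or.inr ⟨k, h1, h2, h3⟩))

theorem run_relevance {c : ℕ} {i j : Fin n} (hc : Current D c i j v) {T : Finset (Fin n)}
    (hT : Marked T v) :
    Run S d w Prog.relevance v (1000 + (n * 3000 + 2000)) fun v' =>
      Frame [.k, .cond] v v' ∧ (0 < v'.a .cond 0 ↔ S.Relevant i j T) := by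
  classical
  obtain ⟨hB1, hB2, hB3, hB4, hB5, hB6⟩ := hB.facts
  refine Run.seq (Q' := fun v' => Frame [.k, .cond] v v' ∧
    v'.a .cond 0 = if S.Edge i j then 1 else 0) ?_ fun v₁ h₁ => ?_
  · refine Run.setReg hw (x := if S.Edge i j then 1 else 0) (fun σ hσ => ?_)
      (by split_ifs <;> omega) ⟨Frame.refl.set (by decide) _ _, by simp⟩ (by decide)
    exact hσ.edge (by rw [hσ.evalReg, hc.i]) (by rw [hσ.evalReg, hc.j])
  -- The bound `1 + 2 * k` is carried along to exclude overflow: each step adds at most `2`.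
  refine (Run.forLoop_const hw (N := n) (by omega) (fun k v' => Frame [.k, .cond] v v' ∧
    v'.a .cond 0 ≤ 1 + 2 * k ∧ (0 < v'.a .cond 0 ↔
      S.Edge i j ∨ ∃ k' : Fin n, (k' : ℕ) < k ∧ S.RelevantVia i j T k')) 1000 ?_ ?_
        (by decide) ?_).mono le_rfl fun v' h => ⟨h.1, ?_⟩
  · intro k _ v' hI σ hσ
    exact hσ.nodes
  · intro k hk v' hI hvk
    set κ : Fin n := ⟨k, hk⟩
    have hcur := hc.frame hI.1 (by decide)
    have hM := hT.frame hI.1 (by decide) κ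
    set x : ℕ := (if κ ∈ T then 1 else 0) * ((if S.Edge i κ then 1 else 0) *
        (if S.Edge j κ then 1 else 0)) +
      (1 - if κ ∈ T then 1 else 0) * (((if S.Edge i κ then 1 else 0) +
        (if S.Edge κ i then 1 else 0)) * (if S.Edge κ j then 1 else 0)) with hx
    have hx2 : x ≤ 2 := by
      rw [hx]
      split_ifs <;> decide
    have hx0 : 0 < x ↔ S.RelevantVia i j T κ := by
      rw [hx, BayesStructure.RelevantVia]
      split_ifs <;> simp_all
    refine Run.setReg hw (x := v'.a .cond 0 + x) (fun σ hσ => ?_) (by omega)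
      ⟨?_, ?_, ?_, ?_⟩ (by decide)
    · have hi : (reg .i).eval σ = i := by rw [hσ.evalReg, hcur.i]
      have hj : (reg .j).eval σ = j := by rw [hσ.evalReg, hcur.j]
      have hk' : (reg .k).eval σ = κ := by rw [hσ.evalReg, hvk]
      have hm : (arr .marks (reg .k)).eval σ = if κ ∈ T then 1 else 0 := by
        rw [hσ.evalArr, hk', hM]
      rw [hx, ← hm, ← hσ.edge hi hk', ← hσ.edge hj hk', ← hσ.edge hk' hi, ← hσ.edge hk' hj,
        ← hσ.evalReg .cond]
      rfl
    · simpa [set_a_of_ne] using hvk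
    · exact (hI.1.set (by decide) _ _).set (by decide) _ _
    · rw [set_a_of_ne _ _ _ _ (by decide), set_a_self, Function.update_self]
      omega
    · rw [set_a_of_ne _ _ _ _ (by decide), set_a_self, Function.update_self, Nat.add_pos_iff_pos_or_pos,
        hI.2.2, hx0, or_assoc]
      refine or_congr_right ⟨?_, ?_⟩
      · rintro (⟨k', h1, h2⟩ | h2)
        · exact ⟨k', by omega, h2⟩
        · exact ⟨κ, Nat.lt_succ_self k, h2⟩
      · rintro ⟨k', h1, h2⟩
        rcases Nat.lt_succ_iff_lt_or_eq.1 h1 with h1 | h1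
        · exact Or.inl ⟨k', h1, h2⟩
        · rw [show k' = κ from Fin.ext h1] at h2
          exact Or.inr h2
  · refine ⟨h₁.1.set (by decide) _ _, ?_, ?_⟩
    · rw [set_a_of_ne _ _ _ _ (by decide), h₁.2]
      split_ifs <;> simp
    · rw [set_a_of_ne _ _ _ _ (by decide), h₁.2]
      split_ifs with h <;> simp [h]
  · rw [h.2.2, S.relevant_iff]

theorem run_pair (hv : Ready D m γ ω v) {c : ℕ} {i j : Fin n} (hc : Current D c i j v)
    (hT : Marked (digitSet n D c) v) (hsort : DigitsSorted n D c) :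
    Run S d w Prog.pair v (20000 * (2 ^ D + m * (D + 1) + n + 2)) fun v' =>
      Frame [.k, .s, .code, .counts, .ok, .cond] v v' ∧
        (v'.a .ok 0 ≠ 0 ↔ v.a .ok 0 ≠ 0 ∧
          (Tested S D c i j → γ * m / 2 ≤ testStat D ω c i j)) := by
  classical
  refine Run.mono (T := (1000 + (n * 3000 + 2000)) +
    (20000 * (2 ^ D + m * (D + 1) + 1) + 1000)) ?_ ?_ fun _ h => h
  · refine (run_relevance hw hB hc hT).seq fun v₁ h₁ => ?_
    have hcur := hc.frame h₁.1 (by decide)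
    have hT₁ := hT.frame h₁.1 (by decide)
    have hok : v₁.a .ok = v.a .ok := h₁.1.a .ok (by decide)
    refine Run.ite (R := Tested S D c i j) (fun σ hσ => ?_) (fun hR => ?_)
      (fun hR => ?_) (by decide)
    · simp only [BoolExpr.Holds, WordExpr.eval, Prog.dist, hσ.evalReg, hσ.evalArr, hcur.i, hcur.j,
        hT₁ i, hT₁ j, Nat.pos_iff_ne_zero, Nat.mul_ne_zero_iff]
      rw [← Nat.pos_iff_ne_zero, h₁.2, Tested, ne_eq i j, Fin.ext_iff]
      constructor
      · rintro ⟨⟨h1, h2, h3⟩, h4⟩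
        refine ⟨hsort, by omega, ?_, ?_, h1⟩
        · intro h
          simp [h] at h2
        · intro h
          simp [h] at h3
      · rintro ⟨_, h1, h2, h3, h4⟩
        exact ⟨⟨h4, by simp [h2], by simp [h3]⟩, by omega⟩
    · refine (run_testPair hw hB (hv.frame h₁.1 (by decide)) hcur).mono le_rfl fun v' h => ⟨?_, ?_⟩
      · exact (h₁.1.mono (by decide)).trans (h.1.mono (by decide))
      · rw [h.2, hok]
        simp [hR]
    · refine Run.skip (Nat.succ_le_of_lt (by positivity)) ⟨h₁.1.mono (by decide), ?_⟩
      rw [hok]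
      simp [hR]
  · omega

theorem run_mark (hv : Ready D m γ ω v) {c : ℕ} (hc : ∀ k < D, v.a .digits k = digit n c k) :
    Run S d w Prog.mark v ((n * 3000 + 2000) + (D * 3000 + 2000)) fun v' =>
      Frame [.k, .marks] v v' ∧ Marked (digitSet n D c) v' := by
  classical
  obtain ⟨hB1, hB2, hB3, hB4, hB5, hB6⟩ := hB.facts
  refine Run.seq (Q' := fun v' => Frame [.k, .marks] v v' ∧ ∀ u < n, v'.a .marks u = 0) ?_
    fun v₁ h₁ => ?_
  · refine Run.forLoop_const hw (by omega)
      (fun k v' => Frame [.k, .marks] v v' ∧ ∀ u < k, v'.a .marks u = 0) 1000 ?_ ?_ (by decide) ?_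
    · exact fun k _ v' hI σ hσ => hσ.nodes
    · intro k hk v' hI hvk
      refine Run.set hw (i := k) (x := 0) (fun σ hσ => ?_) (fun σ hσ => rfl) (by omega) (by omega)
        ⟨?_, ?_, ?_⟩ (by decide)
      · rw [hσ.evalReg, hvk]
      · simpa [set_a_of_ne] using hvk
      · exact (hI.1.set (by decide) _ _).set (by decide) _ _
      · intro q hq
        rw [set_a_of_ne _ _ _ _ (by decide), set_a_self, Function.update_apply]
        split_ifs with h
        · rfl
        · exact hI.2 q (by omega)
    · exact ⟨Frame.refl.set (by decide) _ _, by simp⟩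
  · refine (Run.forLoop_const hw hB5 (fun k v' => Frame [.k, .marks] v v' ∧
      ∀ u < n, v'.a .marks u = if ∃ l < k, digit n c l = u then 1 else 0) 1000 ?_ ?_
        (by decide) ?_).mono le_rfl fun v' h => ⟨h.1, fun u => ?_⟩
    · intro k _ v' hI σ hσ
      rw [hσ.evalReg, (hv.frame hI.1 (by decide)).deg]
    · intro k hk v' hI hvk
      have hle := digit_le n c k
      refine Run.set hw (i := digit n c k) (x := 1) (fun σ hσ => ?_) (fun σ hσ => rfl)
        (by omega) (by omega) ⟨?_, ?_, ?_⟩ (by decide)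
      · rw [hσ.evalArr, hσ.evalReg, hvk, hI.1.a .digits (by decide), hc k hk]
      · simpa [set_a_of_ne] using hvk
      · exact (hI.1.set (by decide) _ _).set (by decide) _ _
      · intro u hu
        rw [set_a_of_ne _ _ _ _ (by decide), set_a_self, Function.update_apply, hI.2 u hu]
        by_cases h : u = digit n c k
        · rw [if_pos h, if_pos ⟨k, Nat.lt_succ_self k, h.symm⟩]
        · rw [if_neg h]
          refine if_congr ⟨?_, ?_⟩ rfl rfl
          · rintro ⟨l, hl, h'⟩
            exact ⟨l, by omega, h'⟩
          · rintro ⟨l, hl, h'⟩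
            refine ⟨l, ?_, h'⟩
            rcases Nat.lt_succ_iff_lt_or_eq.1 hl with hl | rfl
            · exact hl
            · exact absurd h'.symm h
    · refine ⟨h₁.1.set (by decide) _ _, fun u hu => ?_⟩
      rw [set_a_of_ne _ _ _ _ (by decide), h₁.2 u hu]
      simp
    · rw [h.2 u u.2]
      simp [digitSet]

theorem run_tuple (hv : Ready D m γ ω v) {c : ℕ} (hc : ∀ k < D, v.a .digits k = digit n c k)
    (hsort : DigitsSorted n D c) :
    Run S d w Prog.tuple v (30000 * ((n + 1) * (n + 1) * (2 ^ D + m * (D + 1) + n + D + 2)))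
      fun v' => Frame [.k, .s, .code, .counts, .ok, .cond, .i, .j, .marks] v v' ∧
        (v'.a .ok 0 ≠ 0 ↔ v.a .ok 0 ≠ 0 ∧
          ∀ i j : Fin n, Tested S D c i j → γ * m / 2 ≤ testStat D ω c i j) := by
  obtain ⟨hB1, hB2, hB3, hB4, hB5, hB6⟩ := hB.facts
  set Tp := 20000 * (2 ^ D + m * (D + 1) + n + 2) with hTp
  set L : List Reg := [.k, .s, .code, .counts, .ok, .cond, .i, .j] with hL
  set Pass : Fin n → Fin n → Prop := fun i j =>
    Tested S D c i j → γ * m / 2 ≤ testStat D ω c i j with hPass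
  refine Run.mono (T := ((n * 3000 + 2000) + (D * 3000 + 2000)) +
    (n * ((n * (Tp + 2000) + 2000) + 2000) + 2000)) ?_ ?_ fun _ h => h
  swap
  · have e1 : n * ((n * (Tp + 2000) + 2000) + 2000) =
        20000 * (n * n * (2 ^ D + m * (D + 1) + n + 2)) + 2000 * (n * n) + 4000 * n := by
      rw [hTp]
      ring
    have e2 : (n + 1) * (n + 1) * (2 ^ D + m * (D + 1) + n + D + 2) =
      n * n * (2 ^ D + m * (D + 1) + n + 2) + n * n * D + (2 * n + 1) *
        (2 ^ D + m * (D + 1) + n + D + 2) := by ring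
    have e3 : 2 * (2 * n + 1) ≤ (2 * n + 1) * (2 ^ D + m * (D + 1) + n + D + 2) := by
      rw [mul_comm]
      exact Nat.mul_le_mul_left _ (by omega)
    have e4 : 2 ^ D + m * (D + 1) + n + D + 2 ≤
        (2 * n + 1) * (2 ^ D + m * (D + 1) + n + D + 2) :=
      Nat.le_mul_of_pos_left _ (Nat.succ_pos _)
    have e5 : n * n * 2 ≤ n * n * (2 ^ D + m * (D + 1) + n + 2) :=
      Nat.mul_le_mul_left _ (by omega)
    omega
  refine (run_mark hw hB hv hc).seq fun v₁ h₁ => ?_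
  refine (Run.forLoop_const hw (N := n) (by omega) (fun a v' => Frame L v₁ v' ∧
    (v'.a .ok 0 ≠ 0 ↔ v₁.a .ok 0 ≠ 0 ∧ ∀ i j : Fin n, (i : ℕ) < a → Pass i j))
      (n * (Tp + 2000) + 2000) ?_ ?_ (by decide) ?_).mono le_rfl fun v' h => ⟨?_, ?_⟩
  · exact fun k _ v' hI σ hσ => hσ.nodes
  · intro a ha v₂ h₂ hva
    refine (Run.forLoop_const hw (N := n) (by omega) (fun b v' => Frame L v₁ v' ∧ v'.a .i 0 = a ∧
      (v'.a .ok 0 ≠ 0 ↔ v₂.a .ok 0 ≠ 0 ∧ ∀ j : Fin n, (j : ℕ) < b → Pass ⟨a, ha⟩ j))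
        Tp ?_ ?_ (by decide) ?_).mono le_rfl fun v' h => ⟨h.2.1, ?_, ?_⟩
    · exact fun k _ v' hI σ hσ => hσ.nodes
    · intro b hb v₃ h₃ hvb
      have hF : Frame (.marks :: L) v v₃ := (h₁.1.mono (by decide)).trans (h₃.1.mono (by decide))
      have hcur : Current D c ⟨a, ha⟩ ⟨b, hb⟩ v₃ :=
        ⟨h₃.2.1, hvb, by rw [hF.a .digits (by decide)]; exact hc⟩
      refine (run_pair hw hB (hv.frame hF (by decide)) hcur (h₁.2.frame h₃.1 (by decide))
        hsort).mono le_rfl fun v₄ h₄ => ⟨?_, ?_, ?_, ?_⟩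
      · rw [h₄.1.a .j (by decide), hvb]
      · exact (h₃.1.trans (h₄.1.mono (by decide))).set (by decide) _ _
      · rw [set_a_of_ne _ _ _ _ (by decide), h₄.1.a .i (by decide), h₃.2.1]
      · rw [set_a_of_ne _ _ _ _ (by decide), h₄.2, h₃.2.2, and_assoc]
        refine and_congr_right fun _ => ⟨fun h j hj => ?_, fun h => ⟨fun j hj => h j (by omega),
          h ⟨b, hb⟩ (Nat.lt_succ_self b)⟩⟩
        rcases Nat.lt_succ_iff_lt_or_eq.1 hj with hj | hj
        · exact h.1 j hj
        · rw [show j = ⟨b, hb⟩ from Fin.ext hj]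
          exact h.2
    · refine ⟨h₂.1.set (by decide) _ _, ?_, ?_⟩
      · rw [set_a_of_ne _ _ _ _ (by decide), hva]
      · rw [set_a_of_ne _ _ _ _ (by decide)]
        simp
    · exact h.1.set (by decide) _ _
    · rw [set_a_of_ne _ _ _ _ (by decide), h.2.2, h₂.2, and_assoc]
      refine and_congr_right fun _ => ⟨fun h i j hi => ?_, fun h => ⟨fun i j hi => h i j (by omega),
        fun j _ => h ⟨a, ha⟩ j (Nat.lt_succ_self a)⟩⟩
      rcases Nat.lt_succ_iff_lt_or_eq.1 hi with hi | hi
      · exact h.1 i j hi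
      · rw [show i = ⟨a, ha⟩ from Fin.ext hi]
        exact h.2 j j.2
  · refine ⟨Frame.refl.set (by decide) _ _, ?_⟩
    rw [set_a_of_ne _ _ _ _ (by decide)]
    simp
  · exact (h₁.1.mono (by decide)).trans (h.1.mono (by decide))
  · rw [h.2, h₁.1.a .ok (by decide)]
    exact and_congr_right fun _ => ⟨fun h i j => h i j i.2, fun h i j _ => h i j⟩

open Classical in
theorem run_decode (hv : Ready D m γ ω v) {c : ℕ} (hc : c < (n + 1) ^ D) (hvc : v.a .c 0 = c) :
    Run S d w Prog.decode v (D * 8000 + 5000) fun v' =>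
      Frame [.k, .quot, .prev, .sorted, .cur, .digits] v v' ∧
        (∀ k < D, v'.a .digits k = digit n c k) ∧
          (0 < v'.a .sorted 0 ↔ DigitsSorted n D c) := by
  obtain ⟨hB1, hB2, hB3, hB4, hB5, hB6⟩ := hB.facts
  set L : List Reg := [.k, .quot, .prev, .sorted, .cur, .digits] with hL
  refine Run.mono (T := 1000 + (1000 + (1000 + (D * (6000 + 2000) + 2000)))) ?_ (by omega)
    fun _ h => h
  refine (Run.setReg hw (x := c) (Q := fun v' => Frame L v v' ∧ v'.a .quot 0 = c)
    (fun σ hσ => by rw [hσ.evalReg, hvc]) (by omega)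
    ⟨Frame.refl.set (by decide) _ _, by simp⟩ (by decide)).seq fun v₁ h₁ => ?_
  refine (Run.setReg hw (x := 0) (Q := fun v' => Frame L v v' ∧ v'.a .quot 0 = c ∧
    v'.a .prev 0 = 0) (fun σ hσ => rfl) (by omega)
    ⟨h₁.1.set (by decide) _ _, by simp [set_a_of_ne, h₁.2], by simp⟩ (by decide)).seq
      fun v₂ h₂ => ?_
  refine (Run.setReg hw (x := 1) (Q := fun v' => Frame L v v' ∧ v'.a .quot 0 = c ∧
    v'.a .prev 0 = 0 ∧ v'.a .sorted 0 = 1) (fun σ hσ => rfl) (by omega)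
    ⟨h₂.1.set (by decide) _ _, by simp [set_a_of_ne, h₂.2], by simp [set_a_of_ne, h₂.2],
      by simp⟩ (by decide)).seq fun v₃ h₃ => ?_
  -- `.quot` holds what remains of `c` after `k` digits. Before the first digit `.prev` is `0`, so
  -- the first comparison never fails.
  refine (Run.forLoop_const hw hB5 (fun k v' => Frame L v v' ∧
    v'.a .quot 0 = c / (n + 1) ^ k ∧
    (v'.a .prev 0 = if k = 0 then 0 else digit n c (k - 1)) ∧
    (∀ l < k, v'.a .digits l = digit n c l) ∧
    (0 < v'.a .sorted 0 ↔ DigitsSorted n k c)) 6000 ?_ ?_ (by decide) ?_).mono le_rfl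
      fun v' h => ⟨h.1, h.2.2.2.1, h.2.2.2.2⟩
  · intro k _ v' hI σ hσ
    rw [hσ.evalReg, (hv.frame hI.1 (by decide)).deg]
  · rintro k hk v₄ ⟨hF₄, hq₄, hp₄, hd₄, hs₄⟩ hvk
    have hdig := digit_le n c k
    refine Run.mono (T := 1000 + ((1000 + 1000) + (1000 + (1000 + 1000)))) ?_ (by omega)
      fun _ h => h
    refine (Run.setReg hw (x := digit n c k) (Q := fun v' => Frame L v v' ∧ v'.a .k 0 = k ∧
      v'.a .quot 0 = c / (n + 1) ^ k ∧ v'.a .prev 0 = v₄.a .prev 0 ∧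
      (∀ l < k, v'.a .digits l = digit n c l) ∧ (0 < v'.a .sorted 0 ↔ DigitsSorted n k c) ∧
      v'.a .cur 0 = digit n c k) (fun σ hσ => ?_) (by omega)
      ⟨hF₄.set (by decide) _ _, by simpa [set_a_of_ne] using hvk,
        by simpa [set_a_of_ne] using hq₄, by simp [set_a_of_ne],
        by simpa [set_a_of_ne] using hd₄, by simpa [set_a_of_ne] using hs₄,
        by simp⟩ (by decide)).seq ?_
    · simp only [WordExpr.eval, hσ.evalReg, hσ.nodes, hq₄, digit]
    rintro v₅ ⟨hF₅, hk₅, hq₅, hp₅, hd₅, hs₅, hc₅⟩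
    refine (Run.ite (Q := fun v' => Frame L v v' ∧ v'.a .k 0 = k ∧
      v'.a .quot 0 = c / (n + 1) ^ k ∧
      (∀ l < k, v'.a .digits l = digit n c l) ∧
      (0 < v'.a .sorted 0 ↔ DigitsSorted n (k + 1) c) ∧
      v'.a .cur 0 = digit n c k) (R := digit n c k < v₄.a .prev 0)
        (fun σ hσ => ?_) (fun hR => ?_) (fun hR => ?_) (by decide)).seq ?_
    · simp only [BoolExpr.Holds, hσ.evalReg, hc₅, hp₅]
    · refine Run.setReg hw (x := 0) (fun σ hσ => rfl) (by omega)
        ⟨hF₅.set (by decide) _ _, by simpa [set_a_of_ne] using hk₅,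
          by simpa [set_a_of_ne] using hq₅, by simpa [set_a_of_ne] using hd₅, ?_,
          by simpa [set_a_of_ne] using hc₅⟩ (by decide)
      simp only [set_a_self, Function.update_self, lt_irrefl, false_iff]
      intro hsort
      rw [hp₄] at hR
      split_ifs at hR with h0
      · omega
      · have := hsort (k - 1) (by omega)
        rw [show k - 1 + 1 = k by omega] at this
        omega
    · refine Run.skip (by norm_num) ⟨hF₅, hk₅, hq₅, hd₅, ?_, hc₅⟩
      rw [hs₅]
      refine ⟨fun h l hl => ?_, fun h l hl => h l (by omega)⟩
      rcases Nat.lt_succ_iff_lt_or_eq.1 hl with hl | hl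
      · exact h l hl
      · rw [hp₄, if_neg (by omega), ← hl, Nat.add_sub_cancel] at hR
        exact not_lt.1 hR
    rintro v₆ ⟨hF₆, hk₆, hq₆, hd₆, hs₆, hc₆⟩
    refine (Run.setReg hw (x := digit n c k) (Q := fun v' => Frame L v v' ∧ v'.a .k 0 = k ∧
      v'.a .quot 0 = c / (n + 1) ^ k ∧ v'.a .prev 0 = digit n c k ∧
      (∀ l < k, v'.a .digits l = digit n c l) ∧
      (0 < v'.a .sorted 0 ↔ DigitsSorted n (k + 1) c) ∧
      v'.a .cur 0 = digit n c k) (fun σ hσ => by rw [hσ.evalReg, hc₆]) (by omega)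
      ⟨hF₆.set (by decide) _ _, by simpa [set_a_of_ne] using hk₆,
        by simpa [set_a_of_ne] using hq₆, by simp,
        by simpa [set_a_of_ne] using hd₆, by simpa [set_a_of_ne] using hs₆,
        by simpa [set_a_of_ne] using hc₆⟩ (by decide)).seq ?_
    rintro v₇ ⟨hF₇, hk₇, hq₇, hp₇, hd₇, hs₇, hc₇⟩
    refine (Run.set hw (i := k) (x := digit n c k) (Q := fun v' => Frame L v v' ∧ v'.a .k 0 = k ∧
      v'.a .quot 0 = c / (n + 1) ^ k ∧ v'.a .prev 0 = digit n c k ∧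
      (∀ l < k + 1, v'.a .digits l = digit n c l) ∧
      (0 < v'.a .sorted 0 ↔ DigitsSorted n (k + 1) c)) (fun σ hσ => by rw [hσ.evalReg, hk₇])
      (fun σ hσ => by rw [hσ.evalReg, hc₇]) (by omega) (by omega)
      ⟨hF₇.set (by decide) _ _, by simpa [set_a_of_ne] using hk₇,
        by simpa [set_a_of_ne] using hq₇, by simpa [set_a_of_ne] using hp₇, fun l hl => ?_,
        by simpa [set_a_of_ne] using hs₇⟩ (by decide)).seq ?_
    · rw [set_a_self, Function.update_apply]
      split_ifs with h
      · rw [h]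
      · exact hd₇ l (by omega)
    rintro v₈ ⟨hF₈, hk₈, hq₈, hp₈, hd₈, hs₈⟩
    refine Run.setReg hw (x := c / (n + 1) ^ (k + 1)) (fun σ hσ => ?_)
      ((Nat.div_le_self _ _).trans (by omega)) ⟨by simpa [set_a_of_ne] using hk₈,
        (hF₈.set (by decide) _ _).set (by decide) _ _, by simp [set_a_of_ne],
        by simpa [set_a_of_ne] using hp₈, by simpa [set_a_of_ne] using hd₈,
        by simpa [set_a_of_ne] using hs₈⟩ (by decide)
    simp only [WordExpr.eval, hσ.evalReg, hσ.nodes, hq₈, pow_succ, Nat.div_div_eq_div_mul]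
  · refine ⟨h₃.1.set (by decide) _ _, by simp [set_a_of_ne, h₃.2.1],
      by simp [set_a_of_ne, h₃.2.2.1], by simp, ?_⟩
    simp [set_a_of_ne, h₃.2.2.2, DigitsSorted]

open Classical in
/-- The time of the tests for the set with number `c`. -/
noncomputable def tupleTime (n D m c : ℕ) : ℕ :=
  if DigitsSorted n D c then 30000 * ((n + 1) * (n + 1) * (2 ^ D + m * (D + 1) + n + D + 2)) else 1

/-- The time stays a sum over `c`, because only sorted digit sequences are expensive and a uniform
bound would lose the factor `D!`. -/
theorem run_tests (hv : Ready D m γ ω v) :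
    Run S d w Prog.tests v
      (∑ c ∈ Finset.range ((n + 1) ^ D), (D * 8000 + 8000 + tupleTime n D m c) + 3000) fun v' =>
        (v'.a .ok 0 ≠ 0 ↔ TestPasses S D γ ω) := by
  classical
  obtain ⟨hB1, hB2, hB3, hB4, hB5, hB6⟩ := hB.facts
  refine Run.mono (T := 1000 + (∑ c ∈ Finset.range ((n + 1) ^ D),
    (((D * 8000 + 5000) + (tupleTime n D m c + 1000)) + 2000) + 2000)) ?_ ?_ fun _ h => h
  · refine (Run.setReg hw (x := 1) (Q := fun v' => Frame loopRegs v v' ∧ v'.a .ok 0 = 1)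
      (fun _ _ => rfl) (by omega) ⟨Frame.refl.set (by decide) _ _, by simp⟩ (by decide)).seq
      fun v₁ h₁ => ?_
    refine (Run.forLoop hw hB2 (fun c v' => Frame loopRegs v v' ∧
      (v'.a .ok 0 ≠ 0 ↔ ∀ c' < c, ∀ i j, Tested S D c' i j → γ * m / 2 ≤ testStat D ω c' i j))
      (fun c => (D * 8000 + 5000) + (tupleTime n D m c + 1000)) ?_ ?_ (by decide) ?_).mono le_rfl
        fun v' h => h.2
    · intro k _ v' hI σ hσ
      rw [hσ.evalReg, (hv.frame hI.1 (List.Subset.refl _)).tuples]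
    · intro c hc v₂ h₂ hvc
      have hv₂ := hv.frame h₂.1 (List.Subset.refl _)
      refine (run_decode hw hB hv₂ hc hvc).seq fun v₃ h₃ => ?_
      have hok₃ : v₃.a .ok = v₂.a .ok := h₃.1.a .ok (by decide)
      have hc₃ : v₃.a .c = v₂.a .c := h₃.1.a .c (by decide)
      have hF₃ : Frame loopRegs v v₃ := h₂.1.trans (h₃.1.mono (by decide))
      refine Run.ite (R := DigitsSorted n D c) (fun σ hσ => ?_) (fun hR => ?_) (fun hR => ?_)
        (by decide)
      · simp only [BoolExpr.Holds, WordExpr.eval, hσ.evalReg, h₃.2.2]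
      · rw [tupleTime, if_pos hR]
        refine (run_tuple hw hB (hv.frame hF₃ (List.Subset.refl _)) h₃.2.1 hR).mono le_rfl
          fun v₄ h₄ => ⟨?_, (hF₃.trans (h₄.1.mono (by decide))).set (by decide) _ _, ?_⟩
        · rw [h₄.1.a .c (by decide), hc₃, hvc]
        · rw [set_a_of_ne _ _ _ _ (by decide), h₄.2, hok₃, h₂.2]
          refine ⟨fun h c' hc' => ?_, fun h => ⟨fun c' hc' => h c' (by omega),
            h c (Nat.lt_succ_self c)⟩⟩
          rcases Nat.lt_succ_iff_lt_or_eq.1 hc' with hc' | rfl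
          · exact h.1 c' hc'
          · exact h.2
      · rw [tupleTime, if_neg hR]
        refine Run.skip le_rfl ⟨by rw [hc₃, hvc], hF₃.set (by decide) _ _, ?_⟩
        · rw [set_a_of_ne _ _ _ _ (by decide), hok₃, h₂.2]
          refine ⟨fun h c' hc' => ?_, fun h c' hc' => h c' (by omega)⟩
          rcases Nat.lt_succ_iff_lt_or_eq.1 hc' with hc' | rfl
          · exact h c' hc'
          · exact fun i j ht => absurd ht.1 hR
    · refine ⟨h₁.1.set (by decide) _ _, ?_⟩
      rw [set_a_of_ne _ _ _ _ (by decide), h₁.2]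
      simp
  · have e : ∑ c ∈ Finset.range ((n + 1) ^ D),
        (((D * 8000 + 5000) + (tupleTime n D m c + 1000)) + 2000) =
        ∑ c ∈ Finset.range ((n + 1) ^ D), (D * 8000 + 8000 + tupleTime n D m c) :=
      Finset.sum_congr rfl fun c _ => by omega
    rw [e]
    omega

end Pairs

/-! ### Setup, drawing of the samples, and the complete program -/

section Tester

open WordExpr Mem

variable {n : ℕ} {S : BayesStructure n} {d w B D m : ℕ} {γ : ℝ} {ω : Fin m → Cube n}
  {v v' : Mem n} (hw : 2 + n * n + 32 * (B + 1) ≤ 2 ^ w) (hB : WordBound n D m B)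

/-- The number of samples. -/
noncomputable def sampleSize (n d : ℕ) (γ : ℝ) : ℕ :=
  ⌈5632 * ((2 : ℝ) ^ min d n + (min d n : ℕ) * Nat.clog 2 n) / γ ^ 2⌉₊

include hw hB

theorem run_setupLog (hn : 1 ≤ n) (hD : D = min d n) (hv : ∀ r, v.a r 0 = 0) :
    Run S d w Prog.setupLog v (1000 + (1000 + (Nat.clog 2 n * 3000 + 1000))) fun v' =>
      Frame [.deg, .pw, .logn] v v' ∧ v'.a .deg 0 = D ∧ v'.a .logn 0 = Nat.clog 2 n := by
  obtain ⟨hB1, hB2, hB3, hB4, hB5, hB6⟩ := hB.facts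
  have hclog : ∀ k, k < Nat.clog 2 n ↔ 2 ^ k < n := fun k =>
    Nat.lt_clog_iff_pow_lt (by norm_num)
  refine (Run.setReg hw (x := D) (Q := fun v' => Frame [.deg] v v' ∧ v'.a .deg 0 = D)
    (fun σ hσ => ?_) hB5 ⟨Frame.refl.set (by decide) _ _, by simp⟩ (by decide)).seq fun v₁ h₁ => ?_
  · simp only [WordExpr.eval, hσ.degree hn, hσ.nodes]
    omega
  refine (Run.setReg hw (x := 1) (Q := fun v' => Frame [.deg, .pw, .logn] v v' ∧
    v'.a .deg 0 = D ∧ v'.a .pw 0 = 1 ∧ v'.a .logn 0 = 0) (fun σ hσ => rfl) (by omega)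
    ⟨(h₁.1.mono (by decide)).set (by decide) _ _, by simpa [set_a_of_ne] using h₁.2, by simp, ?_⟩
    (by decide)).seq fun v₂ h₂ => ?_
  · rw [set_a_of_ne _ _ _ _ (by decide), h₁.1.a .logn (by decide), hv]
  refine (Run.whileLoop (Nat.clog 2 n) (fun k v' => Frame [.deg, .pw, .logn] v v' ∧
    v'.a .deg 0 = D ∧ v'.a .pw 0 = 2 ^ k ∧ v'.a .logn 0 = k) (fun _ => 1000 + 1000)
    ?_ ?_ ?_ (by decide) h₂).mono (by simp) fun v' h => ⟨h.1, h.2.1, h.2.2.2⟩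
  · intro k hk v' hI σ hσ
    simp only [BoolExpr.Holds, hσ.evalReg, hσ.nodes, hI.2.2.1]
    exact (hclog k).1 hk
  · intro v' hI σ hσ
    simp only [BoolExpr.Holds, hσ.evalReg, hσ.nodes, hI.2.2.1]
    exact fun h => lt_irrefl _ ((hclog _).2 h)
  · intro k hk v₃ h₃
    have hk' := (hclog k).1 hk
    refine (Run.setReg hw (x := 2 ^ (k + 1)) (Q := fun v' => Frame [.deg, .pw, .logn] v v' ∧
      v'.a .deg 0 = D ∧ v'.a .pw 0 = 2 ^ (k + 1) ∧ v'.a .logn 0 = k) (fun σ hσ => ?_) ?_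
      ⟨h₃.1.set (by decide) _ _, by simpa [set_a_of_ne] using h₃.2.1, by simp,
        by simpa [set_a_of_ne] using h₃.2.2.2⟩ (by decide)).seq fun v₄ h₄ => ?_
    · simp only [WordExpr.eval, hσ.evalReg, h₃.2.2.1, pow_succ']
    · rw [pow_succ]
      omega
    · have : k < 2 ^ k := Nat.lt_two_pow_self
      refine Run.setReg hw (x := k + 1) (fun σ hσ => ?_) (by omega)
        ⟨h₄.1.set (by decide) _ _, by simpa [set_a_of_ne] using h₄.2.1,
          by simpa [set_a_of_ne] using h₄.2.2.1, by simp⟩ (by decide)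
      simp only [WordExpr.eval, hσ.evalReg, h₄.2.2.2]

theorem run_setupPowers (hv : v.a .deg 0 = D) :
    Run S d w Prog.setupPowers v (1000 + (1000 + (D * 4000 + 2000))) fun v' =>
      Frame [.tables, .tuples, .k] v v' ∧ v'.a .tables 0 = 2 ^ D ∧
        v'.a .tuples 0 = (n + 1) ^ D := by
  obtain ⟨hB1, hB2, hB3, hB4, hB5, hB6⟩ := hB.facts
  refine (Run.setReg hw (x := 1) (Q := fun v' => Frame [.tables, .tuples, .k] v v' ∧
    v'.a .tables 0 = 1) (fun σ hσ => rfl) (by omega)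
    ⟨Frame.refl.set (by decide) _ _, by simp⟩ (by decide)).seq fun v₁ h₁ => ?_
  refine (Run.setReg hw (x := 1) (Q := fun v' => Frame [.tables, .tuples, .k] v v' ∧
    v'.a .tables 0 = 1 ∧ v'.a .tuples 0 = 1) (fun σ hσ => rfl) (by omega)
    ⟨h₁.1.set (by decide) _ _, by simpa [set_a_of_ne] using h₁.2, by simp⟩
    (by decide)).seq fun v₂ h₂ => ?_
  refine Run.forLoop_const hw hB5 (fun k v' => Frame [.tables, .tuples, .k] v v' ∧
    v'.a .tables 0 = 2 ^ k ∧ v'.a .tuples 0 = (n + 1) ^ k) (1000 + 1000) ?_ ?_ (by decide) ?_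
  · intro k _ v' hI σ hσ
    rw [hσ.evalReg, hI.1.a .deg (by decide), hv]
  · intro k hk v₃ h₃ hvk
    have h2 : 2 ^ (k + 1) ≤ 2 ^ D := Nat.pow_le_pow_right (by norm_num) hk
    have h3 : (n + 1) ^ (k + 1) ≤ (n + 1) ^ D := Nat.pow_le_pow_right (Nat.succ_pos n) hk
    refine (Run.setReg hw (x := 2 ^ (k + 1)) (Q := fun v' => Frame [.tables, .tuples, .k] v v' ∧
      v'.a .tables 0 = 2 ^ (k + 1) ∧ v'.a .tuples 0 = (n + 1) ^ k ∧ v'.a .k 0 = k)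
      (fun σ hσ => ?_) (by omega) ⟨h₃.1.set (by decide) _ _, by simp,
        by simpa [set_a_of_ne] using h₃.2.2, by simpa [set_a_of_ne] using hvk⟩
        (by decide)).seq fun v₄ h₄ => ?_
    · simp only [WordExpr.eval, hσ.evalReg, h₃.2.1, pow_succ']
    · refine Run.setReg hw (x := (n + 1) ^ (k + 1)) (fun σ hσ => ?_) (by omega)
        ⟨by simpa [set_a_of_ne] using h₄.2.2.2, (h₄.1.set (by decide) _ _).set (by decide) _ _,
          by simpa [set_a_of_ne] using h₄.2.1, by simp [set_a_of_ne]⟩ (by decide)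
      simp only [WordExpr.eval, hσ.evalReg, hσ.nodes, h₄.2.2.1, pow_succ]
  · exact ⟨h₂.1.set (by decide) _ _, by simpa [set_a_of_ne] using h₂.2.1,
      by simpa [set_a_of_ne] using h₂.2.2⟩

theorem run_setupSamples (hD : D = min d n) (hγ : 0 < γ) (hm : m = sampleSize n d γ)
    (hdeg : v.a .deg 0 = D) (hlogn : v.a .logn 0 = Nat.clog 2 n) (htables : v.a .tables 0 = 2 ^ D)
    (hsamples : v.a .samples 0 = 0) (hx : v.x 0 = γ) :
    Run S d w Prog.setupSamples v (m * 2000 + 1000) fun v' =>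
      Frame [.samples] v v' ∧ v'.a .samples 0 = m := by
  obtain ⟨hB1, hB2, hB3, hB4, hB5, hB6⟩ := hB.facts
  have htest : ∀ k : ℕ, k < m ↔
      (k : ℝ) * γ * γ < ((5632 * (2 ^ D + D * Nat.clog 2 n) : ℕ) : ℝ) := by
    intro k
    rw [hm, sampleSize, Nat.lt_ceil, lt_div_iff₀ (by positivity), ← hD, pow_two γ, ← mul_assoc]
    push_cast
    rfl
  refine (Run.whileLoop m (fun k v' => Frame [.samples] v v' ∧ v'.a .samples 0 = k)
    (fun _ => 1000) ?_ ?_ ?_ (by decide) ⟨Frame.refl, hsamples⟩).mono (by simp) fun v' h => h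
  · intro k hk v' hI σ hσ
    have h := (htest k).1 hk
    simpa only [BoolExpr.Holds, RealExpr.eval, WordExpr.eval, hσ.evalReg, hσ.real, hI.2, hI.1.x,
      hx, hI.1.a .deg (by decide), hI.1.a .logn (by decide), hI.1.a .tables (by decide), hdeg,
      hlogn, htables] using h
  · intro v' hI σ hσ
    have h := mt (htest m).2 (lt_irrefl m)
    simpa only [BoolExpr.Holds, RealExpr.eval, WordExpr.eval, hσ.evalReg, hσ.real, hI.2, hI.1.x,
      hx, hI.1.a .deg (by decide), hI.1.a .logn (by decide), hI.1.a .tables (by decide), hdeg,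
      hlogn, htables] using h
  · intro k hk v' hI
    refine Run.setReg hw (x := k + 1) (fun σ hσ => ?_) (by omega)
      ⟨hI.1.set (by decide) _ _, by simp⟩ (by decide)
    simp only [WordExpr.eval, hσ.evalReg, hI.2]

omit hw hB in
/-- The samples are stored up to the bit `k` of the sample `s`. -/
def Stored (ω : Fin m → Cube n) (s k : ℕ) (v : Mem n) : Prop :=
  ∀ (s' : Fin m) (k' : ℕ), k' ≤ n → v.a .bits (s' * (n + 1) + k') =
    if (s' : ℕ) < s ∨ (s' : ℕ) = s ∧ k' < k then bitAt (ω s') k' else 0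

omit hw hB in
theorem bitAt_self (x : Cube n) : bitAt x n = 0 := dif_neg (lt_irrefl n)

theorem run_drawSamples (hsamples : v.a .samples 0 = m) (hbits : ∀ q, v.a .bits q = 0)
    (hrest : v.rest = List.ofFn ω) :
    Run S d w Prog.drawSamples v (m * ((n + (n * 3000 + 2000)) + 2000) + 2000) fun v' =>
      (∀ r, r ∉ [.s, .k, .bits] → v'.a r = v.a r) ∧ v'.x = v.x ∧
        ∀ (s : Fin m) (k : ℕ), k ≤ n → v'.a .bits (s * (n + 1) + k) = bitAt (ω s) k := by
  obtain ⟨hB1, hB2, hB3, hB4, hB5, hB6⟩ := hB.facts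
  refine (Run.forLoop_const hw (N := m) (by omega) (fun s v' =>
    (∀ r, r ∉ [.s, .k, .bits] → v'.a r = v.a r) ∧ v'.x = v.x ∧
      v'.rest = (List.ofFn ω).drop s ∧ Stored ω s 0 v') (n + (n * 3000 + 2000)) ?_ ?_
      (by decide) ?_).mono le_rfl fun v' h => ⟨h.1, h.2.1, fun s k hk => ?_⟩
  · intro s _ v' hI σ hσ
    rw [hσ.evalReg, hI.1 .samples (by decide), hsamples]
  · intro s hs v₁ h₁ hvs
    have hdrop : v₁.rest = ω ⟨s, hs⟩ :: (List.ofFn ω).drop (s + 1) := by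
      rw [h₁.2.2.1, List.drop_eq_getElem_cons (by simpa using hs), List.getElem_ofFn]
    refine (Run.draw (Q := fun v' => (∀ r, r ∉ [.s, .k, .bits] → v'.a r = v.a r) ∧ v'.x = v.x ∧
      v'.rest = (List.ofFn ω).drop (s + 1) ∧ v'.smp = ω ⟨s, hs⟩ ∧ Stored ω s 0 v' ∧
      v'.a .s 0 = s) hdrop ⟨h₁.1, h₁.2.1, rfl, rfl, h₁.2.2.2, hvs⟩).seq fun v₂ h₂ => ?_
    refine (Run.forLoop_const hw (N := n) (by omega) (fun k v' =>
      (∀ r, r ∉ [.s, .k, .bits] → v'.a r = v.a r) ∧ v'.x = v.x ∧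
      v'.rest = (List.ofFn ω).drop (s + 1) ∧ v'.smp = ω ⟨s, hs⟩ ∧ Stored ω s k v' ∧
      v'.a .s 0 = s) 1000 ?_ ?_ (by decide) ?_).mono le_rfl fun v' h => ?_
    · exact fun k _ v' hI σ hσ => hσ.nodes
    · rintro k hk v₃ ⟨h1, h2, h3, h4, h5, h6⟩ hvk
      have hle : bitAt (ω ⟨s, hs⟩) k ≤ B := (bitAt_le_one _ _).trans (by omega)
      refine Run.set hw (i := s * (n + 1) + k) (x := bitAt (ω ⟨s, hs⟩) k) (fun σ hσ => ?_)
        (fun σ hσ => ?_) (hB6 s hs k hk.le) hle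
        ⟨by simpa [set_a_of_ne] using hvk, ?_, h2, h3, h4, ?_, by simpa [set_a_of_ne] using h6⟩
        (by decide)
      · simp only [WordExpr.eval, hσ.evalReg, hσ.nodes, h6, hvk]
      · simp only [WordExpr.eval, hσ.evalReg, hvk, hσ.sample, h4, bitAt]
      · intro r hr
        have hr' : r ≠ .bits ∧ r ≠ .k := by
          constructor <;> rintro rfl <;> exact hr (by decide)
        rw [set_a_of_ne _ _ _ _ hr'.2, set_a_of_ne _ _ _ _ hr'.1, h1 r hr]
      · intro s' k' hk'
        rw [set_a_of_ne _ _ _ _ (by decide), set_a_self, Function.update_apply, h5 s' k' hk']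
        -- The address determines the sample and the position, since positions are at most `n`.
        by_cases heq : (s' : ℕ) * (n + 1) + k' = s * (n + 1) + k
        · have e1 : (s' : ℕ) = s := by
            rcases lt_trichotomy (s' : ℕ) s with h | h | h
            · have := Nat.mul_le_mul_right (n + 1) (Nat.succ_le_of_lt h)
              rw [Nat.succ_mul] at this
              omega
            · exact h
            · have := Nat.mul_le_mul_right (n + 1) (Nat.succ_le_of_lt h)
              rw [Nat.succ_mul] at this
              omega
          have e2 : k' = k := by
            rw [e1] at heq
            omega
          rw [if_pos heq, if_pos (Or.inr ⟨e1, by omega⟩), e2, show s' = ⟨s, hs⟩ from Fin.ext e1]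
        · rw [if_neg heq]
          refine if_congr (or_congr_right (and_congr_right fun e => ?_)) rfl rfl
          have : k' ≠ k := by
            rintro rfl
            exact heq (by rw [e])
          omega
    · obtain ⟨h1, h2, h3, h4, h5, h6⟩ := h₂
      refine ⟨fun r hr => ?_, h2, h3, h4, ?_, by simpa [set_a_of_ne] using h6⟩
      · rw [set_a_of_ne _ _ _ _ (by rintro rfl; exact hr (by decide)), h1 r hr]
      · intro s' k' hk'
        rw [set_a_of_ne _ _ _ _ (by decide), h5 s' k' hk']
    · obtain ⟨h1, h2, h3, h4, h5, h6⟩ := h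
      refine ⟨h6, fun r hr => ?_, h2, h3, ?_⟩
      · rw [set_a_of_ne _ _ _ _ (by rintro rfl; exact hr (by decide)), h1 r hr]
      · intro s' k' hk'
        rw [set_a_of_ne _ _ _ _ (by decide), h5 s' k' hk']
        -- Once the bits below `n` are stored the row is complete, as position `n` has to hold `0`
        -- and does.
        rcases eq_or_lt_of_le hk' with rfl | hk''
        · simp [bitAt_self]
        · refine if_congr ?_ rfl rfl
          omega
  · refine ⟨fun r hr => ?_, rfl, by simpa using hrest, ?_⟩
    · rw [set_a_of_ne _ _ _ _ (by rintro rfl; exact hr (by decide))]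
    · intro s' k' hk'
      rw [set_a_of_ne _ _ _ _ (by decide), hbits]
      simp
  · rw [h.2.2.2 s k hk, if_pos (Or.inl s.2)]

/-- A bound on the running time. -/
noncomputable def testerTime (n D m : ℕ) : ℕ :=
  30000 * (n + D + 1 + m * (n + 1)) +
    ∑ c ∈ Finset.range ((n + 1) ^ D), (D * 8000 + 8000 + tupleTime n D m c)

theorem exec_tester (hn : 1 ≤ n) (hγ : 0 < γ) (hD : D = min d n) (hm : m = sampleSize n d γ) :
    ∃ s t, Exec w Prog.tester (startState S d γ ω) s t ∧ t ≤ testerTime n D m ∧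
      (s.word 0 ≠ 0 ↔ TestPasses S D γ ω) := by
  set v₀ : Mem n := ⟨fun _ _ => 0, fun a => if a = 0 then γ else 0, fun _ => false, List.ofFn ω⟩
    with hv₀
  have hrep : Represents S d (startState S d γ ω) v₀ := by
    refine ⟨fun a _ => rfl, fun r q => ?_, rfl, rfl, rfl⟩
    have hne : ¬ ∃ i j : Fin n, 2 + n * n + (32 * q + r.idx) = 2 + i * n + j ∧
        i ∈ S.parents j := by
      rintro ⟨i, j, h, _⟩
      have hi := i.2
      have hj := j.2
      nlinarith
    simp only [startState, hv₀]
    rw [if_neg (by omega), if_neg (by omega), if_neg hne]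
  -- The verdict overwrites address `0`, where `n` is stored, so `Represents` cannot hold
  -- afterwards. The rules cover everything before it, and `2000` units of time are set aside for
  -- the last branch.
  have hrun : Run S d w (.seq Prog.setupLog <| .seq Prog.setupPowers <| .seq Prog.setupSamples <|
      .seq Prog.drawSamples Prog.tests) v₀ (testerTime n D m - 2000) fun v' =>
        (v'.a .ok 0 ≠ 0 ↔ TestPasses S D γ ω) := by
    refine Run.mono (T := (1000 + (1000 + (Nat.clog 2 n * 3000 + 1000))) +
      ((1000 + (1000 + (D * 4000 + 2000))) + ((m * 2000 + 1000) +
      ((m * ((n + (n * 3000 + 2000)) + 2000) + 2000) +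
      (∑ c ∈ Finset.range ((n + 1) ^ D), (D * 8000 + 8000 + tupleTime n D m c) + 3000))))) ?_ ?_
      fun _ h => h
    · refine (run_setupLog hw hB hn hD fun _ => rfl).seq fun v₁ h₁ => ?_
      refine (run_setupPowers hw hB h₁.2.1).seq fun v₂ h₂ => ?_
      have hF₂ : Frame [.deg, .pw, .logn, .tables, .tuples, .k] v₀ v₂ :=
        (h₁.1.mono (by decide)).trans (h₂.1.mono (by decide))
      refine (run_setupSamples hw hB hD hγ hm ?_ ?_ h₂.2.1 ?_ ?_).seq fun v₃ h₃ => ?_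
      · rw [h₂.1.a .deg (by decide), h₁.2.1]
      · rw [h₂.1.a .logn (by decide), h₁.2.2]
      · rw [hF₂.a .samples (by decide)]
      · rw [hF₂.x]
        simp [hv₀]
      have hF₃ : Frame [.deg, .pw, .logn, .tables, .tuples, .k, .samples] v₀ v₃ :=
        (hF₂.mono (by decide)).trans (h₃.1.mono (by decide))
      refine (run_drawSamples hw hB (ω := ω) h₃.2 ?_ ?_).seq fun v₄ h₄ => ?_
      · intro q
        rw [hF₃.a .bits (by decide)]
      · exact hF₃.rest
      refine run_tests hw hB ⟨?_, ?_, ?_, ?_, h₄.2.2, ?_⟩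
      · rw [h₄.1 .deg (by decide), h₃.1.a .deg (by decide), h₂.1.a .deg (by decide), h₁.2.1]
      · rw [h₄.1 .tables (by decide), h₃.1.a .tables (by decide), h₂.2.1]
      · rw [h₄.1 .tuples (by decide), h₃.1.a .tuples (by decide), h₂.2.2]
      · rw [h₄.1 .samples (by decide), h₃.2]
      · rw [h₄.2.1, hF₃.x]
        simp [hv₀]
    · have h1 : Nat.clog 2 n ≤ n := Nat.clog_le_of_le_pow Nat.lt_two_pow_self.le
      have h2 : m * ((n + (n * 3000 + 2000)) + 2000) = 3001 * (m * n) + 4000 * m := by ring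
      have h3 : m * (n + 1) = m * n + m := by ring
      unfold testerTime
      omega
  obtain ⟨s, v, t, hexec, hs, ht, hv⟩ := hrun _ hrep
  have h0 : 0 < 2 ^ w := Nat.two_pow_pos w
  have h1 : 1 < 2 ^ w := by omega
  have hend : ∃ s' t', Exec w (.ite (.wordLt (.lit 0) (.reg .ok)) (.setWord (.lit 0) (.lit 1))
      (.setWord (.lit 0) (.lit 0))) s s' t' ∧ t' ≤ 1000 ∧ (s'.word 0 ≠ 0 ↔ v.a .ok 0 ≠ 0) := by
    by_cases hok : v.a .ok 0 = 0
    · refine ⟨_, _, Exec.iteFalse _ _ _ _ _ _ ?_ (Exec.setWord _ _ _ h0 h0), by decide, ?_⟩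
      · simp only [BoolExpr.Holds, hs.evalReg, hok, WordExpr.eval, lt_irrefl, not_false_iff]
      · simp [WordExpr.eval, hok]
    · refine ⟨_, _, Exec.iteTrue _ _ _ _ _ _ ?_ (Exec.setWord _ _ _ h0 h1), by decide, ?_⟩
      · simp only [BoolExpr.Holds, hs.evalReg, WordExpr.eval]
        exact Nat.pos_of_ne_zero hok
      · simp [WordExpr.eval, hok]
  obtain ⟨s', t', hexec', ht', hs'⟩ := hend
  -- The execution is taken apart and reassociated, since in the program the last branch sits inside
  -- the innermost sequence.
  cases hexec with | seq _ _ _ _ _ t₁ _ e₁ h =>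
  cases h with | seq _ _ _ _ _ t₂ _ e₂ h =>
  cases h with | seq _ _ _ _ _ t₃ _ e₃ h =>
  cases h with | seq _ _ _ _ _ t₄ t₅ e₄ e₅ =>
  refine ⟨s', _, .seq _ _ _ _ _ _ _ e₁ (.seq _ _ _ _ _ _ _ e₂ (.seq _ _ _ _ _ _ _ e₃
    (.seq _ _ _ _ _ _ _ e₄ (.seq _ _ _ _ _ _ _ e₅ hexec')))), ?_, hs'.trans hv⟩
  have : 30000 ≤ testerTime n D m := by
    unfold testerTime
    omega
  omega

end Tester

/-! ### Bounds on the resources -/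

theorem eq_of_digit_eq (n D : ℕ) {c c' : ℕ} (hc : c < (n + 1) ^ D) (hc' : c' < (n + 1) ^ D)
    (h : ∀ k < D, digit n c k = digit n c' k) : c = c' := by
  induction D generalizing c c' with
  | zero =>
    rw [pow_zero] at hc hc'
    omega
  | succ D ih =>
    rw [pow_succ'] at hc hc'
    have h1 : c / (n + 1) = c' / (n + 1) := by
      refine ih (Nat.div_lt_of_lt_mul hc) (Nat.div_lt_of_lt_mul hc') fun k hk => ?_
      have := h (k + 1) (by omega)
      rwa [digit, digit, pow_succ', ← Nat.div_div_eq_div_mul, ← Nat.div_div_eq_div_mul] at this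
    have h2 : c % (n + 1) = c' % (n + 1) := by simpa [digit] using h 0 (by omega)
    rw [← Nat.div_add_mod c (n + 1), ← Nat.div_add_mod c' (n + 1), h1, h2]

theorem DigitsSorted.pairwise {n D c : ℕ} (h : DigitsSorted n D c) :
    ((List.range D).map (digit n c)).Pairwise (· ≤ ·) := by
  rw [List.pairwise_map]
  have key : ∀ l, ∀ k ≤ l, l < D → digit n c k ≤ digit n c l := by
    intro l k hkl
    induction hkl with
    | refl => exact fun _ => le_rfl
    | step _ ih => exact fun hl => (ih (by omega)).trans (h _ hl)
  rw [List.pairwise_iff_getElem]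
  intro a b ha hb hab
  simp only [List.length_range] at ha hb
  simpa using key b a hab.le hb

open Classical in
/-- Few numbers have increasing digits. -/
theorem card_digitsSorted_le (n D : ℕ) :
    ((Finset.range ((n + 1) ^ D)).filter (DigitsSorted n D)).card ≤ (n + D).choose D := by
  have hcard : Fintype.card (Sym (Fin (n + 1)) D) = (n + D).choose D := by
    rw [Sym.card_sym_eq_choose, Fintype.card_fin]
    congr 1
    omega
  rw [← hcard, ← Finset.card_univ]
  -- A sorted list of digits is determined by its multiset, and a number below `(n + 1) ^ D` by its
  -- list of digits.
  refine Finset.card_le_card_of_injOn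
    (fun c => (⟨((List.range D).map fun k => (⟨digit n c k, Nat.lt_succ_of_le (digit_le n c k)⟩ :
      Fin (n + 1)) : List (Fin (n + 1))), by simp⟩ : Sym (Fin (n + 1)) D))
    (fun _ _ => Finset.mem_coe.2 (Finset.mem_univ _)) ?_
  intro c hc c' hc' heq
  simp only [Finset.coe_filter, Finset.mem_range, Set.mem_ofPred_eq] at hc hc'
  have hperm := Multiset.coe_eq_coe.1 (congrArg Subtype.val heq)
  have hperm' := hperm.map Fin.val
  simp only [List.map_map] at hperm'
  change ((List.range D).map (digit n c)).Perm ((List.range D).map (digit n c')) at hperm'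
  have := hperm'.eq_of_pairwise' hc.2.pairwise hc'.2.pairwise
  rw [List.map_inj_left] at this
  exact eq_of_digit_eq n D hc.1 hc'.1 fun k hk => this k (List.mem_range.2 hk)

theorem clog_le_two_mul_logb (n : ℕ) : (Nat.clog 2 n : ℝ) ≤ 2 * Real.logb 2 n := by
  rcases lt_or_ge n 2 with hn | hn
  · rw [Nat.clog_of_right_le_one (by omega)]
    have : 0 ≤ Real.logb 2 n := by
      rcases Nat.eq_zero_or_pos n with rfl | h
      · simp
      · exact Real.logb_nonneg (by norm_num) (by exact_mod_cast h)
    simpa using this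
  · have h1 : 1 ≤ Real.logb 2 n := by
      rw [Real.le_logb_iff_rpow_le (by norm_num) (by positivity), Real.rpow_one]
      exact_mod_cast hn
    have h2 := (Nat.ceil_lt_add_one (a := Real.logb (2 : ℕ) n)
      (by exact_mod_cast zero_le_one.trans h1)).le
    rw [Real.natCeil_logb_natCast] at h2
    push_cast at h2
    linarith

section Bounds

variable {n d : ℕ} {γ : ℝ}

/-- The ceiling adds at most `1 ≤ 2 ^ min d n / γ ^ 2`, which turns `5632` into `5633`. -/
theorem sampleSize_le (hγ : 0 < γ) (hγ1 : γ ≤ 1) :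
    (sampleSize n d γ : ℝ) ≤
      5633 * ((2 : ℝ) ^ min d n + (min d n : ℕ) * Nat.clog 2 n) / γ ^ 2 := by
  have h1 : (1 : ℝ) ≤ 2 ^ min d n := one_le_pow₀ (by norm_num)
  have h2 : (0 : ℝ) ≤ (min d n : ℕ) * Nat.clog 2 n := by positivity
  have h3 : γ ^ 2 ≤ 1 := pow_le_one₀ hγ.le hγ1
  have h4 : 0 < γ ^ 2 := by positivity
  refine (Nat.ceil_lt_add_one (by positivity)).le.trans ?_
  rw [div_add_one h4.ne']
  gcongr
  linarith

theorem le_sampleSize_mul (hγ : 0 < γ) :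
    5632 * ((2 : ℝ) ^ min d n + (min d n : ℕ) * Nat.clog 2 n) ≤ sampleSize n d γ * γ ^ 2 := by
  rw [← div_le_iff₀ (by positivity)]
  exact Nat.le_ceil _

theorem sampleSize_pos (hγ : 0 < γ) : 0 < sampleSize n d γ := by
  refine Nat.ceil_pos.2 (div_pos ?_ (by positivity))
  have : (0 : ℝ) < 2 ^ min d n := by positivity
  positivity

theorem sampleSize_le_logb (hn : 1 ≤ n) (hγ : 0 < γ) (hγ1 : γ ≤ 1) :
    (sampleSize n d γ : ℝ) ≤ 11266 * (2 ^ d + d * Real.logb 2 n) / γ ^ 2 := by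
  have hlog : 0 ≤ Real.logb 2 n := Real.logb_nonneg (by norm_num) (by exact_mod_cast hn)
  refine (sampleSize_le hγ hγ1).trans (div_le_div_of_nonneg_right ?_ (by positivity))
  have h1 : (2 : ℝ) ^ min d n ≤ 2 ^ d := pow_le_pow_right₀ (by norm_num) (min_le_left _ _)
  have h2 : ((min d n : ℕ) : ℝ) * Nat.clog 2 n ≤ d * (2 * Real.logb 2 n) := by
    gcongr
    · exact min_le_left _ _
    · exact clog_le_two_mul_logb n
  have h3 : (0 : ℝ) ≤ 2 ^ d := by positivity
  linarith

/-- The scale in which the resources are measured. -/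
noncomputable def scale (n D : ℕ) (γ : ℝ) : ℝ := (n : ℝ) ^ (D + 3) / γ ^ 2

variable {D : ℕ}

/-- `(1 + 1 / n) ^ D ≤ exp (D / n) ≤ exp 1`; capping the degree at `n` matters here. -/
theorem pow_succ_le (hn : 1 ≤ n) (hD : D ≤ n) : ((n : ℝ) + 1) ^ D ≤ 3 * (n : ℝ) ^ D := by
  have hn' : (0 : ℝ) < n := by exact_mod_cast hn
  have h1 : ((n : ℝ) + 1) / n ≤ Real.exp (1 / n) := by
    have := Real.add_one_le_exp (1 / (n : ℝ))
    rwa [show ((n : ℝ) + 1) / n = 1 / n + 1 by field_simp; ring]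
  have h2 : (((n : ℝ) + 1) / n) ^ D ≤ 3 := by
    calc (((n : ℝ) + 1) / n) ^ D ≤ (Real.exp (1 / n)) ^ D :=
          pow_le_pow_left₀ (by positivity) h1 _
      _ = Real.exp (D / n) := by
          rw [← Real.exp_nat_mul]
          ring_nf
      _ ≤ Real.exp 1 := by
          refine Real.exp_le_exp.2 ((div_le_one hn').2 ?_)
          exact_mod_cast hD
      _ ≤ 3 := by
          have := Real.exp_one_lt_d9
          linarith
  rwa [div_pow, div_le_iff₀ (by positivity)] at h2

theorem le_scale (hn : 1 ≤ n) (hγ : 0 < γ) (hγ1 : γ ≤ 1) {k : ℕ} (hk : k ≤ D + 3) :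
    (n : ℝ) ^ k ≤ scale n D γ := by
  have hn' : (1 : ℝ) ≤ n := by exact_mod_cast hn
  calc (n : ℝ) ^ k ≤ (n : ℝ) ^ (D + 3) := pow_le_pow_right₀ hn' hk
    _ ≤ scale n D γ := by
      rw [scale, le_div_iff₀ (by positivity)]
      exact mul_le_of_le_one_right (by positivity) (pow_le_one₀ hγ.le hγ1)

theorem sampleSize_mul_le (hn : 1 ≤ n) (hγ : 0 < γ) (hγ1 : γ ≤ 1) (hD : D = min d n) :
    (sampleSize n d γ : ℝ) * (n + 1) ≤ 45064 * scale n D γ := by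
  have hn' : (1 : ℝ) ≤ n := by exact_mod_cast hn
  have hDn : D ≤ n := hD ▸ min_le_right _ _
  have hl : (Nat.clog 2 n : ℝ) ≤ n := by
    exact_mod_cast Nat.clog_le_of_le_pow Nat.lt_two_pow_self.le
  have h1 : (2 : ℝ) ^ D ≤ 3 * n ^ D :=
    (pow_le_pow_left₀ (by norm_num) (by linarith) D).trans (pow_succ_le hn hDn)
  have h2 : (D : ℝ) * Nat.clog 2 n ≤ n * n := by
    gcongr
  have h3 := sampleSize_le (n := n) (d := d) hγ hγ1
  rw [← hD] at h3
  have h4 : (2 : ℝ) ^ D + D * Nat.clog 2 n ≤ 4 * (n : ℝ) ^ (D + 2) := by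
    have e1 : (n : ℝ) ^ D ≤ n ^ (D + 2) := pow_le_pow_right₀ hn' (by omega)
    have e2 : (n : ℝ) * n ≤ n ^ (D + 2) := by
      rw [← pow_two]
      exact pow_le_pow_right₀ hn' (by omega)
    linarith
  calc (sampleSize n d γ : ℝ) * (n + 1)
      ≤ 5633 * (4 * (n : ℝ) ^ (D + 2)) / γ ^ 2 * (2 * n) := by
        refine mul_le_mul (h3.trans ?_) (by linarith) (by positivity) (by positivity)
        gcongr
    _ = 45064 * scale n D γ := by
        rw [scale]
        ring

/-- The choice of `D` among `n + D` is at most `(2 n) ^ D / D!`, and `16 ^ D / D! ≤ exp 16`. The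
factor `8 ^ D` is the part of the cost of a test that is exponential in `D`. -/
theorem choose_mul_le (hDn : D ≤ n) :
    ((n + D).choose D : ℝ) * 8 ^ D ≤ Real.exp 16 * (n : ℝ) ^ D := by
  have h1 : ((n + D).choose D : ℝ) ≤ (2 * n : ℝ) ^ D / D.factorial := by
    refine (Nat.choose_le_pow_div D (n + D)).trans ?_
    gcongr
    push_cast
    have : (D : ℝ) ≤ n := by exact_mod_cast hDn
    linarith
  have h2 := Real.pow_div_factorial_le_exp 16 (by norm_num) D
  calc ((n + D).choose D : ℝ) * 8 ^ D ≤ (2 * n : ℝ) ^ D / D.factorial * 8 ^ D := by gcongr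
    _ = (16 : ℝ) ^ D / D.factorial * n ^ D := by
        rw [mul_pow, show (16 : ℝ) = 2 * 8 by norm_num, mul_pow]
        ring
    _ ≤ _ := by gcongr

theorem testerTime_le (hn : 1 ≤ n) (hγ : 0 < γ) (hγ1 : γ ≤ 1) (hD : D = min d n) :
    (testerTime n D (sampleSize n d γ) : ℝ) ≤
      (2000000000 + 2000000000 * Real.exp 16) * scale n D γ := by
  classical
  set m := sampleSize n d γ with hm
  have hn' : (1 : ℝ) ≤ n := by exact_mod_cast hn
  have hDn : D ≤ n := hD ▸ min_le_right _ _
  have hDn' : (D : ℝ) ≤ n := by exact_mod_cast hDn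
  have hY : ∀ k ≤ D + 3, (n : ℝ) ^ k ≤ scale n D γ := fun k hk => le_scale hn hγ hγ1 hk
  have hY1 : (n : ℝ) ≤ scale n D γ := by simpa using hY 1 (by omega)
  set H : ℝ := 30000 * ((n + 1) * (n + 1) * (2 ^ D + m * (D + 1) + n + D + 2)) with hH
  have hsum : ((∑ c ∈ Finset.range ((n + 1) ^ D), (D * 8000 + 8000 + tupleTime n D m c) : ℕ) : ℝ) ≤
      ((n : ℝ) + 1) ^ D * (D * 8000 + 8001) + (n + D).choose D * H := by
    have e : ∀ c ∈ Finset.range ((n + 1) ^ D), D * 8000 + 8000 + tupleTime n D m c ≤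
        (D * 8000 + 8001) + if DigitsSorted n D c then
          30000 * ((n + 1) * (n + 1) * (2 ^ D + m * (D + 1) + n + D + 2)) else 0 := by
      intro c _
      unfold tupleTime
      split_ifs <;> omega
    have e' := Finset.sum_le_sum e
    rw [Finset.sum_add_distrib (f := fun _ => D * 8000 + 8001), Finset.sum_const,
      Finset.card_range, ← Finset.sum_filter, Finset.sum_const, smul_eq_mul, smul_eq_mul] at e'
    have e'' := e'.trans (Nat.add_le_add_left (Nat.mul_le_mul_right _
      (card_digitsSorted_le n D)) _)
    rw [hH]
    exact_mod_cast e''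
  have hG : 1 ≤ 1 / γ ^ 2 := by
    rw [le_div_iff₀ (by positivity), one_mul]
    exact pow_le_one₀ hγ.le hγ1
  set G : ℝ := 1 / γ ^ 2 with hG'
  -- The main term is `m (D + 1)`: here `m` is of order `n * 2 ^ D / γ ^ 2` and `D + 1 ≤ 2 ^ D`, so
  -- even `4 ^ D` would do for it.
  have hinner : (2 : ℝ) ^ D + m * (D + 1) + n + D + 2 ≤ 12000 * (G * n * 8 ^ D) := by
    have h2D : (D : ℝ) + 1 ≤ 2 ^ D := by exact_mod_cast Nat.lt_two_pow_self (n := D)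
    set p : ℝ := 2 ^ D with hp
    have hp1 : 1 ≤ p := one_le_pow₀ (by norm_num)
    have h8 : (8 : ℝ) ^ D = p * p * p := by
      rw [hp, ← mul_pow, ← mul_pow]
      norm_num
    have hl : (Nat.clog 2 n : ℝ) ≤ n := by
      exact_mod_cast Nat.clog_le_of_le_pow Nat.lt_two_pow_self.le
    have hm1 : (m : ℝ) ≤ 5633 * (p + D * Nat.clog 2 n) * G := by
      have := sampleSize_le (n := n) (d := d) hγ hγ1
      rw [← hD] at this
      rw [hG', mul_one_div]
      exact this
    have h5 : p + D * Nat.clog 2 n ≤ 2 * (n * p) := by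
      have e1 : (D : ℝ) * Nat.clog 2 n ≤ p * n := by
        gcongr
        linarith
      nlinarith
    have h6 : (m : ℝ) * (D + 1) ≤ 11266 * (G * n * (p * p)) := by
      calc (m : ℝ) * (D + 1) ≤ (5633 * (2 * (n * p)) * G) * p := by
            refine mul_le_mul (hm1.trans ?_) h2D (by positivity) (by positivity)
            gcongr
        _ = _ := by ring
    have h7 : G * n * (p * p) ≤ G * n * (p * p * p) := by
      refine mul_le_mul_of_nonneg_left ?_ (by positivity)
      nlinarith [mul_nonneg (zero_le_one.trans hp1) (zero_le_one.trans hp1)]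
    have h9 : (n : ℝ) * p ≤ G * n * (p * p * p) := by
      calc (n : ℝ) * p = 1 * n * (p * 1 * 1) := by ring
        _ ≤ G * n * (p * p * p) := by gcongr
    have h10 : p ≤ n * p := le_mul_of_one_le_left (by linarith) hn'
    have h11 : (n : ℝ) ≤ n * p := le_mul_of_one_le_right (by linarith) hp1
    rw [h8]
    linarith
  -- The sorted tuples: `n ^ D` from their number, `n ^ 2` from the pairs and one more `n` from the
  -- sample size make up `n ^ (D + 3)`.
  have hheavy : ((n + D).choose D : ℝ) * H ≤ 1440000000 * Real.exp 16 * scale n D γ := by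
    calc ((n + D).choose D : ℝ) * H
        ≤ (n + D).choose D * (30000 * ((2 * n) * (2 * n) * (12000 * (G * n * 8 ^ D)))) := by
          rw [hH]
          gcongr <;> linarith
      _ = 1440000000 * (((n + D).choose D * 8 ^ D) * (n ^ 3 * G)) := by ring
      _ ≤ 1440000000 * ((Real.exp 16 * n ^ D) * (n ^ 3 * G)) := by
          exact mul_le_mul_of_nonneg_left
            (mul_le_mul_of_nonneg_right (choose_mul_le hDn) (by positivity)) (by norm_num)
      _ = _ := by
          rw [scale, hG']
          ring
  -- All tuples are decoded, sorted or not, but this costs only order `D + 1` each.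
  have hlight : ((n : ℝ) + 1) ^ D * (D * 8000 + 8001) ≤ 48003 * scale n D γ := by
    calc ((n : ℝ) + 1) ^ D * (D * 8000 + 8001) ≤ (3 * n ^ D) * (16001 * n) := by
          refine mul_le_mul (pow_succ_le hn hDn) (by linarith) (by positivity) (by positivity)
      _ = 48003 * n ^ (D + 1) := by ring
      _ ≤ _ := by
          gcongr
          exact hY _ (by omega)
  have hfirst := sampleSize_mul_le hn hγ hγ1 hD
  rw [← hm] at hfirst
  have hexp : 0 < Real.exp 16 * scale n D γ := by
    have : 0 < scale n D γ := by linarith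
    positivity
  unfold testerTime
  push_cast at hsum ⊢
  nlinarith

/-- The bound on the words that occur. -/
noncomputable def wordBound (n D m : ℕ) : ℕ :=
  4 * 2 ^ D + (n + 1) ^ D + 4 * ((m + 1) * (n + 1))

/-- The word length. -/
noncomputable def wordLength (n d : ℕ) (γ : ℝ) : ℕ :=
  Nat.clog 2 (2 + n * n + 32 * (wordBound n (min d n) (sampleSize n d γ) + 1))

theorem scale_min_le (hn : 1 ≤ n) : scale n (min d n) γ ≤ n ^ (d + 3) / γ ^ 2 := by
  have hn' : (1 : ℝ) ≤ n := by exact_mod_cast hn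
  unfold scale
  gcongr
  exact min_le_left _ _

theorem le_two_pow_wordLength :
    2 + n * n + 32 * (wordBound n (min d n) (sampleSize n d γ) + 1) ≤ 2 ^ wordLength n d γ :=
  Nat.le_pow_clog (by norm_num) _

theorem wordBound_le {m : ℕ} {X : ℝ} (hn : 1 ≤ n) (hDn : D ≤ n) (hX : 2 ≤ X)
    (h1 : (n : ℝ) ≤ X) (h2 : (n : ℝ) * n ≤ X) (h3 : (n : ℝ) ^ D ≤ X)
    (hm : (m : ℝ) * (n + 1) ≤ 45064 * X) :
    ((2 + n * n + 32 * (wordBound n D m + 1) : ℕ) : ℝ) ≤ 2 ^ 23 * X := by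
  have h4 := pow_succ_le hn hDn
  have hn' : (1 : ℝ) ≤ n := by exact_mod_cast hn
  have h5 : (2 : ℝ) ^ D ≤ ((n : ℝ) + 1) ^ D := pow_le_pow_left₀ (by norm_num) (by linarith) _
  have h6 : ((2 + n * n + 32 * (wordBound n D m + 1) : ℕ) : ℝ) = 2 + (n : ℝ) * n +
      32 * (4 * 2 ^ D + ((n : ℝ) + 1) ^ D + 4 * ((m : ℝ) * (n + 1) + n + 1) + 1) := by
    rw [wordBound]
    push_cast
    ring
  rw [h6]
  linarith

theorem wordLength_le (hn : 1 ≤ n) (hγ : 0 < γ) (hγ1 : γ ≤ 1) :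
    (wordLength n d γ : ℝ) ≤ 25 * Real.logb 2 (2 + d + n ^ (d + 3) / γ ^ 2) := by
  have hYX : scale n (min d n) γ ≤ 2 + d + n ^ (d + 3) / γ ^ 2 := by
    have := scale_min_le (n := n) (d := d) (γ := γ) hn
    have hd : (0 : ℝ) ≤ d := by positivity
    linarith
  have hX2 : 2 ≤ 2 + d + (n : ℝ) ^ (d + 3) / γ ^ 2 := by
    have : (0 : ℝ) ≤ n ^ (d + 3) / γ ^ 2 := by positivity
    have hd : (0 : ℝ) ≤ d := by positivity
    linarith
  generalize 2 + d + (n : ℝ) ^ (d + 3) / γ ^ 2 = X at hYX hX2 ⊢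
  have hY : ∀ k ≤ min d n + 3, (n : ℝ) ^ k ≤ X := fun k hk => (le_scale hn hγ hγ1 hk).trans hYX
  have hZX := wordBound_le hn (min_le_right d n) hX2 (by simpa using hY 1 (by omega))
    (by simpa [pow_two] using hY 2 (by omega)) (hY _ (by omega))
    ((sampleSize_mul_le (d := d) hn hγ hγ1 rfl).trans
      (mul_le_mul_of_nonneg_left hYX (by norm_num)))
  have hZ1 : 1 ≤ 2 + n * n + 32 * (wordBound n (min d n) (sampleSize n d γ) + 1) := by omega
  unfold wordLength
  generalize 2 + n * n + 32 * (wordBound n (min d n) (sampleSize n d γ) + 1) = Z at hZX hZ1 ⊢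
  have hZ1' : (1 : ℝ) ≤ Z := by exact_mod_cast hZ1
  -- Since `2 ≤ X`, the constant `2 ^ 23` is at most `X ^ 23`. Rounding up the logarithm costs one
  -- more `logb 2 X`, which makes `25`.
  have hZX' : (Z : ℝ) ≤ X ^ 24 := by
    refine hZX.trans ?_
    rw [pow_succ X 23]
    exact mul_le_mul_of_nonneg_right (pow_le_pow_left₀ (by norm_num) hX2 _) (by linarith)
  have hlogX : 1 ≤ Real.logb 2 X := by
    rw [Real.le_logb_iff_rpow_le (by norm_num) (by linarith), Real.rpow_one]
    exact hX2
  have hlogZ : Real.logb 2 Z ≤ 24 * Real.logb 2 X := by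
    refine (Real.logb_le_logb_of_le (by norm_num) (by linarith) hZX').trans (le_of_eq ?_)
    rw [Real.logb_pow, Nat.cast_ofNat]
  have hclog := (Nat.ceil_lt_add_one (a := Real.logb (2 : ℕ) Z)
    (by rw [Nat.cast_ofNat]; exact Real.logb_nonneg (by norm_num) hZ1')).le
  rw [Real.natCeil_logb_natCast, Nat.cast_ofNat] at hclog
  linarith

end Bounds

theorem mainTheorem4 :
    ∃ (prog : Prog) (C : ℝ), 0 < C ∧
      ∀ (n d : ℕ) (γ : ℝ) (S : BayesStructure n),
        1 ≤ n → 0 < γ → γ ≤ 1 → S.DegreeAtMost d →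
        ∃ m w : ℕ,
          (m : ℝ) ≤ C * (2 ^ d + d * Real.logb 2 n) / γ ^ 2 ∧
          (w : ℝ) ≤ C * Real.logb 2 (2 + d + n ^ (d + 3) / γ ^ 2) ∧
          (∀ ω : Fin m → Cube n, ∃ s t, Exec w prog (startState S d γ ω) s t ∧
            (t : ℝ) ≤ C * n ^ (d + 3) / γ ^ 2) ∧
          ∀ (P : PMF (Cube n)) (S' : BayesStructure n),
            S'.DegreeAtMost d → IsBayesNet P S' → S'.numEdges ≤ S.numEdges →
            (IsBayesNet P S ∧ NonDegenerate P γ S d →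
              (99 / 100 : ℝ) ≤ (sampleLaw P m).real {ω | Accepts prog w S d γ ω}) ∧
            (¬ IsBayesNet P S →
              (99 / 100 : ℝ) ≤ (sampleLaw P m).real {ω | Rejects prog w S d γ ω}) := by
  have hexp := Real.exp_pos 16
  -- The constant is dictated by the running time; those for samples and word length are far
  -- smaller.
  refine ⟨Prog.tester, 2000000000 + 2000000000 * Real.exp 16, by positivity, ?_⟩
  intro n d γ S hn hγ hγ1 hd
  have hn' : (1 : ℝ) ≤ n := by exact_mod_cast hn
  have hex := fun ω : Fin (sampleSize n d γ) → Cube n =>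
    exec_tester (S := S) (ω := ω) le_two_pow_wordLength (le_refl _) hn hγ rfl rfl
  have hmono : ∀ (P : PMF (Cube n)) {A B : Set (Fin (sampleSize n d γ) → Cube n)}, A ⊆ B →
      (sampleLaw P (sampleSize n d γ)).real A ≤ (sampleLaw P (sampleSize n d γ)).real B := by
    intro P A B hAB
    have := sampleLaw_isProbabilityMeasure P (sampleSize n d γ)
    exact MeasureTheory.measureReal_mono hAB
  refine ⟨sampleSize n d γ, wordLength n d γ, ?_, ?_, fun ω => ?_, fun P S' hd' hP hE => ⟨?_, ?_⟩⟩
  · have hlog : 0 ≤ Real.logb 2 n := Real.logb_nonneg (by norm_num) hn'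
    refine (sampleSize_le_logb hn hγ hγ1).trans ?_
    gcongr
    linarith
  · have hX : (1 : ℝ) ≤ 2 + d + n ^ (d + 3) / γ ^ 2 := by
      have : (0 : ℝ) ≤ d + n ^ (d + 3) / γ ^ 2 := by positivity
      linarith
    refine (wordLength_le hn hγ hγ1).trans
      (mul_le_mul_of_nonneg_right (by linarith) (Real.logb_nonneg (by norm_num) hX))
  · obtain ⟨s, t, h, ht, _⟩ := hex ω
    refine ⟨s, t, h, (Nat.cast_le.2 ht).trans ((testerTime_le hn hγ hγ1 rfl).trans ?_)⟩
    rw [mul_div_assoc]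
    exact mul_le_mul_of_nonneg_left (scale_min_le hn) (by positivity)
  -- Acceptance and rejection are both deduced on the event `GoodSamples`, on which the verdict is
  -- determined.
  · rintro ⟨_, hnd⟩
    refine (sampleLaw_real_goodSamples hd hγ (le_sampleSize_mul hγ) P).trans (hmono P ?_)
    intro ω hω
    obtain ⟨s, t, h, _, hs⟩ := hex ω
    exact ⟨s, t, h, hs.2 (testPasses_of_nonDegenerate (sampleSize_pos hγ) hnd hω)⟩
  · intro hnot
    refine (sampleLaw_real_goodSamples hd hγ (le_sampleSize_mul hγ) P).trans (hmono P ?_)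
    intro ω hω
    obtain ⟨s, t, h, _, hs⟩ := hex ω
    refine ⟨s, t, h, ?_⟩
    by_contra h0
    exact not_testPasses_of_not_isBayesNet (sampleSize_pos hγ) hd' hP hE hnot hω (hs.1 h0)
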